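/- Let $X$ be a noetherian scheme. Write $\mathbf{D}(\operatorname{Qcoh} X)$ for the derived category of the abelian category of quasi-coherent sheaves on $X$, $\mathbf{D}^b_{\mathrm{coh}}(X)$ for its objects with bounded cohomology and coherent cohomology sheaves, and $\mathbf{K}(\operatorname{Inj}\text{-}X)$ for the homotopy category of (unbounded) complexes of injective objects of $\operatorname{Qcoh}(X)$. Notation. For an object $G$ of a triangulated category $\mathsf{T}$ with small coproducts and $-\infty\le a\le b\le\infty$, let $G[a,b]=\{\Sigma^{-i}G : i\in\mathbb{Z},\ a\le i\le b\}$. Let $\operatorname{Coprod}_1(G[a,b])$ be the class of all small coproducts of objects of $G[a,b]$, and let $\operatorname{Coprod}_{n+1}(G[a,b])$ be the class of objects $B$ admitting a triangle $A\to B\to C\to\Sigma A$ with $A\in\operatorname{Coprod}_1(G[a,b])$ and $C\in\operatorname{Coprod}_n(G[a,b])$. Let $\overline{\langle G\rangle}{}^{[a,b]}_n$ be the closure of $\operatorname{Coprod}_n(G[a,b])$ under direct summands, and $\overline{\langle G\rangle}_n=\overline{\langle G\rangle}{}^{(-\infty,\infty)}_n$. A co-t-structure on $\mathsf{T}$ is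 a pair $(\mathsf{U},\mathsf{V})$ of strictly full subcategories closed under direct summands such that $\Sigma^{-1}\mathsf{U}\subseteq\mathsf{U}$, $\Sigma\mathsf{V}\subseteq\mathsf{V}$, $\operatorname{Hom}(\mathsf{U},\Sigma\mathsf{V})=0$, and every $t\in\mathsf{T}$ admits a triangle $u\to t\to v\to\Sigma u$ with $u\in\mathsf{U}$ and $v\in\Sigma\mathsf{V}$. A compact generator of $\mathsf{T}$ is a compact object $H$ such that every $Y\in\mathsf{T}$ with $\operatorname{Hom}(\Sigma^nH,Y)=0$ for all $n\in\mathbb{Z}$ is zero. A triangulated category $\mathsf{T}$ with small coproducts is co-approximable via the co-t-structure $(\mathsf{U},\mathsf{V})$ if there are a compact generator $H$ and an integer $A>0$ such that 1. $\Sigma^{-A}H\in\mathsf{U}$; 2. $\operatorname{Hom}(\Sigma^AH,F)=0$ for all $F\in\mathsf{U}$; 3. every $F\in\mathsf{U}$ admits a triangle $E\to F\to D\to\Sigma E$ with $D\in\Sigma^{-1}\mathsf{U}$ and $E\in\overline{\langle H\rangle}{}^{[-A,A]}_A$; and it is co-approximable if it is so via some co-t-structure. Theorem. Assume that there are an object $G\in\mathbf{D}^b_{\mathrm{coh}}(X)$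 and a positive integer $N$ such that $\mathbf{D}(\operatorname{Qcoh} X)=\overline{\langle G\rangle}_N$. Then $\mathbf{K}(\operatorname{Inj}\text{-}X)$ has small coproducts and is co-approximable. More precisely, let $\mathbf{K}(\operatorname{Inj}\text{-}X)^{\ge 0}$ (respectively $\mathbf{K}(\operatorname{Inj}\text{-}X)^{\le 0}$) consist of the objects isomorphic to a complex of injectives concentrated in degrees $\ge 0$ (respectively $\le 0$). Then $(\mathbf{K}(\operatorname{Inj}\text{-}X)^{\ge 0},\mathbf{K}(\operatorname{Inj}\text{-}X)^{\le 0})$ is a co-t-structure, and $\mathbf{K}(\operatorname{Inj}\text{-}X)$ is co-approximable via it. -/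

import Mathlib

universe w u v₁ v₂

open CategoryTheory Limits AlgebraicGeometry Opposite TopologicalSpace ZeroObject Pretriangulated

/-! ### Generation, compact generators and co-t-structures in triangulated categories -/

namespace CoApprox

section

variable {T : Type v₁} [Category.{v₂} T] [HasZeroObject T] [HasShift T ℤ] [Preadditive T]
  [∀ n : ℤ, (shiftFunctor T n).Additive] [Pretriangulated T]

/-- `G[S]`: the objects isomorphic to `Σ^{-i} G` for some `i ∈ S`. -/
def shiftsIn (G : T) (S : Set ℤ) : ObjectProperty T :=
  fun Y => ∃ i ∈ S, Nonempty (Y ≅ G⟦-i⟧)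

/-- `Add(P)`: all (existing) coproducts of `w`-small families of objects of `P`. -/
def bigAdd (P : ObjectProperty T) : ObjectProperty T :=
  fun Y => ∃ I : Type w, P.colimitsOfShape (Discrete I) Y

/-- `Coprod_n(P)`: `Coprod_1(P) = Add(P)` and `Coprod_{n+1}(P) = Coprod_1(P) ⋆ Coprod_n(P)`,
where `A ⋆ C` consists of the objects `B` in a triangle `a → B → c → Σa` with `a ∈ A`, `c ∈ C`.
By convention `Coprod_0(P)` consists of the zero objects. -/
def bigCoprod (P : ObjectProperty T) : ℕ → ObjectProperty T
  | 0 => fun Y => IsZero Y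
  | n + 1 => (bigAdd.{w} P).extensionProductIter n

/-- The closure of `Coprod_n(G[S])` under direct summands; for `S = [a, b]` this is the category
usually written `⟨G⟩̄_n^{[a,b]}`, and for `S = ℤ` it is `⟨G⟩̄_n`. -/
def bigGen (G : T) (S : Set ℤ) (n : ℕ) : ObjectProperty T :=
  (bigCoprod.{w} (shiftsIn G S) n).retractClosure

/-- `G` is compact: `Hom(G, -)` preserves `w`-small coproducts. -/
def IsCompactObj (G : T) : Prop :=
  ∀ I : Type w, PreservesColimitsOfShape (Discrete I) (preadditiveCoyoneda.obj (op G))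

/-- `G` is a compact generator: it is compact, and an object which receives only zero morphisms
from all the shifts of `G` is zero. -/
structure IsCompactGenerator (G : T) : Prop where
  compact : IsCompactObj.{w} G
  isZero (Y : T) (h : ∀ (n : ℤ) (f : G⟦n⟧ ⟶ Y), f = 0) : IsZero Y

/-- `(U, V)` is a co-t-structure (weight structure), with `U = T^{≥ 0}` and `V = T^{≤ 0}`. -/
structure IsCoTStructure (U V : ObjectProperty T) : Prop where
  left_retracts : U.IsStableUnderRetracts
  right_retracts : V.IsStableUnderRetracts
  left_shift (Y : T) : U Y → U (Y⟦(-1 : ℤ)⟧)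
  right_shift (Y : T) : V Y → V (Y⟦(1 : ℤ)⟧)
  hom_eq_zero (Y Z : T) (f : Y ⟶ Z⟦(1 : ℤ)⟧) : U Y → V Z → f = 0
  exists_triangle (Y : T) : ∃ (A B : T) (f : A ⟶ Y) (g : Y ⟶ B⟦(1 : ℤ)⟧)
    (h : B⟦(1 : ℤ)⟧ ⟶ A⟦(1 : ℤ)⟧),
    Triangle.mk f g h ∈ distTriang T ∧ U A ∧ V B

/-- The triangulated category `T` (which is required to have `w`-small coproducts) is
co-approximable by means of the co-t-structure `(U, V)`. -/
structure IsCoapproximableVia (U V : ObjectProperty T) : Prop where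
  hasCoproducts : HasCoproducts.{w} T
  isCoTStructure : IsCoTStructure U V
  exists_generator : ∃ (G : T) (A : ℕ), IsCompactGenerator.{w} G ∧ 0 < A ∧
    U (G⟦-(A : ℤ)⟧) ∧
    (∀ (F : T) (f : G⟦(A : ℤ)⟧ ⟶ F), U F → f = 0) ∧
    (∀ F : T, U F → ∃ (E D : T) (f : E ⟶ F) (g : F ⟶ D) (h : D ⟶ E⟦(1 : ℤ)⟧),
      Triangle.mk f g h ∈ distTriang T ∧ U (D⟦(1 : ℤ)⟧) ∧
        bigGen.{w} G (Set.Icc (-(A : ℤ)) A) A E)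

variable (T) in
/-- `T` is co-approximable. -/
def IsCoapproximable : Prop :=
  ∃ U V : ObjectProperty T, IsCoapproximableVia.{w} U V

end

end CoApprox

/-! ### Quasi-coherent sheaves form an abelian category, and the category `K(Inj-X)` -/

namespace AlgebraicGeometry.Scheme

/-- The quasi-coherent sheaves among all sheaves of `𝒪_X`-modules. -/
def isQCoh (X : Scheme.{u}) : ObjectProperty X.Modules := fun M => M.IsQuasicoherent

lemma isQCoh.of_iso {X : Scheme.{u}} {M N : X.Modules} (e : M ≅ N) (h : X.isQCoh M) : X.isQCoh N :=
  (SheafOfModules.isQuasicoherent X.ringCatSheaf).prop_of_iso e h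

instance (X : Scheme.{u}) : (isQCoh X).IsClosedUnderIsomorphisms where
  of_iso e h := isQCoh.of_iso e h

instance {X Y : Scheme.{u}} (f : X ⟶ Y) [IsOpenImmersion f] :
    PreservesLimits (Modules.restrictFunctor f) := by
  have : PreservesLimits ((Functor.whiskeringLeft X.Opensᵒᵖ (Y.Opens)ᵒᵖ Ab.{u}).obj f.opensFunctor.op) := by
    constructor
    intro J _
    infer_instance
  have : PreservesLimits (Modules.restrictFunctor f ⋙ Modules.toPresheaf X) :=
    comp_preservesLimits (Modules.toPresheaf Y) ((Functor.whiskeringLeft X.Opensᵒᵖ (Y.Opens)ᵒᵖ Ab.{u}).obj f.opensFunctor.op)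
  have : ReflectsLimits (Modules.toPresheaf X) := reflectsLimits_of_reflectsIsomorphisms
  exact preservesLimits_of_reflects_of_preserves _ (Modules.toPresheaf X)

lemma isQCoh_of_affine {X : Scheme.{u}} (M : X.Modules)
    (h : ∀ U : X.Opens, IsAffineOpen U →
      Nonempty (M.restrict U.ι).Presentation) : X.isQCoh M := by
  refine SheafOfModules.QuasicoherentData.isQuasicoherent.{u} (M := M)
    { I := X.affineOpens, X := fun U => U.1, coversTop := ?_, presentation := fun U => ?_ }
  · rw [Opens.coversTop_iff]
    exact iSup_affineOpens_eq_top _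
  · have P := (h U.1 U.2).some
    let E : SheafOfModules (X.ringCatSheaf.over U.1) ≌
      SheafOfModules (U.1 : Scheme.{u}).ringCatSheaf := Modules.overEquiv U.1
    have : PreservesColimitsOfSize.{u, u} E.inverse :=
      E.symm.toAdjunction.leftAdjoint_preservesColimits
    let P' := SheafOfModules.Presentation.map P E.inverse (E.unitIso.app _)
    exact SheafOfModules.Presentation.ofIsIso.{u, u, u} (E.inverse.mapIso ((Modules.overFunctorEquiv U.1).symm.app M) ≪≫ (E.unitIso.app _).symm).hom P'

lemma exists_iso_tilde {R : CommRingCat.{u}} (M : (Spec R).Modules) (hM : (Spec R).isQCoh M) :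
    ∃ A : ModuleCat.{u} R, Nonempty ((tilde.functor R).obj A ≅ M) := by
  have h : (tilde.functor R).essImage M := by
    rw [essImage_tilde]; exact hM
  exact h

lemma isQCoh_cokernel_Spec {R : CommRingCat.{u}} {M N : (Spec R).Modules} (f : M ⟶ N)
    (hM : (Spec R).isQCoh M) (hN : (Spec R).isQCoh N) : (Spec R).isQCoh (cokernel f) := by
  obtain ⟨A, ⟨a⟩⟩ := exists_iso_tilde M hM
  obtain ⟨B, ⟨b⟩⟩ := exists_iso_tilde N hN
  let g := (tilde.functor R).preimage (a.hom ≫ f ≫ b.inv)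
  have hg : (tilde.functor R).map g = a.hom ≫ f ≫ b.inv := Functor.map_preimage _ _
  let iso : cokernel ((tilde.functor R).map g) ≅ cokernel f :=
    cokernel.mapIso _ _ a b (by rw [hg]; simp)
  exact isQCoh.of_iso (PreservesCokernel.iso (tilde.functor R) g ≪≫ iso)
    (inferInstanceAs (tilde (cokernel g)).IsQuasicoherent)

lemma kernel_app_exact {X : Scheme.{u}} {M N : X.Modules} (φ : M ⟶ N) (U : X.Opens) :
    (∀ x : Γ(kernel φ, U), (kernel.ι φ).app U x = 0 → x = 0) ∧
    ∀ y : Γ(M, U), φ.app U y = 0 → ∃ x : Γ(kernel φ, U), (kernel.ι φ).app U x = y := by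
  let F : X.Modules ⥤ Ab.{u} := Modules.toPresheaf X ⋙ (CategoryTheory.evaluation _ _).obj (op U)
  have : F.PreservesZeroMorphisms := ⟨fun _ _ => rfl⟩
  have h1 : PreservesLimits ((CategoryTheory.evaluation X.Opensᵒᵖ Ab.{u}).obj (op U)) :=
    ⟨inferInstance⟩
  have h2 : PreservesLimits F := comp_preservesLimits _ _
  have hl := KernelFork.mapIsLimit _ (kernelIsKernel φ) F
  have hw : F.map (kernel.ι φ) ≫ F.map φ = 0 := by rw [← F.map_comp]; simp
  constructor
  · have hmono : Mono (F.map (kernel.ι φ)) := Fork.IsLimit.mono hl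
    rw [AddCommGrpCat.mono_iff_injective] at hmono
    intro x hx
    exact hmono (hx.trans (map_zero (F.map (kernel.ι φ)).hom).symm)
  · have hex := ShortComplex.exact_of_f_is_kernel (ShortComplex.mk _ _ hw) hl
    rw [ShortComplex.ab_exact_iff] at hex
    exact hex

lemma isQCoh_Spec_iff {R : CommRingCat.{u}} (M : (Spec R).Modules) :
    (Spec R).isQCoh M ↔ ∀ (r : R) (U : (Spec R).Opens), U = PrimeSpectrum.basicOpen r →
      (∀ x : Γ(M, U), ∃ (n : ℕ) (y : Γ(M, ⊤)), r ^ n • x = M.presheaf.map U.leTop.op y) ∧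
      (∀ y : Γ(M, ⊤), M.presheaf.map U.leTop.op y = 0 → ∃ n : ℕ, r ^ n • y = 0) := by
  refine ((isQuasicoherent_iff_isIso_fromTildeΓ M).trans
    (isIso_fromTildeΓ_iff_isLocalizing M)).trans ⟨?_, ?_⟩
  · rintro h r _ rfl
    have h1 : IsLocalizedModule.Away r _ := h r
    refine ⟨h1.surj _ _, fun y hy => ?_⟩
    obtain ⟨⟨_, m, rfl⟩, hm⟩ := (IsLocalizedModule.eq_zero_iff (.powers r)
      ((modulesSpecToSheaf.obj M).obj.map (PrimeSpectrum.basicOpen r).leTop.op).hom).mp hy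
    exact ⟨m, hm⟩
  · intro h r
    refine IsLocalizedModule.Away.mk_of_addCommGroup ?_ (h r _ rfl).1 (h r _ rfl).2
    exact Scheme.Modules.isUnit_algebraMap_end_of_le_basicOpen r le_rfl

lemma isQCoh_kernel_Spec {R : CommRingCat.{u}} {M N : (Spec R).Modules} (φ : M ⟶ N)
    (hM : (Spec R).isQCoh M) (hN : (Spec R).isQCoh N) : (Spec R).isQCoh (kernel φ) := by
  have nat {A B : (Spec R).Modules} (ψ : A ⟶ B) {U V : (Spec R).Opens} (i : U ⟶ V)
      (x : Γ(A, V)) : ψ.app U (A.presheaf.map i.op x) = B.presheaf.map i.op (ψ.app V x) :=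
    congr($(ψ.mapPresheaf.naturality i.op) x)
  have lin {A B : (Spec R).Modules} (ψ : A ⟶ B) (U : (Spec R).Opens) (r : R)
      (x : Γ(A, U)) : ψ.app U (r • x) = r • ψ.app U x := by
    rw [Modules.smul_Spec_def, Modules.smul_Spec_def, Modules.Hom.app_smul]
  rw [isQCoh_Spec_iff] at hM hN ⊢
  intro r U hU
  constructor
  · intro x
    obtain ⟨n, y, hy⟩ := (hM r U hU).1 ((kernel.ι φ).app _ x)
    have hz : N.presheaf.map U.leTop.op (φ.app _ y) = 0 := by
      have : φ.app U ((kernel.ι φ).app _ x) = 0 :=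
        congr(Modules.Hom.app $(kernel.condition φ) U x)
      rw [← nat, ← hy, lin, this, smul_zero]
    obtain ⟨m, hm⟩ := (hN r U hU).2 _ hz
    obtain ⟨z, hz⟩ := (kernel_app_exact φ ⊤).2 (r ^ m • y) (by rw [lin]; exact hm)
    refine ⟨m + n, z, ?_⟩
    rw [← sub_eq_zero]
    apply (kernel_app_exact φ _).1
    rw [map_sub, sub_eq_zero, lin, nat, hz, Modules.map_smul_Spec, pow_add, mul_smul, hy]
  · intro x hx
    have : M.presheaf.map U.leTop.op ((kernel.ι φ).app _ x) = 0 := by rw [← nat, hx, map_zero]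
    obtain ⟨m, hm⟩ := (hM r U hU).2 _ this
    refine ⟨m, (kernel_app_exact φ _).1 _ ?_⟩
    rw [lin]; exact hm


lemma nonempty_presentation_of_iso {X : Scheme.{u}} {M N : X.Modules} (e : M ≅ N)
    (h : Nonempty (SheafOfModules.Presentation M)) : Nonempty (SheafOfModules.Presentation N) := by
  have : IsIso (C := SheafOfModules X.ringCatSheaf) e.hom :=
    ⟨e.inv, e.hom_inv_id, e.inv_hom_id⟩
  exact ⟨SheafOfModules.Presentation.ofIsIso.{u, u, u} e.hom h.some⟩

lemma isQCoh_of_restrict_fromSpec {X : Scheme.{u}} (M : X.Modules)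
    (h : ∀ (U : X.Opens) (hU : IsAffineOpen U),
      (Spec Γ(X, U)).isQCoh ((Modules.restrictFunctor hU.fromSpec).obj M)) : X.isQCoh M := by
  refine isQCoh_of_affine M fun U hU => ?_
  obtain ⟨A, ⟨a⟩⟩ := exists_iso_tilde _ (h U hU)
  have P : (tilde A).Presentation :=
    presentationTilde.{u} A .univ (by simp) _ (Submodule.span_eq _)
  have P' : SheafOfModules.Presentation (M.restrict hU.fromSpec) :=
    (nonempty_presentation_of_iso a ⟨P⟩).some
  have e : (M.restrict hU.fromSpec).restrict hU.isoSpec.hom ≅ M.restrict U.ι :=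
    ((Modules.restrictFunctorComp hU.isoSpec.hom hU.fromSpec).app M).symm ≪≫
      (Modules.restrictFunctorCongr (by simp)).app M
  exact nonempty_presentation_of_iso e ⟨Modules.presentationRestrict hU.isoSpec.hom P'⟩

lemma isQCoh_restrict {X Y : Scheme.{u}} (f : X ⟶ Y) [IsOpenImmersion f] {M : Y.Modules}
    (hM : Y.isQCoh M) : X.isQCoh ((Modules.restrictFunctor f).obj M) :=
  have : M.IsQuasicoherent := hM
  Modules.isQuasicoherent_restrictFunctor f M

instance {X Y : Scheme.{u}} (f : X ⟶ Y) [IsOpenImmersion f] :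
    (Modules.restrictFunctor f).PreservesZeroMorphisms := ⟨fun _ _ => rfl⟩

instance (X : Scheme.{u}) : (isQCoh X).IsClosedUnderKernels where
  kernels_le := by
    rintro _ ⟨φ, k, hk, hφ⟩
    refine isQCoh.of_iso (IsLimit.conePointUniqueUpToIso (kernelIsKernel φ) hk) ?_
    refine isQCoh_of_restrict_fromSpec _ fun U hU => ?_
    exact isQCoh.of_iso (PreservesKernel.iso (Modules.restrictFunctor hU.fromSpec) φ).symm
      (isQCoh_kernel_Spec _ (isQCoh_restrict _ hφ.1) (isQCoh_restrict _ hφ.2))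

instance (X : Scheme.{u}) : (isQCoh X).IsClosedUnderCokernels where
  cokernels_le := by
    rintro _ ⟨φ, k, hk, hφ⟩
    refine isQCoh.of_iso (IsColimit.coconePointUniqueUpToIso (cokernelIsCokernel φ) hk) ?_
    refine isQCoh_of_restrict_fromSpec _ fun U hU => ?_
    exact isQCoh.of_iso (PreservesCokernel.iso (Modules.restrictFunctor hU.fromSpec) φ).symm
      (isQCoh_cokernel_Spec _ (isQCoh_restrict _ hφ.1) (isQCoh_restrict _ hφ.2))

instance (X : Scheme.{u}) : (isQCoh X).ContainsZero where
  exists_zero := by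
    refine ⟨_, isZero_zero X.Modules, isQCoh_of_restrict_fromSpec _ fun U hU => ?_⟩
    have h1 : IsZero ((Modules.restrictFunctor hU.fromSpec).obj (0 : X.Modules)) :=
      Functor.map_isZero _ (isZero_zero _)
    have h2 : IsZero ((tilde.functor Γ(X, U)).obj (0 : ModuleCat _)) :=
      Functor.map_isZero _ (isZero_zero _)
    exact isQCoh.of_iso (h2.iso h1)
      (inferInstanceAs (tilde (0 : ModuleCat Γ(X, U))).IsQuasicoherent)

lemma isQCoh_prod_Spec {R : CommRingCat.{u}} {M N : (Spec R).Modules}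
    (hM : (Spec R).isQCoh M) (hN : (Spec R).isQCoh N) : (Spec R).isQCoh (M ⨯ N) := by
  obtain ⟨A, ⟨a⟩⟩ := exists_iso_tilde M hM
  obtain ⟨B, ⟨b⟩⟩ := exists_iso_tilde N hN
  have := preservesBinaryBiproducts_of_preservesBinaryCoproducts (tilde.functor R)
  have := preservesBinaryProducts_of_preservesBinaryBiproducts (tilde.functor R)
  exact isQCoh.of_iso (PreservesLimitPair.iso (tilde.functor R) A B ≪≫ prod.mapIso a b)
    (inferInstanceAs (tilde (A ⨯ B)).IsQuasicoherent)

instance (X : Scheme.{u}) : (isQCoh X).IsClosedUnderBinaryProducts where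
  limitsOfShape_le := by
    rintro M ⟨p⟩
    let e : p.diag.obj ⟨.left⟩ ⨯ p.diag.obj ⟨.right⟩ ≅ M :=
      HasLimit.isoOfNatIso (diagramIsoPair p.diag).symm ≪≫
        IsLimit.conePointUniqueUpToIso (limit.isLimit _) p.isLimit
    refine isQCoh.of_iso e (isQCoh_of_restrict_fromSpec _ fun U hU => ?_)
    have : PreservesLimitsOfSize.{0, 0} (Modules.restrictFunctor hU.fromSpec) :=
      preservesLimitsOfSize_shrink _
    exact isQCoh.of_iso (PreservesLimitPair.iso (Modules.restrictFunctor hU.fromSpec) _ _).symm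
      (isQCoh_prod_Spec (isQCoh_restrict _ (p.prop_diag_obj _))
        (isQCoh_restrict _ (p.prop_diag_obj _)))

instance (X : Scheme.{u}) : (isQCoh X).IsClosedUnderFiniteProducts := .mk'

/-- The abelian category `Qcoh(X)` of quasi-coherent sheaves on `X`. -/
abbrev QCoh (X : Scheme.{u}) : Type (u + 1) := (isQCoh X).FullSubcategory

/-- `G ∈ D(Qcoh X)` lies in `D^b_coh(X)`: it has bounded cohomology, and all its cohomology sheaves
are coherent. On a locally noetherian scheme, a quasi-coherent sheaf is coherent if and only if it
is of finite type. -/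
def IsBoundedCoherent {X : Scheme.{u}} [HasDerivedCategory.{w} X.QCoh]
    (G : DerivedCategory X.QCoh) : Prop :=
  (∃ a b : ℤ, G.IsGE a ∧ G.IsLE b) ∧
    ∀ n : ℤ, ((DerivedCategory.homologyFunctor X.QCoh n).obj G).obj.IsFiniteType

/-- `K(Inj-X)`: the homotopy category of (unbounded) complexes of injective objects
of `Qcoh(X)`. -/
abbrev KInj (X : Scheme.{u}) : Type (u + 1) :=
  HomotopyCategory (InjectiveObject X.QCoh) (ComplexShape.up ℤ)

/-- `K(Inj-X)^{≥ 0}`: the objects of `K(Inj-X)` isomorphic (that is, homotopy equivalent) to a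
complex of injectives concentrated in degrees `≥ 0`. -/
def kInjGE (X : Scheme.{u}) : ObjectProperty X.KInj :=
  fun K => ∃ L : CochainComplex (InjectiveObject X.QCoh) ℤ, L.IsStrictlyGE 0 ∧
    Nonempty (K ≅ (HomotopyCategory.quotient _ _).obj L)

/-- `K(Inj-X)^{≤ 0}`: the objects of `K(Inj-X)` isomorphic (that is, homotopy equivalent) to a
complex of injectives concentrated in degrees `≤ 0`. -/
def kInjLE (X : Scheme.{u}) : ObjectProperty X.KInj :=
  fun K => ∃ L : CochainComplex (InjectiveObject X.QCoh) ℤ, L.IsStrictlyLE 0 ∧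
    Nonempty (K ≅ (HomotopyCategory.quotient _ _).obj L)

end AlgebraicGeometry.Scheme

/-!
Complexes of injectives `L` which are bounded below embed fully faithfully into the derived
category, and for such `L` the vanishing of `Hom(K, L)` can be tested there. The co-t-structure is
given by brutal truncations; these split degreewise.

If an object of the derived category with cohomology in a fixed bounded range is a direct summand
of an object built in `N` steps from shifts of `G`, all shifts of `G` whose cohomology lies far away
from this range can be discarded. So these objects are built in `N` steps from finitely many shifts
of `G`, uniformly. Resolving each step by injectives, the same holds in `K(Inj-X)` for the injective
resolution `H` of `G`. As every complex of injectives in degrees `≥ 0` is an extension of a complex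
of injectives in degrees `≥ 1` by an injective resolution of its `0`-th cohomology, this is the
approximation by `H` that has to be shown.

Morphisms from an injective resolution of a sheaf `M` to a complex of injectives `Y` are the
morphisms from `M` to `Y` up to homotopy. Hence `H` is compact, as morphisms from a coherent sheaf
to a coproduct factor through finite subcoproducts. If all morphisms from the shifts of `H` to `Y`
vanish, then so do those from the resolution of any quasi-coherent sheaf, and applying this to the
sheaves of cycles of `Y` shows that `Y` is contractible.

On a noetherian scheme, coproducts of injective quasi-coherent sheaves are injective because every
quasi-coherent sheaf embeds into a finite sum of direct images of injective modules over the
functions of affine open subsets, and direct images commute with coproducts.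
-/

namespace CoApprox

/-! ### Finitely supported morphisms to coproducts -/

section FiniteSupport

variable {C : Type v₁} [Category.{v₂} C] [Preadditive C]

section

variable {I : Type*} {Y : I → C} {c : Cofan Y} (hc : IsColimit c)

/-- The projection of a coproduct onto one of its summands. -/
noncomputable def cofanProj (i : I) : c.pt ⟶ Y i :=
  open Classical in
  Cofan.IsColimit.desc hc fun j => if h : j = i then eqToHom (by rw [h]) else 0

@[simp]
lemma inj_cofanProj (i : I) : c.inj i ≫ cofanProj hc i = 𝟙 _ := by
  simp [cofanProj]

lemma inj_cofanProj_of_ne {i j : I} (h : j ≠ i) : c.inj j ≫ cofanProj hc i = 0 := by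
  simp [cofanProj, h]

/-- The idempotent endomorphism of a coproduct which projects onto finitely many summands. It is
used to express that a morphism to a coproduct factors through a finite subcoproduct without
having to choose the latter. -/
noncomputable def cofanTrunc (S : Finset I) : c.pt ⟶ c.pt :=
  ∑ i ∈ S, cofanProj hc i ≫ c.inj i

lemma inj_cofanTrunc_of_mem {S : Finset I} {i : I} (hi : i ∈ S) :
    c.inj i ≫ cofanTrunc hc S = c.inj i := by
  rw [cofanTrunc, Preadditive.comp_sum, Finset.sum_eq_single_of_mem i hi, ← Category.assoc,
    inj_cofanProj, Category.id_comp]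
  intro j _ hj
  rw [← Category.assoc, inj_cofanProj_of_ne hc hj.symm, zero_comp]

lemma inj_cofanTrunc_of_notMem {S : Finset I} {i : I} (hi : i ∉ S) :
    c.inj i ≫ cofanTrunc hc S = 0 := by
  rw [cofanTrunc, Preadditive.comp_sum]
  refine Finset.sum_eq_zero fun j hj => ?_
  rw [← Category.assoc, inj_cofanProj_of_ne hc (ne_of_mem_of_not_mem hj hi).symm, zero_comp]

lemma cofanTrunc_comp_of_subset {S S' : Finset I} (h : S ⊆ S') :
    cofanTrunc hc S ≫ cofanTrunc hc S' = cofanTrunc hc S := by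
  rw [cofanTrunc, Preadditive.sum_comp]
  refine Finset.sum_congr rfl fun i hi => ?_
  rw [Category.assoc, inj_cofanTrunc_of_mem hc (h hi)]

lemma comp_cofanTrunc_of_subset {G : C} {f : G ⟶ c.pt} {S S' : Finset I} (h : S ⊆ S')
    (hf : f ≫ cofanTrunc hc S = f) : f ≫ cofanTrunc hc S' = f := by
  rw [← hf, Category.assoc, cofanTrunc_comp_of_subset hc h]

lemma cofanTrunc_comp_of_forall_inj_comp {c' : Cofan Y} (hc' : IsColimit c') {f : c.pt ⟶ c'.pt}
    (hf : ∀ i, c.inj i ≫ f = c'.inj i) (S : Finset I) :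
    cofanTrunc hc S ≫ f = f ≫ cofanTrunc hc' S := by
  refine Cofan.IsColimit.hom_ext hc _ _ fun i => ?_
  rw [reassoc_of% hf i, ← Category.assoc]
  by_cases hi : i ∈ S
  · rw [inj_cofanTrunc_of_mem hc hi, inj_cofanTrunc_of_mem hc' hi, hf]
  · rw [inj_cofanTrunc_of_notMem hc hi, inj_cofanTrunc_of_notMem hc' hi, zero_comp]

lemma map_cofanTrunc {D : Type*} [Category D] [Preadditive D] (F : C ⥤ D) [F.Additive]
    (hc' : IsColimit (Cofan.mk (F.obj c.pt) fun i => F.map (c.inj i))) (S : Finset I) :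
    F.map (cofanTrunc hc S) = cofanTrunc hc' S := by
  have map_inj (i : I) : (Cofan.mk (F.obj c.pt) fun i => F.map (c.inj i)).inj i =
    F.map (c.inj i) := rfl
  refine Cofan.IsColimit.hom_ext hc' _ _ fun i => ?_
  by_cases hi : i ∈ S
  · rw [inj_cofanTrunc_of_mem hc' hi, map_inj, ← F.map_comp, inj_cofanTrunc_of_mem hc hi]
  · rw [inj_cofanTrunc_of_notMem hc' hi, map_inj, ← F.map_comp, inj_cofanTrunc_of_notMem hc hi,
      F.map_zero]

end

/-- Every morphism from `G` to a coproduct of a `w`-small family factors through finitely many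
summands. -/
def IsFinitelySupported (G : C) : Prop :=
  ∀ (I : Type w) (Y : I → C) (c : Cofan Y) (hc : IsColimit c) (f : G ⟶ c.pt),
    ∃ S : Finset I, f ≫ cofanTrunc hc S = f

namespace IsFinitelySupported

lemma of_exists_isColimit {G : C}
    (h : ∀ (I : Type w) (Y : I → C), ∃ (c : Cofan Y) (hc : IsColimit c), ∀ f : G ⟶ c.pt,
      ∃ S : Finset I, f ≫ cofanTrunc hc S = f) : IsFinitelySupported.{w} G := by
  intro I Y c' hc' f
  obtain ⟨c, hc, hf⟩ := h I Y
  let e : c'.pt ≅ c.pt := IsColimit.coconePointUniqueUpToIso hc' hc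
  have he (i : I) : c'.inj i ≫ e.hom = c.inj i :=
    IsColimit.comp_coconePointUniqueUpToIso_hom hc' hc ⟨i⟩
  obtain ⟨S, hS⟩ := hf (f ≫ e.hom)
  refine ⟨S, ?_⟩
  rw [← cancel_mono e.hom, Category.assoc, cofanTrunc_comp_of_forall_inj_comp hc' hc he,
    ← Category.assoc, hS]

lemma of_retract {G G' : C} (h : IsFinitelySupported.{w} G) (r : Retract G' G) :
    IsFinitelySupported.{w} G' := by
  intro I Y c hc f
  obtain ⟨S, hS⟩ := h I Y c hc (r.r ≫ f)
  refine ⟨S, ?_⟩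
  rw [← cancel_epi r.r, ← Category.assoc, hS]

lemma of_iso {G G' : C} (h : IsFinitelySupported.{w} G) (e : G ≅ G') :
    IsFinitelySupported.{w} G' :=
  h.of_retract ⟨e.inv, e.hom, by simp⟩

lemma of_isZero {G : C} (h : IsZero G) : IsFinitelySupported.{w} G :=
  fun _ _ _ _ _ => ⟨∅, h.eq_of_src _ _⟩

open DirectSum in
lemma bijective_toAddMonoid_rightComp {G : C} (h : IsFinitelySupported.{w} G) {I : Type w}
    [DecidableEq I] {Y : I → C} {c : Cofan Y} (hc : IsColimit c) :
    Function.Bijective (DirectSum.toAddMonoid fun i => Preadditive.rightComp G (c.inj i) :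
      (⨁ i, (G ⟶ Y i)) → (G ⟶ c.pt)) := by
  set σ : (⨁ i, (G ⟶ Y i)) →+ (G ⟶ c.pt) :=
    DirectSum.toAddMonoid fun i => Preadditive.rightComp G (c.inj i)
  have σ_of (i : I) (g : G ⟶ Y i) : σ (DirectSum.of _ i g) = g ≫ c.inj i :=
    DirectSum.toAddMonoid_of (fun i => Preadditive.rightComp G (c.inj i)) i g
  have σ_cofanProj (i : I) : (Preadditive.rightComp G (cofanProj hc i)).comp σ =
      DFinsupp.evalAddMonoidHom i := by
    refine DirectSum.addHom_ext fun j g => ?_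
    rw [AddMonoidHom.comp_apply, σ_of]
    change (g ≫ c.inj j) ≫ cofanProj hc i = DirectSum.of (fun i => G ⟶ Y i) j g i
    obtain rfl | hij := eq_or_ne j i
    · rw [Category.assoc, inj_cofanProj, DirectSum.of_eq_same]
      exact Category.comp_id g
    · rw [Category.assoc, inj_cofanProj_of_ne hc hij, comp_zero,
        DirectSum.of_eq_of_ne _ _ _ hij.symm]
  refine ⟨(injective_iff_map_eq_zero σ).2 fun x hx => DFinsupp.ext fun i => ?_, fun f => ?_⟩
  · have := DFunLike.congr_fun (σ_cofanProj i) x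
    rw [AddMonoidHom.comp_apply, hx, map_zero] at this
    exact this.symm
  · obtain ⟨S, hS⟩ := h I Y c hc f
    refine ⟨∑ i ∈ S, DirectSum.of _ i (f ≫ cofanProj hc i), ?_⟩
    simp only [map_sum, σ_of, Category.assoc, ← Preadditive.comp_sum]
    exact hS

lemma existsUnique_addMonoidHom {G : C} (h : IsFinitelySupported.{w} G) {I : Type w} {Y : I → C}
    {c : Cofan Y} (hc : IsColimit c) {A : Type*} [AddCommGroup A] (φ : ∀ i, (G ⟶ Y i) →+ A) :
    ∃! ψ : (G ⟶ c.pt) →+ A, ∀ i g, ψ (g ≫ c.inj i) = φ i g := by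
  classical
  let σ := AddEquiv.ofBijective _ (h.bijective_toAddMonoid_rightComp hc)
  have σ_of (i : I) (g : G ⟶ Y i) : σ (DirectSum.of _ i g) = g ≫ c.inj i :=
    DirectSum.toAddMonoid_of (fun i => Preadditive.rightComp G (c.inj i)) i g
  refine ⟨(DirectSum.toAddMonoid φ).comp σ.symm.toAddMonoidHom, fun i g => ?_, fun ψ hψ => ?_⟩
  · rw [← σ_of]
    exact (congrArg _ (σ.symm_apply_apply _)).trans (DirectSum.toAddMonoid_of φ i g)
  · have : ψ.comp σ.toAddMonoidHom = DirectSum.toAddMonoid φ := DirectSum.addHom_ext fun i g =>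
      (congrArg ψ (σ_of i g)).trans ((hψ i g).trans (DirectSum.toAddMonoid_of φ i g).symm)
    ext f
    rw [← this]
    exact congrArg ψ (σ.apply_symm_apply f).symm

lemma isCompactObj {G : C} (h : IsFinitelySupported.{w} G) : IsCompactObj.{w} G := by
  intro I
  have (Y : I → C) : PreservesColimit (Discrete.functor Y) (preadditiveCoyoneda.obj (op G)) := by
    refine ⟨fun {c} hc => ⟨?_⟩⟩
    let φ (s : Cocone (Discrete.functor Y ⋙ preadditiveCoyoneda.obj (op G))) (i : I) :
      (G ⟶ Y i) →+ s.pt := (s.ι.app ⟨i⟩).hom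
    choose ψ hψ hψ' using fun s => h.existsUnique_addMonoidHom hc (φ s)
    refine { desc s := AddCommGrpCat.ofHom (Y := s.pt) (ψ s), fac s j := ?_, uniq s m hm := ?_ }
    · ext f
      exact hψ s j.as f
    · ext f
      exact congr($(hψ' s m.hom fun i g => congr($(hm ⟨i⟩) g)) f)
  exact preservesColimitsOfShape_of_discrete _

end IsFinitelySupported

end FiniteSupport

section

variable {T : Type v₁} [Category.{v₂} T] [HasZeroObject T] [HasShift T ℤ] [Preadditive T]
  [∀ n : ℤ, (shiftFunctor T n).Additive] [Pretriangulated T]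

lemma IsFinitelySupported.of_distTriang (τ : Triangle T) (hτ : τ ∈ distTriang T)
    (h₁ : IsFinitelySupported.{w} τ.obj₁) (h₃ : IsFinitelySupported.{w} τ.obj₃) :
    IsFinitelySupported.{w} τ.obj₂ := by
  classical
  intro I Y c hc f
  obtain ⟨S, hS⟩ := h₁ I Y c hc (τ.mor₁ ≫ f)
  obtain ⟨g, hg⟩ := Triangle.yoneda_exact₂ τ hτ (f - f ≫ cofanTrunc hc S) (by
    rw [Preadditive.comp_sub, ← Category.assoc, hS, sub_self])
  obtain ⟨S', hS'⟩ := h₃ I Y c hc g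
  have hf : f ≫ cofanTrunc hc S + τ.mor₂ ≫ g = f := by rw [← hg]; abel
  have trunc_left : (f ≫ cofanTrunc hc S) ≫ cofanTrunc hc (S ∪ S') = f ≫ cofanTrunc hc S := by
    rw [Category.assoc, cofanTrunc_comp_of_subset hc Finset.subset_union_left]
  have trunc_right : (τ.mor₂ ≫ g) ≫ cofanTrunc hc (S ∪ S') = τ.mor₂ ≫ g := by
    rw [Category.assoc, comp_cofanTrunc_of_subset hc Finset.subset_union_right hS']
  refine ⟨S ∪ S', ?_⟩
  rw [← hf, Preadditive.add_comp, trunc_left, trunc_right]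

end

/-! ### Generation in finitely many steps -/

section Generation

section Biproduct

variable {C : Type v₁} [Category.{v₂} C] [Preadditive C] [HasBinaryBiproducts C]

lemma nonempty_iso_biprod_of_isColimit {I : Type*} {Y : I → C} {c : Cofan Y} (hc : IsColimit c)
    (p : I → Prop) [HasCoproduct fun i : {i // p i} => Y i]
    [HasCoproduct fun i : {i // ¬ p i} => Y i] :
    Nonempty (c.pt ≅ (∐ fun i : {i // p i} => Y i) ⊞ ∐ fun i : {i // ¬ p i} => Y i) := by
  classical
  let φ : c.pt ⟶ (∐ fun i : {i // p i} => Y i) ⊞ ∐ fun i : {i // ¬ p i} => Y i :=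
    Cofan.IsColimit.desc hc fun i =>
      if hi : p i then Sigma.ι (fun i : {i // p i} => Y i) ⟨i, hi⟩ ≫ biprod.inl
      else Sigma.ι (fun i : {i // ¬ p i} => Y i) ⟨i, hi⟩ ≫ biprod.inr
  have inj_φ_of_pos (i : I) (hi : p i) :
      c.inj i ≫ φ = Sigma.ι (fun i : {i // p i} => Y i) ⟨i, hi⟩ ≫ biprod.inl :=
    (Cofan.IsColimit.fac hc _ i).trans (dif_pos hi)
  have inj_φ_of_neg (i : I) (hi : ¬ p i) :
      c.inj i ≫ φ = Sigma.ι (fun i : {i // ¬ p i} => Y i) ⟨i, hi⟩ ≫ biprod.inr :=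
    (Cofan.IsColimit.fac hc _ i).trans (dif_neg hi)
  refine ⟨φ, biprod.desc (Sigma.desc fun i => c.inj i) (Sigma.desc fun i => c.inj i),
    Cofan.IsColimit.hom_ext hc _ _ fun i => ?_, ?_⟩
  · by_cases hi : p i
    · simp [reassoc_of% inj_φ_of_pos i hi]
    · simp [reassoc_of% inj_φ_of_neg i hi]
  · ext ⟨i, hi⟩ : 2
    · simp [inj_φ_of_pos i hi]
    · simp [inj_φ_of_neg i hi]

end Biproduct

section BigAdd

variable {T : Type v₁} [Category.{v₂} T]

lemma bigAdd_of_isColimit {P : ObjectProperty T} {I : Type w} {Y : I → T} {c : Cofan Y}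
    (hc : IsColimit c) (hY : ∀ i, P (Y i)) : bigAdd.{w} P c.pt :=
  ⟨I, ⟨{ diag := Discrete.functor Y, ι := c.ι, isColimit := hc, prop_diag_obj i := hY i.as }⟩⟩

lemma bigAdd_mono {P Q : ObjectProperty T} (h : P ≤ Q) : bigAdd.{w} P ≤ bigAdd.{w} Q :=
  fun _ ⟨I, hI⟩ => ⟨I, ObjectProperty.colimitsOfShape_monotone _ h _ hI⟩

lemma bigAdd_le {P Q : ObjectProperty T} [∀ I : Type w, Q.IsClosedUnderColimitsOfShape (Discrete I)]
    (h : P ≤ Q) : bigAdd.{w} P ≤ Q :=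
  fun _ ⟨I, hI⟩ => Q.colimitsOfShape_le (J := Discrete I) _
    (ObjectProperty.colimitsOfShape_monotone _ h _ hI)

instance (P : ObjectProperty T) : (bigAdd.{w} P).IsClosedUnderIsomorphisms where
  of_iso e := fun ⟨I, hI⟩ => ⟨I, ObjectProperty.prop_of_iso _ e hI⟩

instance [HasZeroMorphisms T] [HasZeroObject T] (P : ObjectProperty T) :
    (bigAdd.{w} P).ContainsZero where
  exists_zero :=
    ⟨0, isZero_zero T, bigAdd_of_isColimit (I := PEmpty) (Y := fun _ => 0)
      (c := Cofan.mk 0 fun _ => 0) (Cofan.IsColimit.mk _ (fun _ => 0) (fun _ j => j.elim)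
        fun _ _ _ => (isZero_zero T).eq_of_src _ _) fun i => i.elim⟩

variable [HasShift T ℤ]

lemma shiftsIn_mono (G : T) {S S' : Set ℤ} (h : S ⊆ S') : shiftsIn G S ≤ shiftsIn G S' :=
  fun _ ⟨i, hi, e⟩ => ⟨i, h hi, e⟩

lemma exists_cofan_of_bigAdd_shiftsIn {G : T} {S : Set ℤ} {B : T}
    (h : bigAdd.{w} (shiftsIn G S) B) :
    ∃ (I : Type w) (n : I → ℤ) (_ : ∀ i, n i ∈ S) (ι : ∀ i, G⟦-n i⟧ ⟶ B),
      Nonempty (IsColimit (Cofan.mk B ι)) := by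
  obtain ⟨I, ⟨p⟩⟩ := h
  choose n hn e using fun i : I => p.prop_diag_obj ⟨i⟩
  let α : Discrete.functor (fun i => G⟦-n i⟧) ≅ p.diag :=
    Discrete.natIso fun i => (e i.as).some.symm
  exact ⟨I, n, hn, fun i => α.hom.app ⟨i⟩ ≫ p.ι.app ⟨i⟩,
    ⟨((IsColimit.precomposeHomEquiv α _).symm p.isColimit).ofIsoColimit (Cocone.ext (Iso.refl _))⟩⟩

lemma exists_iso_biprod_of_bigAdd_shiftsIn [Preadditive T] [HasBinaryBiproducts T]
    [HasCoproducts.{w} T] {G : T} {S : Set ℤ} {B : T} (h : bigAdd.{w} (shiftsIn G S) B)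
    (S' : Set ℤ) :
    ∃ B₁ B₂ : T, bigAdd.{w} (shiftsIn G (S ∩ S')) B₁ ∧ bigAdd.{w} (shiftsIn G (S \ S')) B₂ ∧
      Nonempty (B ≅ B₁ ⊞ B₂) := by
  obtain ⟨I, n, hn, ι, ⟨hι⟩⟩ := exists_cofan_of_bigAdd_shiftsIn h
  exact ⟨_, _, bigAdd_of_isColimit (coproductIsCoproduct _) fun i => ⟨_, ⟨hn _, i.2⟩, ⟨Iso.refl _⟩⟩,
    bigAdd_of_isColimit (coproductIsCoproduct _) fun i => ⟨_, ⟨hn _, i.2⟩, ⟨Iso.refl _⟩⟩,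
    nonempty_iso_biprod_of_isColimit hι (fun i => n i ∈ S')⟩

end BigAdd

section BigCoprod

variable {T : Type v₁} [Category.{v₂} T] [HasZeroObject T] [HasShift T ℤ] [Preadditive T]
  [∀ n : ℤ, (shiftFunctor T n).Additive] [Pretriangulated T]

lemma bigCoprod_succ (P : ObjectProperty T) (n : ℕ) :
    bigCoprod.{w} P (n + 1) = (bigAdd.{w} P).extensionProduct (bigCoprod.{w} P n) := by
  cases n with
  | zero =>
    refine le_antisymm (fun X hX => ?_) ?_
    · exact ⟨X, 0, 𝟙 X, 0, 0, contractible_distinguished X, hX, isZero_zero T⟩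
    · rintro X ⟨Y, Z, f, g, h, hT, hY, hZ⟩
      have : IsIso f := (Triangle.isZero₃_iff_isIso₁ _ hT).1 hZ
      exact (bigAdd P).prop_of_iso (asIso f) hY
  | succ n => exact ObjectProperty.extensionProductIter_succ _ n

lemma bigCoprod_succ' [IsTriangulated T] (P : ObjectProperty T) (n : ℕ) :
    bigCoprod.{w} P (n + 1) = (bigCoprod.{w} P n).extensionProduct (bigAdd.{w} P) := by
  induction n with
  | zero =>
    refine le_antisymm (fun X hX => ?_) ?_
    · exact ⟨0, X, 0, 𝟙 X, 0, contractible_distinguished₁ X, isZero_zero T, hX⟩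
    · rintro X ⟨Y, Z, f, g, h, hT, hY, hZ⟩
      have : IsIso g := (Triangle.isZero₁_iff_isIso₂ _ hT).1 hY
      exact (bigAdd P).prop_of_iso (asIso g).symm hZ
  | succ n ih =>
    rw [bigCoprod_succ, ih, ← ObjectProperty.extensionProduct_assoc, ← bigCoprod_succ, ih]

instance (P : ObjectProperty T) (n : ℕ) : (bigCoprod.{w} P n).IsClosedUnderIsomorphisms := by
  cases n with
  | zero => exact ⟨fun e hX => hX.of_iso e.symm⟩
  | succ n => rw [bigCoprod_succ]; infer_instance

instance (P : ObjectProperty T) (n : ℕ) : (bigCoprod.{w} P n).ContainsZero := by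
  cases n with
  | zero => exact ⟨0, isZero_zero T, isZero_zero T⟩
  | succ n =>
    obtain ⟨Z, hZ, hP⟩ := (bigAdd.{w} P).exists_prop_of_containsZero
    exact ⟨Z, hZ, ObjectProperty.le_extensionProductIter _ n _ hP⟩

lemma bigCoprod_mono {P Q : ObjectProperty T} (h : P ≤ Q) {n m : ℕ} (hnm : n ≤ m) :
    bigCoprod.{w} P n ≤ bigCoprod.{w} Q m := by
  induction n generalizing m with
  | zero => exact fun X hX => ObjectProperty.prop_of_isZero _ hX
  | succ n ih =>
    obtain ⟨m, rfl⟩ := Nat.exists_eq_add_of_le' (Nat.one_le_of_lt hnm)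
    rw [bigCoprod_succ, bigCoprod_succ]
    grw [ObjectProperty.monotone_extensionProduct_left _ (bigAdd_mono h),
      ObjectProperty.monotone_extensionProduct_right _ (ih (Nat.le_of_succ_le_succ hnm))]

lemma bigGen_mono (G : T) {S S' : Set ℤ} (h : S ⊆ S') {n m : ℕ} (hnm : n ≤ m) :
    bigGen.{w} G S n ≤ bigGen.{w} G S' m :=
  ObjectProperty.monotone_retractClosure (bigCoprod_mono (shiftsIn_mono G h) hnm)

lemma bigCoprod_le {P Q : ObjectProperty T} [Q.ContainsZero] [Q.IsClosedUnderIsomorphisms]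
    [Q.IsTriangulatedClosed₂] [∀ I : Type w, Q.IsClosedUnderColimitsOfShape (Discrete I)]
    (h : P ≤ Q) (n : ℕ) : bigCoprod.{w} P n ≤ Q := by
  induction n with
  | zero => exact fun X hX => Q.prop_of_isZero hX
  | succ n ih =>
    rw [bigCoprod_succ]
    exact ObjectProperty.extensionProduct_le_of_isTriangulatedClosed₂ (bigAdd_le h) ih

end BigCoprod

end Generation

section

variable {C : Type v₁} [Category.{v₂} C] [HasZeroMorphisms C]

instance (P : ObjectProperty C) (J : Type*) [Category J] :
    P.leftOrthogonal.IsClosedUnderColimitsOfShape J where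
  colimitsOfShape_le := by
    rintro X ⟨p⟩ Y f hY
    exact p.isColimit.hom_ext fun j =>
      (p.prop_diag_obj j _ hY).trans (p.prop_diag_obj j _ hY).symm

end

section

variable {T : Type v₁} [Category.{v₂} T] [HasShift T ℤ]

lemma exists_comp_shift_map_eq {A A' M : T} {i : A' ⟶ A}
    (h : ∀ f : M⟦(-1 : ℤ)⟧ ⟶ A, ∃ g, g ≫ i = f) (f : M ⟶ A⟦(1 : ℤ)⟧) :
    ∃ g, g ≫ i⟦(1 : ℤ)⟧' = f := by
  let adj := (shiftEquiv' T (-1 : ℤ) 1 (by simp)).toAdjunction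
  obtain ⟨g, hg⟩ := h ((adj.homEquiv M A).symm f)
  refine ⟨adj.homEquiv M A' g, ?_⟩
  rw [← (adj.homEquiv M A).apply_symm_apply f, ← hg]
  exact (adj.homEquiv_naturality_right g i).symm

end

section Triangulated

variable {T : Type v₁} [Category.{v₂} T] [HasZeroObject T] [HasShift T ℤ] [Preadditive T]
  [∀ n : ℤ, (shiftFunctor T n).Additive] [Pretriangulated T]

lemma hom_eq_zero_of_bigGen {H Y : T} (h : ∀ (n : ℤ) (f : H⟦n⟧ ⟶ Y), f = 0) {S : Set ℤ} {n : ℕ}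
    {X : T} (hX : bigGen.{w} H S n X) (f : X ⟶ Y) : f = 0 := by
  obtain ⟨B, hB, ⟨r⟩⟩ := hX
  have shiftsIn_le : shiftsIn H S ≤ (ObjectProperty.singleton Y).leftOrthogonal := by
    rintro Z ⟨i, -, ⟨e⟩⟩ Y' g hY'
    obtain rfl : Y = Y' := by simpa using hY'
    exact (cancel_epi e.inv).1 ((h _ _).trans comp_zero.symm)
  have : r.r ≫ f = 0 := bigCoprod_le shiftsIn_le n _ hB _ (by simp)
  rw [← cancel_epi r.r, this, comp_zero]

lemma exists_distTriang_of_isSplitMono {A B C : T} {α : A ⟶ B} {β : B ⟶ C} {δ : C ⟶ A⟦(1 : ℤ)⟧}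
    (hτ : Triangle.mk α β δ ∈ distTriang T) {A' C' M : T} (i : A' ⟶ A) [IsSplitMono i]
    {u : C' ⟶ C} (hC' : ∀ g : C'⟦(-1 : ℤ)⟧ ⟶ A, ∃ g', g' ≫ i = g)
    (hM : ∀ g : M ⟶ A, ∃ g', g' ≫ i = g)
    {f : M ⟶ B} {f' : M ⟶ C'} (hf : f' ≫ u = f ≫ β) :
    ∃ (B' : T) (l : M ⟶ B') (v : B' ⟶ B) (α' : A' ⟶ B') (β' : B' ⟶ C') (δ' : C' ⟶ A'⟦(1 : ℤ)⟧),
      l ≫ v = f ∧ Triangle.mk α' β' δ' ∈ distTriang T := by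
  obtain ⟨δ', hδ'⟩ := exists_comp_shift_map_eq hC' (u ≫ δ)
  obtain ⟨B', α', β', hτ'⟩ := distinguished_cocone_triangle₂ δ'
  obtain ⟨v, hv₁, hv₂⟩ : ∃ v : B' ⟶ B, α' ≫ v = i ≫ α ∧ β' ≫ u = v ≫ β :=
    complete_distinguished_triangle_morphism₂ _ _ hτ' hτ i u hδ'
  obtain ⟨l, hl⟩ : ∃ l : M ⟶ B', f' = l ≫ β' := by
    refine Triangle.coyoneda_exact₃ _ hτ' f' ?_
    have hβδ : β ≫ δ = 0 := comp_distTriang_mor_zero₂₃ _ hτ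
    apply (cancel_mono (i⟦(1 : ℤ)⟧')).1
    change (f' ≫ δ') ≫ i⟦(1 : ℤ)⟧' = 0 ≫ i⟦(1 : ℤ)⟧'
    rw [Category.assoc, hδ', reassoc_of% hf, hβδ, comp_zero, zero_comp]
  obtain ⟨d, hd⟩ : ∃ d : M ⟶ A, f - l ≫ v = d ≫ α := by
    refine Triangle.coyoneda_exact₂ _ hτ (f - l ≫ v) ?_
    change (f - l ≫ v) ≫ β = 0
    rw [Preadditive.sub_comp, Category.assoc, ← hv₂, ← Category.assoc, ← hl, hf, sub_self]
  obtain ⟨d, rfl⟩ := hM d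
  refine ⟨B', l + d ≫ α', v, α', β', δ', ?_, hτ'⟩
  rw [Preadditive.add_comp, Category.assoc, hv₁, ← Category.assoc d, ← hd]
  abel

lemma exists_distTriang_of_isSplitEpi {A B C : T} {α : A ⟶ B} {β : B ⟶ C} {δ : C ⟶ A⟦(1 : ℤ)⟧}
    (hτ : Triangle.mk α β δ ∈ distTriang T) {A' C' M : T} (p : C ⟶ C') [IsSplitEpi p]
    {u : A ⟶ A'} (hA' : ∀ g : C ⟶ A'⟦(1 : ℤ)⟧, ∃ g', p ≫ g' = g)
    (hM : ∀ g : C ⟶ M, ∃ g', p ≫ g' = g)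
    {f : B ⟶ M} {f' : A' ⟶ M} (hf : u ≫ f' = α ≫ f) :
    ∃ (B' : T) (v : B ⟶ B') (l : B' ⟶ M) (α' : A' ⟶ B') (β' : B' ⟶ C') (δ' : C' ⟶ A'⟦(1 : ℤ)⟧),
      v ≫ l = f ∧ Triangle.mk α' β' δ' ∈ distTriang T := by
  obtain ⟨δ', hδ'⟩ := hA' (δ ≫ u⟦(1 : ℤ)⟧')
  obtain ⟨B', α', β', hτ'⟩ := distinguished_cocone_triangle₂ δ'
  obtain ⟨v, hv₁, hv₂⟩ : ∃ v : B ⟶ B', α ≫ v = u ≫ α' ∧ β ≫ p = v ≫ β' :=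
    complete_distinguished_triangle_morphism₂ _ _ hτ hτ' u p hδ'.symm
  obtain ⟨l, hl, -⟩ : ∃ l : B' ⟶ M, α' ≫ l = f' ≫ 𝟙 M ∧ β' ≫ 0 = l ≫ (0 : M ⟶ 0) := by
    refine complete_distinguished_triangle_morphism₂ _ _ hτ' (contractible_distinguished M) f' 0 ?_
    have hδα : δ ≫ α⟦(1 : ℤ)⟧' = 0 := comp_distTriang_mor_zero₃₁ _ hτ
    apply (cancel_epi p).1
    change p ≫ δ' ≫ f'⟦(1 : ℤ)⟧' = p ≫ 0 ≫ (0 : (0 : T) ⟶ M⟦(1 : ℤ)⟧)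
    rw [reassoc_of% hδ', ← Functor.map_comp, hf, Functor.map_comp, reassoc_of% hδα, zero_comp,
      zero_comp, comp_zero]
  obtain ⟨d, hd⟩ : ∃ d : C ⟶ M, f - v ≫ l = β ≫ d := by
    refine Triangle.yoneda_exact₂ _ hτ (f - v ≫ l) ?_
    change α ≫ (f - v ≫ l) = 0
    rw [Preadditive.comp_sub, ← Category.assoc α, hv₁, Category.assoc, hl, Category.comp_id, hf,
      sub_self]
  obtain ⟨d, rfl⟩ := hM d
  refine ⟨B', v, l + β' ≫ d, α', β', δ', ?_, hτ'⟩
  rw [Preadditive.comp_add, ← Category.assoc v, ← hv₂, Category.assoc, ← hd]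
  abel

end Triangulated

section TStructure

variable {T : Type v₁} [Category.{v₂} T] [HasZeroObject T] [HasShift T ℤ] [Preadditive T]
  [∀ n : ℤ, (shiftFunctor T n).Additive] [Pretriangulated T]

section

variable (t : Triangulated.TStructure T)

instance (n : ℤ) : (t.le n).IsTriangulatedClosed₂ :=
  .mk' fun τ hτ h₁ h₃ => (t.isLE₂ τ hτ n ⟨h₁⟩ ⟨h₃⟩).le

instance (n : ℤ) : (t.ge n).IsTriangulatedClosed₂ :=
  .mk' fun τ hτ h₁ h₃ => (t.isGE₂ τ hτ n ⟨h₁⟩ ⟨h₃⟩).ge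

instance (n : ℤ) : (t.le n).ContainsZero :=
  ⟨0, isZero_zero T, (t.isLE_of_isZero (isZero_zero T) n).le⟩

instance (n : ℤ) : (t.ge n).ContainsZero :=
  ⟨0, isZero_zero T, (t.isGE_of_isZero (isZero_zero T) n).ge⟩

lemma le_eq_leftOrthogonal (n : ℤ) : t.le n = (t.ge (n + 1)).leftOrthogonal := by
  ext X
  rw [t.le_iff_isLE, t.isLE_iff_orthogonal n (n + 1) rfl]
  exact ⟨fun h Y f hY => h Y f ⟨hY⟩, fun h Y f hY => h f hY.ge⟩

instance (n : ℤ) (J : Type*) [Category J] : (t.le n).IsClosedUnderColimitsOfShape J := by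
  rw [le_eq_leftOrthogonal]
  infer_instance

end

variable {t : Triangulated.TStructure T} {G : T} {a b : ℤ}

lemma isLE_of_bigCoprod_shiftsIn (hb : t.IsLE G b) {S : Set ℤ} {k : ℤ} (hS : ∀ i ∈ S, i ≤ k)
    {n : ℕ} {B : T} (hB : bigCoprod.{w} (shiftsIn G S) n B) : t.IsLE B (b + k) := by
  refine ⟨bigCoprod_le ?_ n _ hB⟩
  rintro X ⟨i, hi, ⟨e⟩⟩
  have := t.isLE_shift G b (-i) (b + i)
  have := t.isLE_of_iso e.symm (b + i)
  exact (t.isLE_of_le X (b + i) _ (by have := hS i hi; lia)).le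

section

variable [HasCoproducts.{w} T]

lemma exists_isSplitEpi_of_bigAdd_shiftsIn (hb : t.IsLE G b) {S : Set ℤ} {B : T}
    (hB : bigAdd.{w} (shiftsIn G S) B) (k : ℤ) :
    ∃ (B' : T) (p : B ⟶ B'), IsSplitEpi p ∧ bigAdd.{w} (shiftsIn G (S ∩ Set.Ici k)) B' ∧
      ∀ M : T, t.IsGE M (b + k) → ∀ f : B ⟶ M, ∃ f' : B' ⟶ M, p ≫ f' = f := by
  obtain ⟨B₁, B₂, h₁, h₂, ⟨e⟩⟩ := exists_iso_biprod_of_bigAdd_shiftsIn hB (Set.Ici k)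
  have : t.IsLE B₂ (b + (k - 1)) :=
    isLE_of_bigCoprod_shiftsIn hb (fun i hi => Int.le_sub_one_of_lt (not_le.1 hi.2)) (n := 1) h₂
  refine ⟨B₁, e.hom ≫ biprod.fst, inferInstance, h₁, fun M hM f => ⟨biprod.inl ≫ e.inv ≫ f, ?_⟩⟩
  have hf : biprod.inr ≫ e.inv ≫ f = 0 := t.zero _ (b + (k - 1)) (b + k)
  rw [← cancel_epi e.inv]
  ext
  · simp
  · simpa using hf.symm

end

variable [∀ (n : ℤ) (I : Type w), (t.ge n).IsClosedUnderColimitsOfShape (Discrete I)]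

lemma isGE_of_bigCoprod_shiftsIn (ha : t.IsGE G a) {S : Set ℤ} {k : ℤ} (hS : ∀ i ∈ S, k ≤ i)
    {n : ℕ} {B : T} (hB : bigCoprod.{w} (shiftsIn G S) n B) : t.IsGE B (a + k) := by
  refine ⟨bigCoprod_le ?_ n _ hB⟩
  rintro X ⟨i, hi, ⟨e⟩⟩
  have := t.isGE_shift G a (-i) (a + i)
  have := t.isGE_of_iso e.symm (a + i)
  exact (t.isGE_of_ge X _ (a + i) (by have := hS i hi; lia)).ge

variable [HasCoproducts.{w} T]

lemma exists_isSplitMono_of_bigAdd_shiftsIn (ha : t.IsGE G a) {S : Set ℤ} {B : T}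
    (hB : bigAdd.{w} (shiftsIn G S) B) (k : ℤ) :
    ∃ (B' : T) (i : B' ⟶ B), IsSplitMono i ∧ bigAdd.{w} (shiftsIn G (S ∩ Set.Iic k)) B' ∧
      ∀ M : T, t.IsLE M (a + k) → ∀ f : M ⟶ B, ∃ f' : M ⟶ B', f' ≫ i = f := by
  obtain ⟨B₁, B₂, h₁, h₂, ⟨e⟩⟩ := exists_iso_biprod_of_bigAdd_shiftsIn hB (Set.Iic k)
  have : t.IsGE B₂ (a + (k + 1)) :=
    isGE_of_bigCoprod_shiftsIn ha (fun i hi => by simpa using hi.2) (n := 1) h₂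
  refine ⟨B₁, biprod.inl ≫ e.inv, inferInstance, h₁, fun M hM f => ⟨f ≫ e.hom ≫ biprod.fst, ?_⟩⟩
  have hf : (f ≫ e.hom) ≫ biprod.snd = 0 := t.zero _ (a + k) (a + (k + 1))
  rw [← cancel_mono e.hom]
  ext
  · simp
  · simpa using hf.symm

lemma exists_factorization_of_isLE (ha : t.IsGE G a) (hb : t.IsLE G b) (n : ℕ) (m : ℤ) :
    ∃ k : ℤ, ∀ (S : Set ℤ) (B : T), bigCoprod.{w} (shiftsIn G S) n B →
      ∀ M : T, t.IsLE M m → ∀ f : M ⟶ B, ∃ (B' : T) (l : M ⟶ B') (v : B' ⟶ B),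
        bigCoprod.{w} (shiftsIn G (S ∩ Set.Iic k)) n B' ∧ l ≫ v = f := by
  induction n with
  | zero => exact ⟨0, fun S B hB M _ f => ⟨B, f, 𝟙 B, hB, Category.comp_id f⟩⟩
  | succ n ih =>
    obtain ⟨k₁, hk₁⟩ := ih
    let k := max k₁ (max (m - a) (b + k₁ - a + 1))
    refine ⟨k, fun S B hB M hM f => ?_⟩
    rw [bigCoprod_succ] at hB
    obtain ⟨A, C, α, β, δ, hτ, hA, hC⟩ := hB
    obtain ⟨C', f', u, hC', hu⟩ := hk₁ S C hC M hM (f ≫ β)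
    obtain ⟨A', i, _, hA', hi⟩ := exists_isSplitMono_of_bigAdd_shiftsIn ha hA k
    have : t.IsLE C' (b + k₁) := isLE_of_bigCoprod_shiftsIn hb (fun _ hi => hi.2) hC'
    have : t.IsLE (C'⟦(-1 : ℤ)⟧) (b + k₁ + 1) := t.isLE_shift C' (b + k₁) (-1) (b + k₁ + 1)
    obtain ⟨B', l, v, α', β', δ', hlv, hτ'⟩ := exists_distTriang_of_isSplitMono hτ i
      (hi _ (t.isLE_of_le _ (b + k₁ + 1) _)) (hi _ (t.isLE_of_le _ m _)) hu
    have subset : S ∩ Set.Iic k₁ ⊆ S ∩ Set.Iic k := by gcongr; exact le_max_left _ _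
    refine ⟨B', l, v, ?_, hlv⟩
    rw [bigCoprod_succ]
    exact ⟨A', C', α', β', δ', hτ', hA', bigCoprod_mono (shiftsIn_mono G subset) le_rfl _ hC'⟩

lemma exists_factorization_of_isGE [IsTriangulated T] (ha : t.IsGE G a) (hb : t.IsLE G b) (n : ℕ)
    (m : ℤ) :
    ∃ k : ℤ, ∀ (S : Set ℤ) (B : T), bigCoprod.{w} (shiftsIn G S) n B →
      ∀ M : T, t.IsGE M m → ∀ f : B ⟶ M, ∃ (B' : T) (v : B ⟶ B') (l : B' ⟶ M),
        bigCoprod.{w} (shiftsIn G (S ∩ Set.Ici k)) n B' ∧ v ≫ l = f := by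
  induction n with
  | zero => exact ⟨0, fun S B hB M _ f => ⟨B, 𝟙 B, f, hB, Category.id_comp f⟩⟩
  | succ n ih =>
    obtain ⟨k₁, hk₁⟩ := ih
    let k := min k₁ (min (m - b) (a + k₁ - b - 1))
    refine ⟨k, fun S B hB M hM f => ?_⟩
    rw [bigCoprod_succ'] at hB
    obtain ⟨A, C, α, β, δ, hτ, hA, hC⟩ := hB
    obtain ⟨A', u, f', hA', hu⟩ := hk₁ S A hA M hM (α ≫ f)
    obtain ⟨C', p, _, hC', hp⟩ := exists_isSplitEpi_of_bigAdd_shiftsIn hb hC k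
    have : t.IsGE A' (a + k₁) := isGE_of_bigCoprod_shiftsIn ha (fun _ hi => hi.2) hA'
    have : t.IsGE (A'⟦(1 : ℤ)⟧) (a + k₁ - 1) := t.isGE_shift A' (a + k₁) 1 (a + k₁ - 1)
    obtain ⟨B', v, l, α', β', δ', hvl, hτ'⟩ := exists_distTriang_of_isSplitEpi hτ p
      (hp _ (t.isGE_of_ge _ _ (a + k₁ - 1))) (hp _ (t.isGE_of_ge _ _ m)) hu
    have subset : S ∩ Set.Ici k₁ ⊆ S ∩ Set.Ici k := by gcongr; exact min_le_left _ _
    refine ⟨B', v, l, ?_, hvl⟩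
    rw [bigCoprod_succ']
    exact ⟨A', C', α', β', δ', hτ', bigCoprod_mono (shiftsIn_mono G subset) le_rfl _ hA', hC'⟩

lemma exists_Icc_bigGen [IsTriangulated T] (ha : t.IsGE G a) (hb : t.IsLE G b) (n : ℕ)
    (m m' : ℤ) :
    ∃ l k : ℤ, ∀ M : T, t.IsGE M m → t.IsLE M m' → bigGen.{w} G Set.univ n M →
      bigGen.{w} G (Set.Icc l k) n M := by
  obtain ⟨k, hk⟩ := exists_factorization_of_isLE ha hb n m'
  obtain ⟨l, hl⟩ := exists_factorization_of_isGE ha hb n m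
  refine ⟨l, k, fun M h h' ⟨B, hB, ⟨r⟩⟩ => ?_⟩
  obtain ⟨B₁, f₁, g₁, hB₁, e₁⟩ := hk _ B hB M h' r.i
  obtain ⟨B₂, f₂, g₂, hB₂, e₂⟩ := hl _ B₁ hB₁ M h (g₁ ≫ r.r)
  refine ⟨B₂, bigCoprod_mono (shiftsIn_mono G ?_) le_rfl _ hB₂,
    ⟨⟨f₁ ≫ f₂, g₂, by rw [Category.assoc, e₂, reassoc_of% e₁, r.retract]⟩⟩⟩
  exact fun i hi => ⟨hi.2, hi.1.2⟩

end TStructure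

/-! ### Coproducts in homotopy categories and derived categories -/

section

variable {C : Type v₁} [Category.{v₂} C] [Abelian C] {J : Type*} [Category* J]

lemma quasiIso_functorEquivalence_inverse_map {F₁ F₂ : J ⥤ ShortComplex C} (φ : F₁ ⟶ F₂)
    (hφ : ∀ j, ShortComplex.QuasiIso (φ.app j)) :
    ShortComplex.QuasiIso ((ShortComplex.FunctorEquivalence.inverse J C).map φ) := by
  have γ : ShortComplex.LeftHomologyMapData
    ((ShortComplex.FunctorEquivalence.inverse J C).map φ)
    (ShortComplex.leftHomologyData _) (ShortComplex.leftHomologyData _) := default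
  rw [γ.quasiIso_iff, NatTrans.isIso_iff_isIso_app]
  intro j
  let ev : (J ⥤ C) ⥤ C := (evaluation J C).obj j
  have : ev.PreservesHomology := inferInstance
  have h := (γ.map ev).quasiIso_iff
  rw [ShortComplex.LeftHomologyMapData.map_φH] at h
  exact h.1 (hφ j)

variable [HasColimitsOfShape J C] [HasExactColimitsOfShape J C]

lemma quasiIso_shortComplex_of_isColimit {F₁ F₂ : J ⥤ ShortComplex C} {φ : F₁ ⟶ F₂}
    (hφ : ∀ j, ShortComplex.QuasiIso (φ.app j)) {c₁ : Cocone F₁} {c₂ : Cocone F₂}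
    (h₁ : IsColimit c₁) (h₂ : IsColimit c₂) {ψ : c₁.pt ⟶ c₂.pt}
    (hψ : ∀ j, c₁.ι.app j ≫ ψ = φ.app j ≫ c₂.ι.app j) : ShortComplex.QuasiIso ψ := by
  have : PreservesFiniteLimits (colim (J := J) (C := C)) :=
    HasExactColimitsOfShape.preservesFiniteLimits
  let L : (J ⥤ C) ⥤ C := colim
  have : L.PreservesHomology := inferInstance
  have := quasiIso_functorEquivalence_inverse_map φ hφ
  let ψ' : (ShortComplex.colimitCocone F₁).pt ⟶ (ShortComplex.colimitCocone F₂).pt :=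
    L.mapShortComplex.map ((ShortComplex.FunctorEquivalence.inverse J C).map φ)
  have hψ' (j : J) : (ShortComplex.colimitCocone F₁).ι.app j ≫ ψ' =
      φ.app j ≫ (ShortComplex.colimitCocone F₂).ι.app j := by
    ext
    · exact ι_colimMap (Functor.whiskerRight φ ShortComplex.π₁) j
    · exact ι_colimMap (Functor.whiskerRight φ ShortComplex.π₂) j
    · exact ι_colimMap (Functor.whiskerRight φ ShortComplex.π₃) j
  have : ShortComplex.QuasiIso ψ' :=
    inferInstanceAs (ShortComplex.QuasiIso (L.mapShortComplex.map
      ((ShortComplex.FunctorEquivalence.inverse J C).map φ)))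
  let e₁ := (ShortComplex.isColimitColimitCocone F₁).coconePointUniqueUpToIso h₁
  let e₂ := (ShortComplex.isColimitColimitCocone F₂).coconePointUniqueUpToIso h₂
  have : ψ = e₁.inv ≫ ψ' ≫ e₂.hom := by
    refine h₁.hom_ext fun j => ?_
    rw [hψ, IsColimit.comp_coconePointUniqueUpToIso_inv_assoc, reassoc_of% hψ' j,
      IsColimit.comp_coconePointUniqueUpToIso_hom]
  rw [this]
  infer_instance

instance {ι : Type*} (c : ComplexShape ι) :
    (HomologicalComplex.quasiIso C c).IsStableUnderColimitsOfShape J where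
  condition F₁ F₂ c₁ c₂ h₁ h₂ f hf ψ hψ := by
    refine ⟨fun n => (quasiIsoAt_iff _ _).2 ?_⟩
    let S := HomologicalComplex.shortComplexFunctor C c n
    have hS {F : J ⥤ HomologicalComplex C c} {s : Cocone F} (hs : IsColimit s) :
        IsColimit (S.mapCocone s) :=
      ShortComplex.isColimitOfIsColimitπ _
        (isColimitOfPreserves (HomologicalComplex.eval C c _) hs)
        (isColimitOfPreserves (HomologicalComplex.eval C c _) hs)
        (isColimitOfPreserves (HomologicalComplex.eval C c _) hs)
    refine quasiIso_shortComplex_of_isColimit (φ := Functor.whiskerRight f S) (fun j => ?_)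
      (hS h₁) (hS h₂) fun j => ?_
    · have : QuasiIso (f.app j) := hf j
      exact (quasiIsoAt_iff _ n).1 inferInstance
    · exact (S.map_comp _ _).symm.trans ((congrArg S.map (hψ j)).trans (S.map_comp _ _))

end

section

variable {D E : Type*} [Category* D] [Category* E] {I : Type*} (F : D ⥤ E) [F.EssSurj]

lemma hasColimitsOfShape_discrete_of_essSurj [HasColimitsOfShape (Discrete I) D]
    [PreservesColimitsOfShape (Discrete I) F] : HasColimitsOfShape (Discrete I) E where
  has_colimit K := by
    have : HasColimit ((Discrete.functor fun i => F.objPreimage (K.obj ⟨i⟩)) ⋙ F) := inferInstance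
    exact hasColimit_of_iso
      (F := (Discrete.functor fun i => F.objPreimage (K.obj ⟨i⟩)) ⋙ F)
      (Discrete.natIso fun i => (F.objObjPreimageIso (K.obj i)).symm)

lemma preservesColimitsOfShape_discrete_of_essSurj [Preadditive E]
    (exists_desc : ∀ {Y : I → D} {s : Cofan Y} (_ : IsColimit s) {Z : D}
      (f : ∀ i, F.obj (Y i) ⟶ F.obj Z),
      ∃ g : F.obj s.pt ⟶ F.obj Z, ∀ i, F.map (s.inj i) ≫ g = f i)
    (eq_zero : ∀ {Y : I → D} {s : Cofan Y} (_ : IsColimit s) {Z : D}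
      (f : F.obj s.pt ⟶ F.obj Z), (∀ i, F.map (s.inj i) ≫ f = 0) → f = 0) :
    PreservesColimitsOfShape (Discrete I) F := by
  have (Y : I → D) : PreservesColimit (Discrete.functor Y) F := by
    constructor
    intro (s : Cofan Y) hs
    have exists_desc' (t : Cocone (Discrete.functor Y ⋙ F)) :
        ∃ g : F.obj s.pt ⟶ t.pt, ∀ i, F.map (s.inj i) ≫ g = t.ι.app ⟨i⟩ := by
      let e := F.objObjPreimageIso t.pt
      obtain ⟨g, hg⟩ := exists_desc hs fun i => t.ι.app ⟨i⟩ ≫ e.inv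
      refine ⟨g ≫ e.hom, fun i => ?_⟩
      rw [reassoc_of% hg i, e.inv_hom_id]
      exact Category.comp_id _
    choose d hd using exists_desc'
    refine ⟨⟨d, fun t j => hd t j.as, fun t m hm => ?_⟩⟩
    let e := F.objObjPreimageIso t.pt
    rw [← sub_eq_zero, ← cancel_mono e.inv, zero_comp]
    refine eq_zero hs _ fun i => ?_
    have : F.map (s.inj i) ≫ m = F.map (s.inj i) ≫ d t := (hm ⟨i⟩).trans (hd t i).symm
    rw [← Category.assoc, Preadditive.comp_sub, this, sub_self, zero_comp]
  exact preservesColimitsOfShape_of_discrete F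

end

section

variable {C : Type v₁} [Category.{v₂} C] [Abelian C] {ι : Type*} {c : ComplexShape ι}
  {I : Type*} [HasColimitsOfShape (Discrete I) C] [HasExactColimitsOfShape (Discrete I) C]

lemma quasiIso_sigma_desc {X Y : I → HomologicalComplex C c} {t : ∀ i, X i ⟶ Y i}
    (ht : ∀ i, QuasiIso (t i)) {s : Cofan Y} (hs : IsColimit s) :
    QuasiIso (Sigma.desc fun i => t i ≫ s.inj i) :=
  MorphismProperty.IsStableUnderColimitsOfShape.condition
    (W := HomologicalComplex.quasiIso C c) _ _ _ _ (coproductIsCoproduct X) hs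
    (Discrete.natTrans fun i => t i.as) (fun i => ht i.as) _ fun _ => Sigma.ι_desc _ _

end

section

variable {C : Type v₁} [Category.{v₂} C] [Preadditive C] {ι : Type*} {c : ComplexShape ι}
  {I : Type*} [HasColimitsOfShape (Discrete I) C]

/-- A coproduct of complexes is a coproduct in each degree. -/
noncomputable def isColimitCofanX {Y : I → HomologicalComplex C c} {s : Cofan Y}
    (hs : IsColimit s) (n : ι) :
    IsColimit (Cofan.mk (s.pt.X n) fun i => (s.inj i).f n) :=
  isColimitCofanMkObjOfIsColimit (HomologicalComplex.eval C c n) Y s.inj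
    (IsColimit.ofIsoColimit hs (Cofan.ext (Iso.refl _) (by simp)))

lemma isStrictlyGE_of_isColimit {n : ℤ} {Y : I → CochainComplex C ℤ}
    (hY : ∀ i, (Y i).IsStrictlyGE n) {s : Cofan Y} (hs : IsColimit s) :
    s.pt.IsStrictlyGE n := by
  rw [CochainComplex.isStrictlyGE_iff]
  intro p hp
  rw [IsZero.iff_id_eq_zero]
  refine Cofan.IsColimit.hom_ext (isColimitCofanX hs p) _ _ fun i => ?_
  exact ((Y i).isZero_of_isStrictlyGE n p hp).eq_of_src _ _

lemma nonempty_homotopy_zero_of_isColimit {Y : I → HomologicalComplex C c} {s : Cofan Y}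
    (hs : IsColimit s) {Z : HomologicalComplex C c} {f : s.pt ⟶ Z}
    (H : ∀ i, Nonempty (Homotopy (s.inj i ≫ f) 0)) : Nonempty (Homotopy f 0) := by
  let h (i : I) := (H i).some
  let k (p q : ι) : s.pt.X p ⟶ Z.X q :=
    Cofan.IsColimit.desc (isColimitCofanX hs p) fun i => (h i).hom p q
  have hk (i : I) (p q : ι) : (s.inj i).f p ≫ k p q = (h i).hom p q :=
    Cofan.IsColimit.fac (isColimitCofanX hs p) _ i
  refine ⟨{ hom := k, zero := fun p q hpq => ?_, comm := fun p => ?_ }⟩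
  · refine Cofan.IsColimit.hom_ext (isColimitCofanX hs p) _ _ fun i => ?_
    change (s.inj i).f p ≫ k p q = (s.inj i).f p ≫ 0
    rw [hk, comp_zero, (h i).zero p q hpq]
  · refine Cofan.IsColimit.hom_ext (isColimitCofanX hs p) _ _ fun i => ?_
    change (s.inj i).f p ≫ f.f p = (s.inj i).f p ≫ _
    rw [← HomologicalComplex.comp_f, (h i).comm p, Preadditive.comp_add, Preadditive.comp_add,
      ← dNext_comp_left, ← prevD_comp_left]
    simp only [hk, HomologicalComplex.zero_f, comp_zero]

lemma quotient_map_eq_zero_of_isColimit {Y : I → HomologicalComplex C c} {s : Cofan Y}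
    (hs : IsColimit s) {Z : HomologicalComplex C c} {f : s.pt ⟶ Z}
    (h : ∀ i, (HomotopyCategory.quotient C c).map (s.inj i ≫ f) = 0) :
    (HomotopyCategory.quotient C c).map f = 0 := by
  simp only [HomotopyCategory.quotient_map_eq_zero_iff] at h ⊢
  exact nonempty_homotopy_zero_of_isColimit hs h

instance : PreservesColimitsOfShape (Discrete I) (HomotopyCategory.quotient C c) := by
  refine preservesColimitsOfShape_discrete_of_essSurj _ (fun hs _ f => ?_) fun hs _ f hf => ?_
  · choose f' hf' using fun i => (HomotopyCategory.quotient C c).map_surjective (f i)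
    refine ⟨(HomotopyCategory.quotient C c).map (Cofan.IsColimit.desc hs f'), fun i => ?_⟩
    rw [← Functor.map_comp, Cofan.IsColimit.fac, hf']
  · obtain ⟨f, rfl⟩ := (HomotopyCategory.quotient C c).map_surjective f
    exact quotient_map_eq_zero_of_isColimit hs fun i => (Functor.map_comp _ _ _).trans (hf i)

instance : HasColimitsOfShape (Discrete I) (HomotopyCategory C c) :=
  hasColimitsOfShape_discrete_of_essSurj (HomotopyCategory.quotient C c)

end

section

open DerivedCategory

variable {C : Type v₁} [Category.{v₂} C] [Abelian C] [HasDerivedCategory.{u} C]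

lemma exists_quasiIso_quotient_map_comp_eq_zero {K L : CochainComplex C ℤ} {f : K ⟶ L}
    (hf : Q.map f = 0) :
    ∃ (K' : CochainComplex C ℤ) (s : K' ⟶ K),
      QuasiIso s ∧ (HomotopyCategory.quotient C _).map (s ≫ f) = 0 := by
  let q := HomotopyCategory.quotient C (ComplexShape.up ℤ)
  have hf' : Qh.map (q.map f) = Qh.map (0 : q.obj K ⟶ q.obj L) := by
    rw [Functor.map_zero]
    exact hf
  rw [MorphismProperty.map_eq_iff_precomp Qh (HomotopyCategory.quasiIso C _)] at hf'
  obtain ⟨K', s, hs, e⟩ := hf'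
  obtain ⟨K', rfl⟩ := HomotopyCategory.quotient_obj_surjective K'
  obtain ⟨s, rfl⟩ := q.map_surjective s
  rw [HomotopyCategory.quotient_map_mem_quasiIso_iff] at hs
  rw [comp_zero, ← q.map_comp] at e
  exact ⟨K', s, hs, e⟩

variable {I : Type*} [HasColimitsOfShape (Discrete I) C] [HasExactColimitsOfShape (Discrete I) C]

lemma exists_Q_map_inj_comp_eq {Y : I → CochainComplex C ℤ} {s : Cofan Y} (hs : IsColimit s)
    {Z : CochainComplex C ℤ} (f : ∀ i, Q.obj (Y i) ⟶ Q.obj Z) :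
    ∃ g : Q.obj s.pt ⟶ Q.obj Z, ∀ i, Q.map (s.inj i) ≫ g = f i := by
  choose X t ht g hg using fun i => right_fac (f i)
  have ht' (i : I) : QuasiIso (t i) := (isIso_Q_map_iff_quasiIso _ _).1 (ht i)
  let σ : ∐ X ⟶ s.pt := Sigma.desc fun i => t i ≫ s.inj i
  have : QuasiIso σ := quasiIso_sigma_desc ht' hs
  refine ⟨inv (Q.map σ) ≫ Q.map (Sigma.desc g), fun i => ?_⟩
  have hσ : Q.map (s.inj i) ≫ inv (Q.map σ) = inv (Q.map (t i)) ≫ Q.map (Sigma.ι X i) := by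
    rw [IsIso.comp_inv_eq, Category.assoc, ← Functor.map_comp, Sigma.ι_desc, Functor.map_comp,
      IsIso.inv_hom_id_assoc]
  rw [reassoc_of% hσ, ← Functor.map_comp, Sigma.ι_desc, hg]

lemma eq_zero_of_Q_map_inj_comp_eq_zero {Y : I → CochainComplex C ℤ} {s : Cofan Y}
    (hs : IsColimit s) {Z : CochainComplex C ℤ} (f : Q.obj s.pt ⟶ Q.obj Z)
    (hf : ∀ i, Q.map (s.inj i) ≫ f = 0) : f = 0 := by
  obtain ⟨Z', g, t, ht, rfl⟩ := left_fac f
  have hg (i : I) : Q.map (s.inj i ≫ g) = 0 := by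
    rw [← cancel_mono (inv (Q.map t)), Functor.map_comp, Category.assoc, hf, zero_comp]
  choose X σ hσ H using fun i => exists_quasiIso_quotient_map_comp_eq_zero (hg i)
  let τ : ∐ X ⟶ s.pt := Sigma.desc fun i => σ i ≫ s.inj i
  have : QuasiIso τ := quasiIso_sigma_desc hσ hs
  have hτ : (HomotopyCategory.quotient C _).map (τ ≫ g) = 0 :=
    quotient_map_eq_zero_of_isColimit (coproductIsCoproduct X) fun i =>
      (congrArg _ (by
        change Sigma.ι X i ≫ τ ≫ g = σ i ≫ s.inj i ≫ g
        rw [Sigma.ι_desc_assoc, Category.assoc])).trans (H i)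
  have hτ' : Q.map τ ≫ Q.map g = 0 := by
    rw [← Functor.map_comp]
    exact (Qh.congr_map hτ).trans (Qh.map_zero _ _)
  have hg' : Q.map g = 0 := by rwa [← cancel_epi (Q.map τ), comp_zero]
  rw [hg', zero_comp]

instance : PreservesColimitsOfShape (Discrete I) (Q : _ ⥤ DerivedCategory C) :=
  preservesColimitsOfShape_discrete_of_essSurj _ exists_Q_map_inj_comp_eq
    eq_zero_of_Q_map_inj_comp_eq_zero

instance : HasColimitsOfShape (Discrete I) (DerivedCategory C) :=
  hasColimitsOfShape_discrete_of_essSurj Q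

instance (n : ℤ) : ((TStructure.t (C := C)).ge n).IsClosedUnderColimitsOfShape (Discrete I) where
  colimitsOfShape_le := by
    rintro Z ⟨p⟩
    choose K hK e using fun i =>
      have : (p.diag.obj ⟨i⟩).IsGE n := ⟨p.prop_diag_obj ⟨i⟩⟩
      exists_iso_Q_obj_of_isGE (p.diag.obj ⟨i⟩) n
    have : (∐ K).IsStrictlyGE n := isStrictlyGE_of_isColimit hK (coproductIsCoproduct K)
    have e' : Q.obj (∐ K) ≅ Z := IsColimit.coconePointsIsoOfNatIso
      (isColimitOfHasCoproductOfPreservesColimit Q K) p.isColimit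
      (Discrete.natIso fun i => (e i.as).some.symm)
    exact (TStructure.t.isGE_of_iso e' n).ge

end

/-! ### The co-t-structure of brutal truncations -/

lemma distTriang_of_iso₃ {T : Type v₁} [Category.{v₂} T] [HasZeroObject T] [HasShift T ℤ]
    [Preadditive T] [∀ n : ℤ, (shiftFunctor T n).Additive] [Pretriangulated T] {X Y Z Z' : T}
    {f : X ⟶ Y} {g : Y ⟶ Z} {h : Z ⟶ X⟦(1 : ℤ)⟧} (hT : Triangle.mk f g h ∈ distTriang T)
    (e : Z' ≅ Z) : Triangle.mk f (g ≫ e.inv) (e.hom ≫ h) ∈ distTriang T :=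
  isomorphic_distinguished _ hT _ (Triangle.isoMk _ _ (Iso.refl X) (Iso.refl Y) e
    ((Category.comp_id f).trans (Category.id_comp f).symm)
    (((Category.assoc _ _ _).trans (g ≫= e.inv_hom_id)).trans
      ((Category.comp_id g).trans (Category.id_comp g).symm))
    (((e.hom ≫ h) ≫= CategoryTheory.Functor.map_id _ X).trans (Category.comp_id _)))

section

variable {A : Type v₁} [Category.{v₂} A] [Preadditive A]

lemma exists_degreewise_splitting {ι : Type*} {c : ComplexShape ι} (K : HomologicalComplex A c)
    {X Y : ι → A} {f : ∀ p, X p ⟶ K.X p} {g : ∀ p, K.X p ⟶ Y p} {r : ∀ p, K.X p ⟶ X p}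
    {s : ∀ p, Y p ⟶ K.X p} (fg : ∀ p, f p ≫ g p = 0) (fr : ∀ p, f p ≫ r p = 𝟙 _)
    (sg : ∀ p, s p ≫ g p = 𝟙 _) (rf : ∀ p, r p ≫ f p + g p ≫ s p = 𝟙 _)
    (fdg : ∀ p q, f p ≫ K.d p q ≫ g q = 0) :
    ∃ (L M : HomologicalComplex A c) (i : L ⟶ K) (π : K ⟶ M) (w : i ≫ π = 0),
      L.X = X ∧ M.X = Y ∧ Nonempty (∀ p,
        ((ShortComplex.mk i π w).map (HomologicalComplex.eval A c p)).Splitting) := by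
  have hfd (p q : ι) : (f p ≫ K.d p q ≫ r q) ≫ f q = f p ≫ K.d p q := by
    simp only [Category.assoc, eq_sub_of_add_eq (rf q), Preadditive.comp_sub, Category.comp_id]
    rw [reassoc_of% fdg p q, zero_comp, sub_zero]
  have hdg (p q : ι) : g p ≫ s p ≫ K.d p q ≫ g q = K.d p q ≫ g q := by
    rw [← Category.assoc (g p), eq_sub_of_add_eq' (rf p), Preadditive.sub_comp,
      Category.id_comp, Category.assoc, fdg, comp_zero, sub_zero]
  let L : HomologicalComplex A c :=
    { X := X
      d := fun p q => f p ≫ K.d p q ≫ r q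
      shape := fun p q h => by rw [K.shape _ _ h, zero_comp, comp_zero]
      d_comp_d' := fun p q t _ _ => by
        rw [← Category.assoc, hfd p q, Category.assoc, K.d_comp_d_assoc, zero_comp, comp_zero] }
  let M : HomologicalComplex A c :=
    { X := Y
      d := fun p q => s p ≫ K.d p q ≫ g q
      shape := fun p q h => by rw [K.shape _ _ h, zero_comp, comp_zero]
      d_comp_d' := fun p q t _ _ => by
        rw [Category.assoc, Category.assoc, hdg q t, K.d_comp_d_assoc, zero_comp, comp_zero] }
  exact ⟨L, M, { f := f, comm' := fun p q _ => (hfd p q).symm },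
    { f := g, comm' := fun p q _ => hdg p q }, by ext p; exact fg p, rfl, rfl,
    ⟨fun p => { r := r p, s := s p, f_r := fr p, s_g := sg p, id := rf p }⟩⟩

lemma exists_brutal_truncation [HasZeroObject A] (K : CochainComplex A ℤ) {m n : ℤ}
    (hmn : m + 1 = n) :
    ∃ (L M : CochainComplex A ℤ) (i : L ⟶ K) (π : K ⟶ M) (w : i ≫ π = 0),
      L.IsStrictlyGE n ∧ M.IsStrictlyLE m ∧ Nonempty (∀ p,
        ((ShortComplex.mk i π w).map (HomologicalComplex.eval A _ p)).Splitting) := by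
  have key (p : ℤ) : ∃ (X Y : A) (f : X ⟶ K.X p) (g : K.X p ⟶ Y) (r : K.X p ⟶ X)
      (s : Y ⟶ K.X p), f ≫ g = 0 ∧ f ≫ r = 𝟙 _ ∧ s ≫ g = 𝟙 _ ∧ r ≫ f + g ≫ s = 𝟙 _ ∧
      (p < n → IsZero X) ∧ (n ≤ p → IsZero Y) := by
    by_cases hp : p < n
    · exact ⟨0, K.X p, 0, 𝟙 _, 0, 𝟙 _, by simp, by simp, by simp, by simp,
        fun _ => isZero_zero _, fun h => by lia⟩
    · exact ⟨K.X p, 0, 𝟙 _, 0, 𝟙 _, 0, by simp, by simp, by simp, by simp,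
        fun h => by lia, fun _ => isZero_zero _⟩
  choose X Y f g r s fg fr sg rf hX hY using key
  have fdg (p q : ℤ) : f p ≫ K.d p q ≫ g q = 0 := by
    by_cases hpq : p + 1 = q
    · by_cases hp : p < n
      · exact (hX p hp).eq_of_src _ _
      · exact (hY q (by lia)).eq_of_tgt _ _
    · rw [K.shape p q hpq, zero_comp, comp_zero]
  obtain ⟨L, M, i, π, w, rfl, rfl, σ⟩ := exists_degreewise_splitting K fg fr sg rf fdg
  exact ⟨L, M, i, π, w, (CochainComplex.isStrictlyGE_iff L n).2 hX,
    (CochainComplex.isStrictlyLE_iff M m).2 fun p hp => hY p (by lia), σ⟩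

variable (A) in
/-- The objects of the homotopy category which are homotopy equivalent to a complex in
degrees `≥ n`. For `n = 0` this is the first half of the co-t-structure of brutal truncations. -/
def homotopyGE (n : ℤ) : ObjectProperty (HomotopyCategory A (ComplexShape.up ℤ)) :=
  fun K => ∃ L : CochainComplex A ℤ, L.IsStrictlyGE n ∧
    Nonempty (K ≅ (HomotopyCategory.quotient _ _).obj L)

variable (A) in
/-- The objects of the homotopy category which are homotopy equivalent to a complex in
degrees `≤ n`. For `n = 0` this is the second half of the co-t-structure of brutal truncations. -/
def homotopyLE (n : ℤ) : ObjectProperty (HomotopyCategory A (ComplexShape.up ℤ)) :=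
  fun K => ∃ L : CochainComplex A ℤ, L.IsStrictlyLE n ∧
    Nonempty (K ≅ (HomotopyCategory.quotient _ _).obj L)

instance (n : ℤ) : (homotopyGE A n).IsClosedUnderIsomorphisms where
  of_iso e := fun ⟨L, hL, ⟨e'⟩⟩ => ⟨L, hL, ⟨e.symm ≪≫ e'⟩⟩

lemma homotopyGE_quotient (K : CochainComplex A ℤ) (n : ℤ) [K.IsStrictlyGE n] :
    homotopyGE A n ((HomotopyCategory.quotient _ _).obj K) :=
  ⟨K, inferInstance, ⟨Iso.refl _⟩⟩

lemma homotopyLE_quotient (K : CochainComplex A ℤ) (n : ℤ) [K.IsStrictlyLE n] :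
    homotopyLE A n ((HomotopyCategory.quotient _ _).obj K) :=
  ⟨K, inferInstance, ⟨Iso.refl _⟩⟩

lemma homotopyGE_mono {m n : ℤ} (hmn : m ≤ n) : homotopyGE A n ≤ homotopyGE A m := by
  rintro K ⟨L, hL, e⟩
  exact ⟨L, L.isStrictlyGE_of_ge m n hmn, e⟩

lemma homotopyLE_mono {m n : ℤ} (hmn : m ≤ n) : homotopyLE A m ≤ homotopyLE A n := by
  rintro K ⟨L, hL, e⟩
  exact ⟨L, L.isStrictlyLE_of_le m n hmn, e⟩

lemma homotopyGE_shift {K : HomotopyCategory A (ComplexShape.up ℤ)} {n : ℤ}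
    (hK : homotopyGE A n K) (a n' : ℤ) (h : a + n' = n) : homotopyGE A n' (K⟦a⟧) := by
  obtain ⟨L, hL, ⟨e⟩⟩ := hK
  exact ⟨L⟦a⟧, L.isStrictlyGE_shift n a n' h,
    ⟨(shiftFunctor _ a).mapIso e ≪≫
      (((HomotopyCategory.quotient A (ComplexShape.up ℤ)).commShiftIso a).app L).symm⟩⟩

lemma homotopyLE_shift {K : HomotopyCategory A (ComplexShape.up ℤ)} {n : ℤ}
    (hK : homotopyLE A n K) (a n' : ℤ) (h : a + n' = n) : homotopyLE A n' (K⟦a⟧) := by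
  obtain ⟨L, hL, ⟨e⟩⟩ := hK
  exact ⟨L⟦a⟧, L.isStrictlyLE_shift n a n' h,
    ⟨(shiftFunctor _ a).mapIso e ≪≫
      (((HomotopyCategory.quotient A (ComplexShape.up ℤ)).commShiftIso a).app L).symm⟩⟩

lemma hom_eq_zero_of_homotopyGE_of_homotopyLE {K L : HomotopyCategory A (ComplexShape.up ℤ)}
    {m n : ℤ} (hmn : m < n) (hK : homotopyGE A n K) (hL : homotopyLE A m L) (f : K ⟶ L) :
    f = 0 := by
  obtain ⟨K', hK', ⟨e⟩⟩ := hK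
  obtain ⟨L', hL', ⟨e'⟩⟩ := hL
  obtain ⟨g, hg⟩ := (HomotopyCategory.quotient A (ComplexShape.up ℤ)).map_surjective
    (e.inv ≫ f ≫ e'.hom)
  have hg₀ : g = 0 := by
    ext p
    by_cases hp : p < n
    · exact (K'.isZero_of_isStrictlyGE n p hp).eq_of_src _ _
    · exact (L'.isZero_of_isStrictlyLE m p (by lia)).eq_of_tgt _ _
  rw [← cancel_epi e.inv, ← cancel_mono e'.hom, Category.assoc, ← hg, hg₀, Functor.map_zero,
    comp_zero, zero_comp]

lemma exists_distTriang_homotopyGE_homotopyLE [HasZeroObject A] [HasBinaryBiproducts A]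
    (K : HomotopyCategory A (ComplexShape.up ℤ)) {m n : ℤ} (hmn : m + 1 = n) :
    ∃ (L M : HomotopyCategory A (ComplexShape.up ℤ)) (f : L ⟶ K) (g : K ⟶ M)
      (h : M ⟶ L⟦(1 : ℤ)⟧), Triangle.mk f g h ∈ distTriang _ ∧ homotopyGE A n L ∧
        homotopyLE A m M := by
  obtain ⟨K, rfl⟩ := HomotopyCategory.quotient_obj_surjective K
  obtain ⟨L, M, i, π, w, _, _, ⟨σ⟩⟩ := exists_brutal_truncation K hmn
  exact ⟨_, _, _, _, _, (HomotopyCategory.distinguished_iff_iso_trianglehOfDegreewiseSplit _).2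
    ⟨ShortComplex.mk i π w, σ, ⟨Iso.refl _⟩⟩, homotopyGE_quotient L n, homotopyLE_quotient M m⟩

end

section

variable {A : Type v₁} [Category.{v₂} A] [Preadditive A] {ι : Type*} {c : ComplexShape ι}

lemma nullHomotopicMap_comp_eq_self {K M : HomologicalComplex A c} {g : K ⟶ M}
    (k : Homotopy g 0) {s : ∀ p, M.X p ⟶ K.X p} (sg : ∀ p, s p ≫ g.f p = 𝟙 _) :
    Homotopy.nullHomotopicMap (fun p q => k.hom p q ≫ s q) ≫ g = g := by
  rw [Homotopy.nullHomotopicMap_comp]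
  ext p
  simpa only [Homotopy.nullHomotopicMap, Category.assoc, sg, Category.comp_id,
    HomologicalComplex.zero_f, add_zero] using (k.comm p).symm

lemma comp_nullHomotopicMap_eq_self {L K : HomologicalComplex A c} {f : L ⟶ K}
    (k : Homotopy f 0) {r : ∀ p, K.X p ⟶ L.X p} (fr : ∀ p, f.f p ≫ r p = 𝟙 _) :
    f ≫ Homotopy.nullHomotopicMap (fun p q => r p ≫ k.hom p q) = f := by
  rw [Homotopy.comp_nullHomotopicMap]
  ext p
  simpa only [Homotopy.nullHomotopicMap, ← Category.assoc, fr, Category.id_comp,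
    HomologicalComplex.zero_f, add_zero] using (k.comm p).symm

lemma exists_iso_of_idempotent_of_homotopy_zero [IsIdempotentComplete A]
    {K : HomologicalComplex A c} {t : K ⟶ K} (ht : t ≫ t = t) (h : Homotopy t 0) :
    ∃ L : HomologicalComplex A c, Nonempty ((HomotopyCategory.quotient _ _).obj K ≅
      (HomotopyCategory.quotient _ _).obj L) ∧ ∀ p, t.f p = 𝟙 _ → IsZero (L.X p) := by
  obtain ⟨L, i, e, hie, hei⟩ := IsIdempotentComplete.idempotents_split K (𝟙 K - t)
    (Idempotents.idem_of_id_sub_idem t ht)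
  refine ⟨L, ⟨(HomotopyCategory.quotient _ _).map e, (HomotopyCategory.quotient _ _).map i,
    ?_, ?_⟩, fun p hp => ?_⟩
  · rw [← Functor.map_comp, hei, Functor.map_sub, HomotopyCategory.eq_of_homotopy _ _ h,
      Functor.map_zero, sub_zero, CategoryTheory.Functor.map_id]
  · rw [← Functor.map_comp, hie, CategoryTheory.Functor.map_id]
  · have hie' : i.f p ≫ e.f p = 𝟙 _ := congr(($hie).f p)
    have hei' : e.f p ≫ i.f p = 0 := by
      rw [← HomologicalComplex.comp_f, hei, HomologicalComplex.sub_f_apply, hp,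
        HomologicalComplex.id_f, sub_self]
    rw [IsZero.iff_id_eq_zero]
    calc 𝟙 _ = (i.f p ≫ e.f p) ≫ i.f p ≫ e.f p := by rw [hie', Category.comp_id]
      _ = 0 := by rw [Category.assoc, reassoc_of% hei', zero_comp, comp_zero]

end

section

variable {A : Type v₁} [Category.{v₂} A] [Preadditive A] [IsIdempotentComplete A]
  {K : CochainComplex A ℤ}

lemma homotopyGE_of_nullHomotopicMap_f_eq_id {n : ℤ} {h : ∀ p q, K.X p ⟶ K.X q}
    (hrel : ∀ p q, ¬ (ComplexShape.up ℤ).Rel q p → h p q = 0)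
    (h_ge : ∀ p q, n ≤ q → h p q = 0)
    (h_lt : ∀ p < n, (Homotopy.nullHomotopicMap h).f p = 𝟙 _) :
    homotopyGE A n ((HomotopyCategory.quotient _ _).obj K) := by
  set t := Homotopy.nullHomotopicMap h
  have ht (p : ℤ) (hp : n ≤ p) : t.f p = h p (p - 1) ≫ K.d (p - 1) p := by
    rw [Homotopy.nullHomotopicMap_f (sub_add_cancel p 1) rfl h, h_ge _ p hp, comp_zero, zero_add]
  have htt : t ≫ t = t := by
    ext p
    rw [HomologicalComplex.comp_f]
    by_cases hp : p < n
    · rw [h_lt p hp, Category.comp_id]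
    · rw [ht p (by lia), Category.assoc]
      by_cases hp' : p - 1 < n
      · rw [← ht p (by lia), ← t.comm, h_lt _ hp', Category.id_comp, ht p (by lia)]
      · rw [h_ge p (p - 1) (by lia), zero_comp, zero_comp]
  obtain ⟨L, e, hL⟩ := exists_iso_of_idempotent_of_homotopy_zero htt
    (Homotopy.nullHomotopy h hrel)
  exact ⟨L, (CochainComplex.isStrictlyGE_iff L n).2 fun p hp => hL p (h_lt p hp), e⟩

lemma homotopyLE_of_nullHomotopicMap_f_eq_id {m : ℤ} {h : ∀ p q, K.X p ⟶ K.X q}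
    (hrel : ∀ p q, ¬ (ComplexShape.up ℤ).Rel q p → h p q = 0)
    (h_le : ∀ p q, p ≤ m → h p q = 0)
    (h_gt : ∀ p > m, (Homotopy.nullHomotopicMap h).f p = 𝟙 _) :
    homotopyLE A m ((HomotopyCategory.quotient _ _).obj K) := by
  set t := Homotopy.nullHomotopicMap h
  have ht (p : ℤ) (hp : p ≤ m) : t.f p = K.d p (p + 1) ≫ h (p + 1) p := by
    rw [Homotopy.nullHomotopicMap_f (sub_add_cancel p 1) rfl h, h_le p _ hp, zero_comp, add_zero]
  have htt : t ≫ t = t := by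
    ext p
    rw [HomologicalComplex.comp_f]
    by_cases hp : m < p
    · rw [h_gt p hp, Category.comp_id]
    · rw [ht p (by lia)]
      by_cases hp' : m < p + 1
      · rw [← Category.assoc, ← ht p (by lia), t.comm, h_gt _ hp', Category.comp_id,
          ht p (by lia)]
      · rw [h_le (p + 1) p (by lia), comp_zero, comp_zero]
  obtain ⟨L, e, hL⟩ := exists_iso_of_idempotent_of_homotopy_zero htt
    (Homotopy.nullHomotopy h hrel)
  exact ⟨L, (CochainComplex.isStrictlyLE_iff L m).2 fun p hp => hL p (h_gt p hp), e⟩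

end

section

variable {A : Type v₁} [Category.{v₂} A] [Preadditive A] [IsIdempotentComplete A]
  [HasZeroObject A]

lemma homotopyGE_eq_leftOrthogonal {m n : ℤ} (hmn : m + 1 = n) :
    homotopyGE A n = (homotopyLE A m).leftOrthogonal := by
  ext K
  refine ⟨fun hK L f hL => hom_eq_zero_of_homotopyGE_of_homotopyLE (by lia) hK hL f, fun hK => ?_⟩
  obtain ⟨K, rfl⟩ := HomotopyCategory.quotient_obj_surjective K
  obtain ⟨L, M, i, π, w, _, _, ⟨σ⟩⟩ := exists_brutal_truncation K hmn
  obtain ⟨k⟩ := (HomotopyCategory.quotient_map_eq_zero_iff π).1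
    (hK ((HomotopyCategory.quotient _ _).map π) (homotopyLE_quotient M m))
  let s (p : ℤ) : M.X p ⟶ K.X p := (σ p).s
  have hs (p : ℤ) (hp : n ≤ p) : s p = 0 :=
    (M.isZero_of_isStrictlyLE m p (by lia)).eq_of_src _ _
  have hπs (p : ℤ) (hp : p < n) : π.f p ≫ s p = 𝟙 _ := by
    have : (show K.X p ⟶ L.X p from (σ p).r) ≫ i.f p + π.f p ≫ s p = 𝟙 _ := (σ p).id
    rwa [(L.isZero_of_isStrictlyGE n p hp).eq_of_src (i.f p) 0, comp_zero, zero_add] at this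
  refine homotopyGE_of_nullHomotopicMap_f_eq_id (h := fun p q => k.hom p q ≫ s q)
    (fun p q hpq => by rw [k.zero p q hpq, zero_comp])
    (fun p q hq => by rw [hs q hq, comp_zero]) fun p hp => ?_
  rw [← Category.comp_id (HomologicalComplex.Hom.f _ p), ← hπs p hp, ← Category.assoc,
    ← HomologicalComplex.comp_f, nullHomotopicMap_comp_eq_self k fun p => (σ p).s_g]

lemma homotopyLE_eq_rightOrthogonal {m n : ℤ} (hmn : m + 1 = n) :
    homotopyLE A m = (homotopyGE A n).rightOrthogonal := by
  ext K
  refine ⟨fun hK L f hL => hom_eq_zero_of_homotopyGE_of_homotopyLE (by lia) hL hK f, fun hK => ?_⟩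
  obtain ⟨K, rfl⟩ := HomotopyCategory.quotient_obj_surjective K
  obtain ⟨L, M, i, π, w, _, _, ⟨σ⟩⟩ := exists_brutal_truncation K hmn
  obtain ⟨k⟩ := (HomotopyCategory.quotient_map_eq_zero_iff i).1
    (hK ((HomotopyCategory.quotient _ _).map i) (homotopyGE_quotient L n))
  let r (p : ℤ) : K.X p ⟶ L.X p := (σ p).r
  have hr (p : ℤ) (hp : p ≤ m) : r p = 0 :=
    (L.isZero_of_isStrictlyGE n p (by lia)).eq_of_tgt _ _
  have hri (p : ℤ) (hp : m < p) : r p ≫ i.f p = 𝟙 _ := by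
    have : r p ≫ i.f p + π.f p ≫ (show M.X p ⟶ K.X p from (σ p).s) = 𝟙 _ := (σ p).id
    rwa [(M.isZero_of_isStrictlyLE m p hp).eq_of_tgt (π.f p) 0, zero_comp, add_zero] at this
  refine homotopyLE_of_nullHomotopicMap_f_eq_id (h := fun p q => r p ≫ k.hom p q)
    (fun p q hpq => by rw [k.zero p q hpq, comp_zero])
    (fun p q hp => by rw [hr p hp, zero_comp]) fun p hp => ?_
  rw [← Category.id_comp (HomologicalComplex.Hom.f _ p), ← hri p hp, Category.assoc,
    ← HomologicalComplex.comp_f, comp_nullHomotopicMap_eq_self k fun p => (σ p).f_r]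

theorem isCoTStructure_homotopyCategory [HasBinaryBiproducts A] :
    IsCoTStructure (homotopyGE A 0) (homotopyLE A 0) where
  left_retracts := ⟨fun {X Y} ρ hY => by
    rw [homotopyGE_eq_leftOrthogonal (neg_add_cancel 1)] at hY ⊢
    intro L f hL
    rw [← Category.id_comp f, ← ρ.retract, Category.assoc, hY (ρ.r ≫ f) hL, comp_zero]⟩
  right_retracts := ⟨fun {X Y} ρ hY => by
    rw [homotopyLE_eq_rightOrthogonal (zero_add 1)] at hY ⊢
    intro L f hL
    rw [← Category.comp_id f, ← ρ.retract, ← Category.assoc, hY (f ≫ ρ.i) hL, zero_comp]⟩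
  left_shift Y hY := homotopyGE_mono zero_le_one _ (homotopyGE_shift hY (-1) 1 (by simp))
  right_shift Y hY := homotopyLE_mono (by simp) _ (homotopyLE_shift hY 1 (-1) (by simp))
  hom_eq_zero Y Z f hY hZ := hom_eq_zero_of_homotopyGE_of_homotopyLE (by simp) hY
    (homotopyLE_shift hZ 1 (-1) (by simp)) f
  exists_triangle K := by
    obtain ⟨L, M, f, g, h, hT, hL, hM⟩ :=
      exists_distTriang_homotopyGE_homotopyLE K (neg_add_cancel 1)
    exact ⟨L, M⟦(-1 : ℤ)⟧, f, _, _,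
      distTriang_of_iso₃ hT ((shiftEquiv _ (1 : ℤ)).counitIso.app M), hL,
      homotopyLE_shift hM _ _ (by simp)⟩

end

/-! ### From complexes of injectives to the derived category -/

section

open DerivedCategory

instance {C : Type v₁} [Category.{v₂} C] [Abelian C] :
    IsIdempotentComplete (InjectiveObject C) where
  idempotents_split X p hp := by
    obtain ⟨Y, i, e, h₁, h₂⟩ := IsIdempotentComplete.idempotents_split X.obj p.hom
      (congr(($hp).hom))
    have : Injective Y := Retract.injective ⟨i, e, h₁⟩
    exact ⟨⟨Y, this⟩, ⟨i⟩, ⟨e⟩, by ext; exact h₁, by ext; exact h₂⟩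

instance {A : Type v₁} [Category.{v₂} A] [Preadditive A] [HasZeroObject A]
    [HasBinaryBiproducts A] [IsIdempotentComplete A] (n : ℤ) :
    (homotopyGE A n).IsTriangulatedClosed₂ := by
  rw [homotopyGE_eq_leftOrthogonal (sub_add_cancel n 1)]
  infer_instance

instance {A : Type v₁} [Category.{v₂} A] [Preadditive A] [HasZeroObject A] (n : ℤ) :
    (homotopyGE A n).ContainsZero :=
  ⟨_, Functor.map_isZero (HomotopyCategory.quotient A (ComplexShape.up ℤ)) (isZero_zero _),
    homotopyGE_quotient 0 n⟩

variable {C : Type v₁} [Category.{v₂} C] [Abelian C]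

variable (C) in
/-- The inclusion into the homotopy category of `C` of that of its injective objects. -/
noncomputable abbrev kInjToK : HomotopyCategory (InjectiveObject C) (ComplexShape.up ℤ) ⥤
    HomotopyCategory C (ComplexShape.up ℤ) :=
  (InjectiveObject.ι C).mapHomotopyCategory (ComplexShape.up ℤ)

lemma homotopyGE_kInjToK {K : HomotopyCategory (InjectiveObject C) (ComplexShape.up ℤ)} {n : ℤ}
    (hK : homotopyGE _ n K) : homotopyGE C n ((kInjToK C).obj K) := by
  obtain ⟨L, hL, ⟨e⟩⟩ := hK
  exact ⟨((InjectiveObject.ι C).mapHomologicalComplex _).obj L,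
    (CochainComplex.isStrictlyGE_mapHomologicalComplex_obj_iff _ _ _).2 hL,
    ⟨(kInjToK C).mapIso e⟩⟩

lemma homotopyLE_kInjToK {K : HomotopyCategory (InjectiveObject C) (ComplexShape.up ℤ)} {n : ℤ}
    (hK : homotopyLE _ n K) : homotopyLE C n ((kInjToK C).obj K) := by
  obtain ⟨L, hL, ⟨e⟩⟩ := hK
  exact ⟨((InjectiveObject.ι C).mapHomologicalComplex _).obj L,
    (CochainComplex.isStrictlyLE_mapHomologicalComplex_obj_iff _ _ _).2 hL,
    ⟨(kInjToK C).mapIso e⟩⟩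

variable [HasDerivedCategory.{u} C]

variable (C) in
/-- The canonical functor from the homotopy category of complexes of injectives to the derived
category. -/
noncomputable abbrev kInjToD : HomotopyCategory (InjectiveObject C) (ComplexShape.up ℤ) ⥤
    DerivedCategory C :=
  kInjToK C ⋙ Qh

lemma Qh_map_bijective_of_homotopyGE (K : HomotopyCategory C (ComplexShape.up ℤ))
    {L : HomotopyCategory (InjectiveObject C) (ComplexShape.up ℤ)} {n : ℤ}
    (hL : homotopyGE _ n L) :
    Function.Bijective (Qh.map : (K ⟶ (kInjToK C).obj L) → _) := by
  obtain ⟨L', hL', ⟨e⟩⟩ := hL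
  let L₀ := ((InjectiveObject.ι C).mapHomologicalComplex (ComplexShape.up ℤ)).obj L'
  have : CochainComplex.IsStrictlyGE L₀ n :=
    (CochainComplex.isStrictlyGE_mapHomologicalComplex_obj_iff _ _ _).2 hL'
  have (p : ℤ) : Injective (L₀.X p) := (L'.X p).2
  have : CochainComplex.IsKInjective L₀ := CochainComplex.isKInjective_of_injective L₀ n
  have hL₀ := CochainComplex.IsKInjective.Qh_map_bijective K L₀
  let e' : (kInjToK C).obj L ≅ (HomotopyCategory.quotient _ _).obj L₀ := (kInjToK C).mapIso e
  constructor
  · intro f g hfg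
    rw [← cancel_mono e'.hom]
    apply hL₀.injective
    rw [Functor.map_comp, Functor.map_comp, hfg]
  · intro f
    obtain ⟨g, hg⟩ := hL₀.surjective (f ≫ Qh.map e'.hom)
    refine ⟨g ≫ e'.inv, ?_⟩
    rw [Functor.map_comp, hg, Category.assoc, ← Functor.map_comp, e'.hom_inv_id,
      CategoryTheory.Functor.map_id, Category.comp_id]

lemma kInjToD_map_bijective (K : HomotopyCategory (InjectiveObject C) (ComplexShape.up ℤ))
    {L : HomotopyCategory (InjectiveObject C) (ComplexShape.up ℤ)} {n : ℤ}
    (hL : homotopyGE _ n L) :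
    Function.Bijective ((kInjToD C).map : (K ⟶ L) → _) :=
  (Qh_map_bijective_of_homotopyGE _ hL).comp
    ((Functor.FullyFaithful.ofFullyFaithful (kInjToK C)).map_bijective K L)

lemma nonempty_iso_of_kInjToD_iso
    {K L : HomotopyCategory (InjectiveObject C) (ComplexShape.up ℤ)} {m n : ℤ}
    (hK : homotopyGE _ m K) (hL : homotopyGE _ n L)
    (e : (kInjToD C).obj K ≅ (kInjToD C).obj L) : Nonempty (K ≅ L) := by
  obtain ⟨f, hf⟩ := (kInjToD_map_bijective K hL).surjective e.hom
  obtain ⟨g, hg⟩ := (kInjToD_map_bijective L hK).surjective e.inv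
  refine ⟨f, g, (kInjToD_map_bijective K hK).injective ?_,
    (kInjToD_map_bijective L hL).injective ?_⟩
  · rw [Functor.map_comp, hf, hg, e.hom_inv_id, CategoryTheory.Functor.map_id]
  · rw [Functor.map_comp, hf, hg, e.inv_hom_id, CategoryTheory.Functor.map_id]

lemma exists_kInjToD_iso [EnoughInjectives C] (X : DerivedCategory C) (n : ℤ) [X.IsGE n] :
    ∃ L : HomotopyCategory (InjectiveObject C) (ComplexShape.up ℤ),
      homotopyGE _ n L ∧ Nonempty ((kInjToD C).obj L ≅ X) := by
  obtain ⟨K, hK, ⟨e⟩⟩ := exists_iso_Q_obj_of_isGE X n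
  obtain ⟨L, hL, i, hi⟩ := CochainComplex.Plus.exists_quasiIso_injective ⟨K, n, hK⟩ n
  have : QuasiIso i.hom := hi
  exact ⟨(HomotopyCategory.quotient _ _).obj L.obj, homotopyGE_quotient _ _,
    ⟨(asIso (Q.map i.hom)).symm ≪≫ e.symm⟩⟩

lemma isGE_kInjToD_obj {K : HomotopyCategory (InjectiveObject C) (ComplexShape.up ℤ)} {n : ℤ}
    (hK : homotopyGE _ n K) : ((kInjToD C).obj K).IsGE n := by
  obtain ⟨L, hL, ⟨e⟩⟩ := homotopyGE_kInjToK hK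
  have : (Q.obj L).IsGE n := (isGE_Q_obj_iff L n).2 inferInstance
  exact TStructure.t.isGE_of_iso (show Q.obj L ≅ (kInjToD C).obj K from (Qh.mapIso e).symm) n

lemma homotopyGE_of_isGE [EnoughInjectives C]
    {K : HomotopyCategory (InjectiveObject C) (ComplexShape.up ℤ)} {m : ℤ}
    (hK : homotopyGE _ m K) (n : ℤ) [((kInjToD C).obj K).IsGE n] : homotopyGE _ n K := by
  obtain ⟨L, hL, ⟨e⟩⟩ := exists_kInjToD_iso ((kInjToD C).obj K) n
  obtain ⟨e'⟩ := nonempty_iso_of_kInjToD_iso hL hK e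
  exact ObjectProperty.prop_of_iso _ e' hL

/-- Truncating the target `Y`, which may be unbounded, replaces it by a bounded below complex of
injectives. -/
lemma hom_eq_zero_of_isZero_Qh {Z : HomotopyCategory C (ComplexShape.up ℤ)} {n : ℤ}
    (hZ : homotopyGE C n Z) (hZ' : IsZero (Qh.obj Z))
    {Y : HomotopyCategory (InjectiveObject C) (ComplexShape.up ℤ)}
    (f : Z ⟶ (kInjToK C).obj Y) : f = 0 := by
  obtain ⟨L, M, i, g, h, hT, hL, hM⟩ :=
    exists_distTriang_homotopyGE_homotopyLE Y (sub_add_cancel n 1)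
  obtain ⟨φ, rfl⟩ := Triangle.coyoneda_exact₂ _ ((kInjToK C).map_distinguished _ hT) f
    (hom_eq_zero_of_homotopyGE_of_homotopyLE (by simp) hZ (homotopyLE_kInjToK hM) _)
  have hφ : φ = 0 :=
    (Qh_map_bijective_of_homotopyGE Z hL).injective (hZ'.eq_of_src _ _)
  rw [hφ]
  exact zero_comp

lemma comp_kInjToK_map_bijective {P : HomotopyCategory C (ComplexShape.up ℤ)}
    {I : HomotopyCategory (InjectiveObject C) (ComplexShape.up ℤ)} {m n : ℤ}
    (hP : homotopyGE C m P) (hI : homotopyGE _ n I) (j : P ⟶ (kInjToK C).obj I)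
    [IsIso (Qh.map j)] (Y : HomotopyCategory (InjectiveObject C) (ComplexShape.up ℤ)) :
    Function.Bijective fun f : I ⟶ Y => j ≫ (kInjToK C).map f := by
  obtain ⟨Z, g, h, hT⟩ := distinguished_cocone_triangle j
  have hZ : homotopyGE C (min (m - 1) n) Z :=
    ObjectProperty.ext_of_isTriangulatedClosed₂ _ _ (rot_of_distTriang _ hT)
      (homotopyGE_mono (min_le_right _ _) _ (homotopyGE_kInjToK hI))
      (homotopyGE_mono (min_le_left _ _) _ (homotopyGE_shift hP 1 (m - 1) (by simp)))
  have hZ' : IsZero (Qh.obj Z) :=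
    Triangle.isZero₃_of_isIso₁ _ (Qh.map_distinguished _ hT) (by assumption)
  have hZ₁ : homotopyGE C (1 + min (m - 1) n) (Z⟦(-1 : ℤ)⟧) := homotopyGE_shift hZ _ _ (by simp)
  have hZ₁' : IsZero (Qh.obj (Z⟦(-1 : ℤ)⟧)) :=
    ((shiftFunctor _ (-1 : ℤ)).map_isZero hZ').of_iso ((Qh.commShiftIso (-1 : ℤ)).app Z)
  refine Function.Bijective.comp (g := fun f : (kInjToK C).obj I ⟶ (kInjToK C).obj Y => j ≫ f)
    ⟨fun f₁ f₂ hf => ?_, fun f => ?_⟩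
    ((Functor.FullyFaithful.ofFullyFaithful (kInjToK C)).map_bijective I Y)
  · rw [← sub_eq_zero]
    obtain ⟨φ, hφ⟩ := Triangle.yoneda_exact₂ _ hT (f₁ - f₂)
      ((Preadditive.comp_sub _ _ _).trans (sub_eq_zero.2 hf))
    obtain rfl := hom_eq_zero_of_isZero_Qh hZ hZ' φ
    exact hφ.trans comp_zero
  · obtain ⟨φ, hφ⟩ := Triangle.yoneda_exact₂ _ (inv_rot_of_distTriang _ hT) f
      (hom_eq_zero_of_isZero_Qh hZ₁ hZ₁' _)
    exact ⟨φ, hφ.symm⟩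

lemma exists_distTriang_kInjToD [EnoughInjectives C]
    {L : HomotopyCategory (InjectiveObject C) (ComplexShape.up ℤ)} {n : ℤ}
    (hL : homotopyGE _ n L) {X A B : DerivedCategory C} (e : (kInjToD C).obj L ≅ X)
    {f : A ⟶ X} {g : X ⟶ B} {h : B ⟶ A⟦(1 : ℤ)⟧} (hT : Triangle.mk f g h ∈ distTriang _)
    (a b : ℤ) [A.IsGE a] [B.IsGE b] :
    ∃ (A' B' : HomotopyCategory (InjectiveObject C) (ComplexShape.up ℤ))
      (f' : A' ⟶ L) (g' : L ⟶ B') (h' : B' ⟶ A'⟦(1 : ℤ)⟧),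
      Triangle.mk f' g' h' ∈ distTriang _ ∧ homotopyGE _ a A' ∧ homotopyGE _ b B' ∧
        Nonempty ((kInjToD C).obj A' ≅ A) ∧ Nonempty ((kInjToD C).obj B' ≅ B) := by
  obtain ⟨A', hA', ⟨eA⟩⟩ := exists_kInjToD_iso A a
  obtain ⟨f', hf'⟩ := (kInjToD_map_bijective A' hL).surjective (eA.hom ≫ f ≫ e.inv)
  obtain ⟨B', g', h', hT'⟩ := distinguished_cocone_triangle f'
  have hB' : homotopyGE _ (min n (a - 1)) B' :=
    ObjectProperty.ext_of_isTriangulatedClosed₂ _ _ (rot_of_distTriang _ hT')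
      (homotopyGE_mono (min_le_left _ _) _ hL)
      (homotopyGE_mono (min_le_right _ _) _ (homotopyGE_shift hA' 1 (a - 1) (by simp)))
  have eB : (kInjToD C).obj B' ≅ B := Triangle.π₃.mapIso
    (isoTriangleOfIso₁₂ _ _ ((kInjToD C).map_distinguished _ hT') hT eA e (by
      change (kInjToD C).map f' ≫ e.hom = eA.hom ≫ f
      rw [hf', Category.assoc, Category.assoc, e.inv_hom_id, Category.comp_id]))
  have : ((kInjToD C).obj B').IsGE b := TStructure.t.isGE_of_iso eB.symm b
  exact ⟨A', B', f', g', h', hT', hA', homotopyGE_of_isGE hB' b, ⟨eA⟩, ⟨eB⟩⟩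

end

/-! ### Lifting generation from the derived category to complexes of injectives -/

section

open DerivedCategory

variable {C : Type v₁} [Category.{v₂} C] [Abelian C]
  [HasCoproducts.{w} C] [∀ I : Type w, (isInjective C).IsClosedUnderColimitsOfShape (Discrete I)]

instance : HasCoproducts.{w} (InjectiveObject C) := fun _ => inferInstance

/-- Coproducts of complexes of injectives are computed degreewise in `C`. -/
noncomputable def isColimitMapHomologicalComplexInjectiveι {I : Type w}
    {Y : I → CochainComplex (InjectiveObject C) ℤ} {s : Cofan Y} (hs : IsColimit s) :
    IsColimit (Cofan.mk
      (((InjectiveObject.ι C).mapHomologicalComplex (ComplexShape.up ℤ)).obj s.pt)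
      fun i => ((InjectiveObject.ι C).mapHomologicalComplex (ComplexShape.up ℤ)).map (s.inj i)) :=
  HomologicalComplex.isColimitOfEval _ _ fun n =>
    (isColimitMapCoconeCofanMkEquiv (HomologicalComplex.eval C (ComplexShape.up ℤ) n) _ _).symm
      (isColimitCofanMkObjOfIsColimit (InjectiveObject.ι C) _ _ (isColimitCofanX hs n))

variable [HasDerivedCategory.{u} C] [∀ I : Type w, HasExactColimitsOfShape (Discrete I) C]

lemma exists_lift_of_bigAdd_shiftsIn
    {H : HomotopyCategory (InjectiveObject C) (ComplexShape.up ℤ)}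
    {a l : ℤ} (hH : homotopyGE _ a H) {G : DerivedCategory C} (e : (kInjToD C).obj H ≅ G)
    {S : Set ℤ} (hS : ∀ i ∈ S, l ≤ i) {B : DerivedCategory C}
    (hB : bigAdd.{w} (shiftsIn G S) B) :
    ∃ B' : HomotopyCategory (InjectiveObject C) (ComplexShape.up ℤ), homotopyGE _ (a + l) B' ∧
      bigAdd.{w} (shiftsIn H S) B' ∧ Nonempty ((kInjToD C).obj B' ≅ B) := by
  obtain ⟨I, n, hn, ι, ⟨hι⟩⟩ := exists_cofan_of_bigAdd_shiftsIn hB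
  choose K hK eK using fun i : I =>
    homotopyGE_mono (m := a + l) (by have := hS _ (hn i); lia) _
      (homotopyGE_shift hH (-n i) (a + n i) (by lia))
  let e₁ (i : I) := (eK i).some
  have hs := coproductIsCoproduct K
  have hq := isColimitCofanMkObjOfIsColimit (HomotopyCategory.quotient _ (ComplexShape.up ℤ)) _ _ hs
  have hQ := isColimitCofanMkObjOfIsColimit Q _ _ (isColimitMapHomologicalComplexInjectiveι hs)
  refine ⟨(HomotopyCategory.quotient _ _).obj (∐ K), ?_, ?_, ⟨?_⟩⟩
  · have : CochainComplex.IsStrictlyGE (∐ K) (a + l) := isStrictlyGE_of_isColimit hK hs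
    exact homotopyGE_quotient _ _
  · exact bigAdd_of_isColimit hq fun i => ⟨n i, hn i, ⟨(e₁ i).symm⟩⟩
  · exact IsColimit.coconePointsIsoOfNatIso hQ hι (Discrete.natIso fun i =>
      (kInjToD C).mapIso (e₁ i.as).symm ≪≫ ((kInjToD C).commShiftIso (-n i.as)).app H ≪≫
        (shiftFunctor _ (-n i.as)).mapIso e)

lemma exists_lift_of_bigCoprod_shiftsIn
    {H : HomotopyCategory (InjectiveObject C) (ComplexShape.up ℤ)}
    {a l : ℤ} (hH : homotopyGE _ a H) {G : DerivedCategory C} (e : (kInjToD C).obj H ≅ G)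
    {S : Set ℤ} (hS : ∀ i ∈ S, l ≤ i) (n : ℕ) {B : DerivedCategory C}
    (hB : bigCoprod.{w} (shiftsIn G S) n B) :
    ∃ B' : HomotopyCategory (InjectiveObject C) (ComplexShape.up ℤ), homotopyGE _ (a + l) B' ∧
      bigCoprod.{w} (shiftsIn H S) n B' ∧ Nonempty ((kInjToD C).obj B' ≅ B) := by
  induction n generalizing B with
  | zero =>
    exact ⟨0, ObjectProperty.prop_zero _, isZero_zero _,
      ⟨((kInjToD C).map_isZero (isZero_zero _)).iso hB⟩⟩
  | succ n ih =>
    rw [bigCoprod_succ] at hB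
    obtain ⟨X, Z, f, g, h, hT, hX, hZ⟩ := hB
    obtain ⟨X', hX₁, hX₂, ⟨eX⟩⟩ := exists_lift_of_bigAdd_shiftsIn hH e hS hX
    obtain ⟨Z', hZ₁, hZ₂, ⟨eZ⟩⟩ := ih hZ
    let eX₁ : (kInjToD C).obj (X'⟦(1 : ℤ)⟧) ≅ X⟦(1 : ℤ)⟧ :=
      ((kInjToD C).commShiftIso (1 : ℤ)).app X' ≪≫ (shiftFunctor _ (1 : ℤ)).mapIso eX
    obtain ⟨h', hh'⟩ := (kInjToD_map_bijective Z'
      (homotopyGE_shift hX₁ 1 (a + l - 1) (by lia))).surjective (eZ.hom ≫ h ≫ eX₁.inv)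
    obtain ⟨B', f', g', hT'⟩ := distinguished_cocone_triangle₂ h'
    refine ⟨B', ObjectProperty.ext_of_isTriangulatedClosed₂ _ _ hT' hX₁ hZ₁, ?_, ⟨?_⟩⟩
    · rw [bigCoprod_succ]
      exact ⟨X', Z', f', g', h', hT', hX₂, hZ₂⟩
    · have hcomm : ((kInjToD C).map h' ≫ ((kInjToD C).commShiftIso (1 : ℤ)).hom.app X') ≫
          (shiftFunctor _ (1 : ℤ)).map eX.hom = eZ.hom ≫ h := by
        rw [hh', Category.assoc]
        change (eZ.hom ≫ h ≫ eX₁.inv) ≫ eX₁.hom = _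
        simp
      exact Triangle.π₂.mapIso (isoTriangleOfIso₁₃ _ _ ((kInjToD C).map_distinguished _ hT') hT
        eX eZ hcomm)

lemma bigGen_of_bigGen_kInjToD
    {H M : HomotopyCategory (InjectiveObject C) (ComplexShape.up ℤ)}
    {a l m : ℤ} (hH : homotopyGE _ a H) (hM : homotopyGE _ m M) {G : DerivedCategory C}
    (e : (kInjToD C).obj H ≅ G) {S : Set ℤ} (hS : ∀ i ∈ S, l ≤ i) {n : ℕ}
    (h : bigGen.{w} G S n ((kInjToD C).obj M)) : bigGen.{w} H S n M := by
  obtain ⟨B, hB, ⟨r⟩⟩ := h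
  obtain ⟨B', hB₁, hB₂, ⟨eB⟩⟩ := exists_lift_of_bigCoprod_shiftsIn hH e hS n hB
  obtain ⟨i, hi⟩ := (kInjToD_map_bijective M hB₁).surjective (r.i ≫ eB.inv)
  obtain ⟨p, hp⟩ := (kInjToD_map_bijective B' hM).surjective (eB.hom ≫ r.r)
  refine ⟨B', hB₂, ⟨⟨i, p, (kInjToD_map_bijective M hM).injective ?_⟩⟩⟩
  rw [Functor.map_comp, hi, hp, CategoryTheory.Functor.map_id, Category.assoc,
    eB.inv_hom_id_assoc, r.retract]

end

/-! ### Compact generation of the homotopy category of complexes of injectives -/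

section

variable {C : Type v₁} [Category.{v₂} C] [Preadditive C]

lemma nonempty_homotopy_id_zero [HasKernels C] (K : CochainComplex C ℤ)
    (h : ∀ p q : ℤ, p + 1 = q → ∃ s : kernel (K.d q (q + 1)) ⟶ K.X p,
      s ≫ K.d p q = kernel.ι (K.d q (q + 1))) : Nonempty (Homotopy (𝟙 K) 0) := by
  choose h hh using h
  let a (p : ℤ) : K.X p ⟶ kernel (K.d (p + 1) (p + 1 + 1)) :=
    kernel.lift _ (K.d p (p + 1)) (K.d_comp_d _ _ _)
  have ha (p : ℤ) : a p ≫ kernel.ι _ = K.d p (p + 1) := kernel.lift_ι _ _ _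
  let b (p : ℤ) : K.X p ⟶ kernel (K.d p (p + 1)) :=
    kernel.lift _ (𝟙 _ - a p ≫ h p (p + 1) rfl) (by
      rw [Preadditive.sub_comp, Category.assoc, hh, ha, Category.id_comp, sub_self])
  have hb (p : ℤ) : b p ≫ kernel.ι _ = 𝟙 _ - a p ≫ h p (p + 1) rfl := kernel.lift_ι _ _ _
  have hdb (p : ℤ) : K.d p (p + 1) ≫ b (p + 1) = a p := by
    have hda : K.d p (p + 1) ≫ a (p + 1) = 0 := by
      rw [← cancel_mono (kernel.ι _), Category.assoc, ha, K.d_comp_d, zero_comp]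
    rw [← cancel_mono (kernel.ι _), Category.assoc, hb, ha, Preadditive.comp_sub, ← Category.assoc,
      hda, zero_comp, sub_zero, Category.comp_id]
  let s (p q : ℤ) (hqp : (ComplexShape.up ℤ).Rel q p) : K.X p ⟶ K.X q := b p ≫ h q p hqp
  refine ⟨(Homotopy.ofEq ?_).trans (Homotopy.nullHomotopy' s)⟩
  ext p
  rw [Homotopy.nullHomotopicMap'_f (k₂ := p - 1) (k₀ := p + 1) (sub_add_cancel p 1) rfl]
  simp only [s, Category.assoc, hh, hb, reassoc_of% hdb, HomologicalComplex.id_f]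
  abel

lemma exists_comp_d_eq_of_quotient_map_eq_zero [HasZeroObject C] {K : CochainComplex C ℤ}
    {p q : ℤ} (hpq : p + 1 = q) {Z : C}
    (φ : (HomologicalComplex.single C (ComplexShape.up ℤ) q).obj Z ⟶ K)
    (hφ : (HomotopyCategory.quotient C (ComplexShape.up ℤ)).map φ = 0) :
    ∃ s : Z ⟶ K.X p, s ≫ K.d p q =
      (HomologicalComplex.singleObjXSelf (ComplexShape.up ℤ) q Z).inv ≫ φ.f q := by
  obtain ⟨k⟩ := (HomotopyCategory.quotient_map_eq_zero_iff φ).1 hφ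
  have hk := k.comm q
  rw [dNext_eq k.hom (show (ComplexShape.up ℤ).Rel q (q + 1) from rfl),
    prevD_eq k.hom (show (ComplexShape.up ℤ).Rel p q from hpq), HomologicalComplex.zero_f,
    add_zero, HomologicalComplex.single_obj_d, zero_comp, zero_add] at hk
  exact ⟨(HomologicalComplex.singleObjXSelf _ q Z).inv ≫ k.hom q p, by rw [hk, Category.assoc]⟩

end

section

open DerivedCategory

variable {C : Type v₁} [Category.{v₂} C] [Abelian C]

instance (M : C) (n : ℤ) : CochainComplex.IsStrictlyGE
    ((HomologicalComplex.single C (ComplexShape.up ℤ) n).obj M) n :=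
  inferInstanceAs (CochainComplex.IsStrictlyGE ((CochainComplex.singleFunctor C n).obj M) n)

lemma exists_comp_cofanTrunc_map_eq [HasCoproducts.{w} C]
    [∀ I : Type w, (isInjective C).IsClosedUnderColimitsOfShape (Discrete I)] {M : C}
    (hM : IsFinitelySupported.{w} M) {p : ℤ} {I : Type w}
    {K : I → CochainComplex (InjectiveObject C) ℤ} {s : Cofan K} (hs : IsColimit s)
    (φ : (HomologicalComplex.single C (ComplexShape.up ℤ) p).obj M ⟶
      ((InjectiveObject.ι C).mapHomologicalComplex (ComplexShape.up ℤ)).obj s.pt) :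
    ∃ S : Finset I, φ ≫ ((InjectiveObject.ι C).mapHomologicalComplex (ComplexShape.up ℤ)).map
      (cofanTrunc hs S) = φ := by
  let ev : CochainComplex (InjectiveObject C) ℤ ⥤ C :=
    HomologicalComplex.eval _ _ p ⋙ InjectiveObject.ι C
  have hp : IsColimit (Cofan.mk (ev.obj s.pt) fun i => ev.map (s.inj i)) :=
    isColimitCofanMkObjOfIsColimit (InjectiveObject.ι C) _ _ (isColimitCofanX hs p)
  obtain ⟨S, hS⟩ := hM I _ _ hp ((HomologicalComplex.singleObjXSelf _ p M).inv ≫ φ.f p)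
  refine ⟨S, HomologicalComplex.from_single_hom_ext ?_⟩
  exact (cancel_epi (HomologicalComplex.singleObjXSelf (ComplexShape.up ℤ) p M).inv).1
    ((Category.assoc _ _ _).symm.trans ((_ ≫= map_cofanTrunc hs ev hp S).trans hS))

variable [HasDerivedCategory.{u} C]

lemma exists_isIso_Qh_map_of_iso_singleFunctor
    {X : HomotopyCategory (InjectiveObject C) (ComplexShape.up ℤ)} {n : ℤ}
    (hX : homotopyGE _ n X) {M : C} {p : ℤ}
    (e : (kInjToD C).obj X ≅ (singleFunctor C p).obj M) :
    ∃ j : (HomotopyCategory.quotient C (ComplexShape.up ℤ)).obj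
      ((HomologicalComplex.single C (ComplexShape.up ℤ) p).obj M) ⟶ (kInjToK C).obj X,
      IsIso (Qh.map j) := by
  let e' : Qh.obj ((HomotopyCategory.quotient C (ComplexShape.up ℤ)).obj
      ((HomologicalComplex.single C (ComplexShape.up ℤ) p).obj M)) ≅ Qh.obj ((kInjToK C).obj X) :=
    ((singleFunctorIsoCompQ C p).app M).symm ≪≫ e.symm
  obtain ⟨j, hj⟩ := (Qh_map_bijective_of_homotopyGE _ hX).surjective e'.hom
  exact ⟨j, by rw [hj]; infer_instance⟩

/-- Morphisms from an injective resolution of the cycles of `Y` in degree `n` are the same as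
morphisms from the cycles themselves, so their vanishing splits the inclusion of cycles. -/
lemma isZero_of_forall_hom_eq_zero [EnoughInjectives C]
    (Y : HomotopyCategory (InjectiveObject C) (ComplexShape.up ℤ))
    (hY : ∀ (n : ℤ) (X : HomotopyCategory (InjectiveObject C) (ComplexShape.up ℤ)),
      homotopyGE _ n X → ((kInjToD C).obj X).IsLE n → ∀ f : X ⟶ Y, f = 0) : IsZero Y := by
  obtain ⟨K, rfl⟩ := HomotopyCategory.quotient_obj_surjective Y
  let K' : CochainComplex C ℤ :=
    ((InjectiveObject.ι C).mapHomologicalComplex (ComplexShape.up ℤ)).obj K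
  have ⟨H⟩ : Nonempty (Homotopy (𝟙 K') 0) := nonempty_homotopy_id_zero K' fun p q hpq => by
    let φ := HomologicalComplex.mkHomFromSingle (c := ComplexShape.up ℤ)
      (kernel.ι (K'.d q (q + 1))) (by rintro _ rfl; exact kernel.condition _)
    obtain ⟨X, hX, ⟨e⟩⟩ :=
      exists_kInjToD_iso ((singleFunctor C q).obj (kernel (K'.d q (q + 1)))) q
    obtain ⟨j, hj⟩ := exists_isIso_Qh_map_of_iso_singleFunctor hX e
    obtain ⟨f, hf⟩ := (comp_kInjToK_map_bijective (homotopyGE_quotient _ q) hX j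
      ((HomotopyCategory.quotient _ _).obj K)).surjective ((HomotopyCategory.quotient _ _).map φ)
    obtain rfl : f = 0 := hY q X hX (TStructure.t.isLE_of_iso e.symm q) f
    obtain ⟨s, hs⟩ := exists_comp_d_eq_of_quotient_map_eq_zero hpq φ (by
      refine hf.symm.trans ?_
      dsimp only
      rw [Functor.map_zero]
      exact comp_zero)
    exact ⟨s, by rw [hs, HomologicalComplex.mkHomFromSingle_f, Iso.inv_hom_id_assoc]⟩
  have isZero_kInjToK :
      IsZero ((kInjToK C).obj ((HomotopyCategory.quotient _ _).obj K)) := by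
    rw [IsZero.iff_id_eq_zero]
    have := HomotopyCategory.eq_of_homotopy _ _ H
    rwa [CategoryTheory.Functor.map_id, Functor.map_zero] at this
  rw [IsZero.iff_id_eq_zero]
  exact (kInjToK C).map_injective (isZero_kInjToK.eq_of_src _ _)

variable [HasCoproducts.{w} C]
  [∀ I : Type w, (isInjective C).IsClosedUnderColimitsOfShape (Discrete I)]

lemma isFinitelySupported_of_iso_singleFunctor {M : C} (hM : IsFinitelySupported.{w} M)
    {X : HomotopyCategory (InjectiveObject C) (ComplexShape.up ℤ)} {n p : ℤ}
    (hX : homotopyGE _ n X) (e : (kInjToD C).obj X ≅ (singleFunctor C p).obj M) :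
    IsFinitelySupported.{w} X := by
  obtain ⟨j, hj⟩ := exists_isIso_Qh_map_of_iso_singleFunctor hX e
  refine .of_exists_isColimit fun I Y => ?_
  choose K hK using fun i => HomotopyCategory.quotient_obj_surjective (Y i)
  obtain rfl : (fun i => (HomotopyCategory.quotient _ _).obj (K i)) = Y := funext hK
  have hs := coproductIsCoproduct K
  have hc := isColimitCofanMkObjOfIsColimit (HomotopyCategory.quotient _ (ComplexShape.up ℤ)) _ _ hs
  refine ⟨_, hc, fun f => ?_⟩
  let F := (InjectiveObject.ι C).mapHomologicalComplex (ComplexShape.up ℤ)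
  let q := HomotopyCategory.quotient C (ComplexShape.up ℤ)
  obtain ⟨φ, hφ⟩ := q.map_surjective (Y := F.obj (∐ K)) (j ≫ (kInjToK C).map f)
  obtain ⟨S, hS⟩ := exists_comp_cofanTrunc_map_eq hM hs φ
  refine ⟨S, (comp_kInjToK_map_bijective (homotopyGE_quotient _ p) hX j _).injective ?_⟩
  have comp_trunc : j ≫ (kInjToK C).map (f ≫ cofanTrunc hc S) =
      (j ≫ (kInjToK C).map f) ≫ (kInjToK C).map (cofanTrunc hc S) :=
    (j ≫= (kInjToK C).map_comp _ _).trans (Category.assoc _ _ _).symm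
  have lift_trunc : (j ≫ (kInjToK C).map f) ≫ (kInjToK C).map (cofanTrunc hc S) =
      q.map φ ≫ q.map (F.map (cofanTrunc hs S)) :=
    congrArg₂ (· ≫ ·) hφ.symm (congrArg (kInjToK C).map (map_cofanTrunc hs _ hc S).symm)
  exact comp_trunc.trans <| lift_trunc.trans <|
    (q.map_comp _ _).symm.trans <| (q.congr_map hS).trans hφ

lemma isFinitelySupported_of_isGE_of_isLE_self (X : DerivedCategory C) (a : ℤ) [X.IsGE a]
    [X.IsLE a] (hX : IsFinitelySupported.{w} ((homologyFunctor C a).obj X))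
    {L : HomotopyCategory (InjectiveObject C) (ComplexShape.up ℤ)} {n : ℤ}
    (hL : homotopyGE _ n L) (e : (kInjToD C).obj L ≅ X) : IsFinitelySupported.{w} L := by
  obtain ⟨M, ⟨e'⟩⟩ := exists_iso_singleFunctor_obj_of_isGE_of_isLE X a
  refine isFinitelySupported_of_iso_singleFunctor (hX.of_iso ?_) hL (e ≪≫ e')
  exact (homologyFunctor C a).mapIso (e' ≪≫ (singleFunctorIsoCompQ C a).app M) ≪≫
    (homologyFunctorFactors C a).app _ ≪≫
      (HomologicalComplex.homologyFunctorSingleIso C (ComplexShape.up ℤ) a).app M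

end

section

open DerivedCategory

variable {C : Type v₁} [Category.{v₂} C] [Abelian C] [HasDerivedCategory.{u} C]
  {T : Triangle (DerivedCategory C)}

lemma isIso_homologyFunctor_map_mor₁ (hT : T ∈ distTriang _) {m i : ℤ} (h₃ : T.obj₃.IsGE m)
    (h : i < m) : IsIso ((homologyFunctor C i).map T.mor₁) := by
  have : Mono ((homologyFunctor C i).map T.mor₁) :=
    (HomologySequence.mono_homologyMap_mor₁_iff _ hT (i - 1) i (by simp)).2
      ((isZero_of_isGE T.obj₃ m (i - 1) (by lia)).eq_of_src _ _)
  have : Epi ((homologyFunctor C i).map T.mor₁) :=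
    (HomologySequence.epi_homologyMap_mor₁_iff _ hT i).2
      ((isZero_of_isGE T.obj₃ m i h).eq_of_tgt _ _)
  exact isIso_of_mono_of_epi _

lemma isIso_homologyFunctor_map_mor₂ (hT : T ∈ distTriang _) {m i : ℤ} (h₁ : T.obj₁.IsLE m)
    (h : m < i) : IsIso ((homologyFunctor C i).map T.mor₂) := by
  have : Mono ((homologyFunctor C i).map T.mor₂) :=
    (HomologySequence.mono_homologyMap_mor₂_iff _ hT i).2
      ((isZero_of_isLE T.obj₁ m i h).eq_of_src _ _)
  have : Epi ((homologyFunctor C i).map T.mor₂) :=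
    (HomologySequence.epi_homologyMap_mor₂_iff _ hT i (i + 1) rfl).2
      ((isZero_of_isLE T.obj₁ m (i + 1) (by lia)).eq_of_tgt _ _)
  exact isIso_of_mono_of_epi _

lemma exists_distTriang_of_isGE (X : DerivedCategory C) (a : ℤ) [X.IsGE a] :
    ∃ (A B : DerivedCategory C) (f : A ⟶ X) (g : X ⟶ B) (h : B ⟶ A⟦(1 : ℤ)⟧),
      Triangle.mk f g h ∈ distTriang _ ∧ A.IsGE a ∧ A.IsLE a ∧ B.IsGE (a + 1) := by
  obtain ⟨A, B, hA, hB, f, g, h, hT⟩ := TStructure.t.exists_triangle X a (a + 1) rfl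
  have hA' : A.IsLE a := ⟨hA⟩
  have hB' : B.IsGE (a + 1) := ⟨hB⟩
  have hB₁ : TStructure.t.IsGE (B⟦(-1 : ℤ)⟧) a :=
    have := TStructure.t.isGE_shift B (a + 1) (-1) (a + 2)
    TStructure.t.isGE_of_ge _ a (a + 2)
  exact ⟨A, B, f, g, h, hT,
    TStructure.t.isGE₂ _ (inv_rot_of_distTriang _ hT) a hB₁ (by assumption), hA', hB'⟩

variable [HasCoproducts.{w} C]
  [∀ I : Type w, (isInjective C).IsClosedUnderColimitsOfShape (Discrete I)]

lemma isFinitelySupported_of_isGE_of_isLE [EnoughInjectives C] (k : ℕ)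
    (X : DerivedCategory C) (a : ℤ) [X.IsGE a] (hb : X.IsLE (a + k))
    (hX : ∀ n : ℤ, IsFinitelySupported.{w} ((homologyFunctor C n).obj X))
    {L : HomotopyCategory (InjectiveObject C) (ComplexShape.up ℤ)} {n : ℤ}
    (hL : homotopyGE _ n L) (e : (kInjToD C).obj L ≅ X) : IsFinitelySupported.{w} L := by
  induction k generalizing X a L n with
  | zero =>
    have : X.IsLE a := by simpa only [Nat.cast_zero, add_zero] using hb
    exact isFinitelySupported_of_isGE_of_isLE_self X a (hX a) hL e
  | succ k ih =>
    obtain ⟨A, B, f, g, h, hT, hA, hA', hB⟩ := exists_distTriang_of_isGE X a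
    have hA₁ : TStructure.t.IsLE (A⟦(1 : ℤ)⟧) (a + 1 + k) :=
      have := TStructure.t.isLE_shift A a 1 (a - 1)
      TStructure.t.isLE_of_le _ (a - 1) _ (by lia)
    have hX₁ : X.IsLE (a + 1 + k) := by convert hb using 1; push_cast; ring
    have hB' : B.IsLE (a + 1 + k) := TStructure.t.isLE₂ _ (rot_of_distTriang _ hT) _ hX₁ hA₁
    have hfA : IsFinitelySupported.{w} ((homologyFunctor C a).obj A) :=
      have : IsIso ((homologyFunctor C a).map f) :=
        isIso_homologyFunctor_map_mor₁ hT hB (lt_add_one a)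
      (hX a).of_iso (asIso ((homologyFunctor C a).map f)).symm
    have hfB (i : ℤ) : IsFinitelySupported.{w} ((homologyFunctor C i).obj B) := by
      by_cases hi : a < i
      · have : IsIso ((homologyFunctor C i).map g) := isIso_homologyFunctor_map_mor₂ hT hA' hi
        exact (hX i).of_iso (asIso ((homologyFunctor C i).map g))
      · exact .of_isZero (isZero_of_isGE B (a + 1) i (by lia))
    obtain ⟨A', B', f', g', h', hT', hA₂, hB₂, ⟨eA⟩, ⟨eB⟩⟩ :=
      exists_distTriang_kInjToD hL e hT a (a + 1)
    exact IsFinitelySupported.of_distTriang _ hT'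
      (isFinitelySupported_of_isGE_of_isLE_self A a hfA hA₂ eA) (ih B (a + 1) hB' hfB hB₂ eB)

end

section

open DerivedCategory

variable {C : Type v₁} [Category.{v₂} C] [Abelian C] [HasDerivedCategory.{u} C]

lemma hom_eq_zero_of_isLE_of_homotopyGE
    {K L : HomotopyCategory (InjectiveObject C) (ComplexShape.up ℤ)} {m n : ℤ}
    (hK : ((kInjToD C).obj K).IsLE m) (hL : homotopyGE _ n L) (hmn : m < n) (f : K ⟶ L) :
    f = 0 := by
  apply (kInjToD_map_bijective K hL).injective
  have := isGE_kInjToD_obj hL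
  rw [Functor.map_zero]
  exact TStructure.t.zero _ m n hmn

lemma isLE_kInjToD_obj_shift {K : HomotopyCategory (InjectiveObject C) (ComplexShape.up ℤ)}
    {n : ℤ} [((kInjToD C).obj K).IsLE n] (a n' : ℤ) (h : a + n' = n) :
    ((kInjToD C).obj (K⟦a⟧)).IsLE n' :=
  have : TStructure.t.IsLE (((kInjToD C).obj K)⟦a⟧) n' :=
    TStructure.t.isLE_shift ((kInjToD C).obj K) n a n' h
  TStructure.t.isLE_of_iso (show ((kInjToD C).obj K)⟦a⟧ ≅ (kInjToD C).obj (K⟦a⟧) from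
    (((kInjToD C).commShiftIso a).app K).symm) n'

section

variable [HasCoproducts.{w} C] [∀ I : Type w, HasExactColimitsOfShape (Discrete I) C]
  [∀ I : Type w, (isInjective C).IsClosedUnderColimitsOfShape (Discrete I)]

lemma exists_Icc_bigGen_of_homotopyGE_of_isLE {N : ℕ}
    {H : HomotopyCategory (InjectiveObject C) (ComplexShape.up ℤ)} {a b : ℤ}
    (ha : homotopyGE _ a H) {G : DerivedCategory C} (e : (kInjToD C).obj H ≅ G) (hb : G.IsLE b)
    (hgen : bigGen.{w} G Set.univ N = ⊤) (m m' : ℤ) :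
    ∃ l k : ℤ, ∀ M : HomotopyCategory (InjectiveObject C) (ComplexShape.up ℤ),
      homotopyGE _ m M → ((kInjToD C).obj M).IsLE m' → bigGen.{w} H (Set.Icc l k) N M := by
  have : HasCoproducts.{w} (DerivedCategory C) := fun _ => inferInstance
  have isGE_G : G.IsGE a :=
    have := isGE_kInjToD_obj ha
    TStructure.t.isGE_of_iso e a
  obtain ⟨l, k, hlk⟩ := exists_Icc_bigGen.{w} isGE_G hb N m m'
  exact ⟨l, k, fun M hM hM' => bigGen_of_bigGen_kInjToD ha hM e (fun i hi => hi.1)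
    (hlk _ (isGE_kInjToD_obj hM) hM' (by rw [hgen]; trivial))⟩

end

variable [EnoughInjectives C]

lemma exists_distTriang_of_homotopyGE
    (F : HomotopyCategory (InjectiveObject C) (ComplexShape.up ℤ)) (n : ℤ)
    (hF : homotopyGE _ n F) :
    ∃ (E D : HomotopyCategory (InjectiveObject C) (ComplexShape.up ℤ)) (f : E ⟶ F) (g : F ⟶ D)
      (h : D ⟶ E⟦(1 : ℤ)⟧), Triangle.mk f g h ∈ distTriang _ ∧
        homotopyGE _ (n + 1) D ∧ homotopyGE _ n E ∧ ((kInjToD C).obj E).IsLE n := by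
  have := isGE_kInjToD_obj hF
  obtain ⟨A, B, f, g, h, hT, hA, hA', hB⟩ := exists_distTriang_of_isGE ((kInjToD C).obj F) n
  obtain ⟨E, D, f', g', h', hT', hE, hD, ⟨e⟩, -⟩ :=
    exists_distTriang_kInjToD hF (Iso.refl _) hT n (n + 1)
  exact ⟨E, D, f', g', h', hT', hD, hE, TStructure.t.isLE_of_iso e.symm n⟩

variable [HasCoproducts.{w} C] [∀ I : Type w, HasExactColimitsOfShape (Discrete I) C]
  [∀ I : Type w, (isInjective C).IsClosedUnderColimitsOfShape (Discrete I)]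

lemma isCompactGenerator_of_bigGen_eq_top {N : ℕ}
    {H : HomotopyCategory (InjectiveObject C) (ComplexShape.up ℤ)} {a b : ℤ}
    (ha : homotopyGE _ a H) {G : DerivedCategory C} (e : (kInjToD C).obj H ≅ G) (hb : G.IsLE b)
    (hG : ∀ n : ℤ, IsFinitelySupported.{w} ((homologyFunctor C n).obj G))
    (hgen : bigGen.{w} G Set.univ N = ⊤) :
    IsCompactGenerator.{w} H := by
  constructor
  · have := isGE_kInjToD_obj ha
    have : G.IsGE a := TStructure.t.isGE_of_iso e a
    refine (isFinitelySupported_of_isGE_of_isLE (b - a).natAbs G a ?_ hG ha e).isCompactObj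
    exact TStructure.t.isLE_of_le _ b _ (by lia)
  · refine fun Y hY => isZero_of_forall_hom_eq_zero Y fun n X hX hX' f => ?_
    obtain ⟨l, k, hlk⟩ := exists_Icc_bigGen_of_homotopyGE_of_isLE ha e hb hgen n n
    exact hom_eq_zero_of_bigGen hY (hlk X hX hX') f

theorem isCoapproximableVia_of_bigGen_eq_top {N : ℕ}
    {H : HomotopyCategory (InjectiveObject C) (ComplexShape.up ℤ)} {a b : ℤ}
    (ha : homotopyGE _ a H) {G : DerivedCategory C} (e : (kInjToD C).obj H ≅ G) (hb : G.IsLE b)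
    (hG : ∀ n : ℤ, IsFinitelySupported.{w} ((homologyFunctor C n).obj G))
    (hgen : bigGen.{w} G Set.univ N = ⊤) :
    IsCoapproximableVia.{w} (homotopyGE (InjectiveObject C) 0)
      (homotopyLE (InjectiveObject C) 0) := by
  have isLE_H : ((kInjToD C).obj H).IsLE b := TStructure.t.isLE_of_iso e.symm b
  obtain ⟨l, k, hlk⟩ := exists_Icc_bigGen_of_homotopyGE_of_isLE ha e hb hgen 0 0
  let A : ℕ := N + a.natAbs + b.natAbs + l.natAbs + k.natAbs + 1
  refine ⟨fun _ => inferInstance, isCoTStructure_homotopyCategory, H, A,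
    isCompactGenerator_of_bigGen_eq_top ha e hb hG hgen, by lia, ?_, ?_, ?_⟩
  · exact homotopyGE_mono (by lia) _ (homotopyGE_shift ha (-(A : ℤ)) (a + A) (by lia))
  · exact fun F f hF => hom_eq_zero_of_isLE_of_homotopyGE
      (isLE_kInjToD_obj_shift (n := b) A (b - A) (by lia)) hF (by lia) f
  · intro F hF
    obtain ⟨E, D, f, g, h, hT, hD, hE, hE'⟩ := exists_distTriang_of_homotopyGE F 0 hF
    exact ⟨E, D, f, g, h, hT, homotopyGE_shift hD 1 0 (by simp),
      bigGen_mono H (Set.Icc_subset_Icc (by lia) (by lia)) (by lia) _ (hlk E hE hE')⟩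

end

/-! ### Exactness and injectivity of coproducts -/

section

variable {C : Type v₁} [Category.{v₂} C] {I : Type*}

/-- A colimit of a functor from a discrete category, as a coproduct. -/
noncomputable def isColimitCofanMkApp {F : Discrete I ⥤ C} {t : Cocone F} (ht : IsColimit t) :
    IsColimit (Cofan.mk t.pt fun i => t.ι.app ⟨i⟩ : Cofan fun i => F.obj ⟨i⟩) :=
  Cofan.IsColimit.mk _ (fun s => ht.desc ⟨s.pt, Discrete.natTrans fun i => s.inj i.as⟩)
    (fun _ _ => ht.fac _ _) fun s _ hm => ht.hom_ext fun j =>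
      (hm j.as).trans (ht.fac ⟨s.pt, Discrete.natTrans fun i => s.inj i.as⟩ j).symm

variable [Preadditive C]

lemma comp_cofanProj {Y Z : I → C} {c : Cofan Y} (hc : IsColimit c) {d : Cofan Z}
    (hd : IsColimit d) {f : c.pt ⟶ d.pt} {g : ∀ i, Y i ⟶ Z i}
    (hf : ∀ i, c.inj i ≫ f = g i ≫ d.inj i) (k : I) :
    f ≫ cofanProj hd k = cofanProj hc k ≫ g k := by
  refine Cofan.IsColimit.hom_ext hc _ _ fun i => ?_
  rw [reassoc_of% hf i]
  by_cases hik : i = k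
  · subst hik
    rw [inj_cofanProj, reassoc_of% (inj_cofanProj hc i), Category.comp_id]
  · rw [inj_cofanProj_of_ne hd hik, reassoc_of% (inj_cofanProj_of_ne hc hik), comp_zero,
      zero_comp]

lemma comp_cofanTrunc_eq_zero {Y : I → C} {c : Cofan Y} (hc : IsColimit c) {P : C} {f : P ⟶ c.pt}
    (hf : ∀ k, f ≫ cofanProj hc k = 0) (S : Finset I) : f ≫ cofanTrunc hc S = 0 := by
  rw [cofanTrunc, Preadditive.comp_sum]
  exact Finset.sum_eq_zero fun k _ => by rw [reassoc_of% hf k, zero_comp]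

lemma map_cofanTrunc_comp_eq_zero {D : Type*} [Category D] [Preadditive D] (F : C ⥤ D)
    [F.Additive] {Y : I → C} {c : Cofan Y} (hc : IsColimit c) {Q : D} {g : F.obj c.pt ⟶ Q}
    (hg : ∀ k, F.map (c.inj k) ≫ g = 0) (S : Finset I) : F.map (cofanTrunc hc S) ≫ g = 0 := by
  rw [cofanTrunc, Functor.map_sum, Preadditive.sum_comp]
  exact Finset.sum_eq_zero fun k _ => by rw [F.map_comp, Category.assoc, hg, comp_zero]

lemma mono_of_forall_inj_comp_eq_map {D : Type*} [Category D] [Preadditive D] (F : C ⥤ D)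
    [F.Additive] {Y : I → C} {c : Cofan Y} (hc : IsColimit c) {d : Cofan fun i => F.obj (Y i)}
    (hd : IsColimit d) {φ : d.pt ⟶ F.obj c.pt} (hφ : ∀ i, d.inj i ≫ φ = F.map (c.inj i))
    (hmono : ∀ {P : D} (f : P ⟶ d.pt), (∀ k, f ≫ cofanProj hd k = 0) → f = 0) : Mono φ := by
  have comp_map_cofanProj (k : I) : φ ≫ F.map (cofanProj hc k) = cofanProj hd k := by
    refine Cofan.IsColimit.hom_ext hd _ _ fun i => ?_
    rw [reassoc_of% hφ i, ← F.map_comp]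
    by_cases hik : i = k
    · subst hik
      rw [inj_cofanProj, inj_cofanProj, F.map_id]
    · rw [inj_cofanProj_of_ne hc hik, inj_cofanProj_of_ne hd hik, F.map_zero]
  rw [Preadditive.mono_iff_cancel_zero]
  exact fun P g hg => hmono g fun k => by
    rw [← comp_map_cofanProj, reassoc_of% hg, zero_comp]

end

lemma hasExactColimitsOfShape_discrete_of_jointly_mono {C : Type v₁} [Category.{v₂} C] [Abelian C]
    {I : Type*} [HasColimitsOfShape (Discrete I) C]
    (hmono : ∀ {Y : I → C} {c : Cofan Y} (hc : IsColimit c) {P : C} (f : P ⟶ c.pt),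
      (∀ k, f ≫ cofanProj hc k = 0) → f = 0) : HasExactColimitsOfShape (Discrete I) C := by
  have : Functor.PreservesMonomorphisms (colim (J := Discrete I) (C := C)) := by
    refine ⟨fun {F G} f hf => (Preadditive.mono_iff_cancel_zero _).2 fun P g hg => ?_⟩
    have hcF := isColimitCofanMkApp (colimit.isColimit F)
    refine hmono hcF g fun k => ?_
    rw [← cancel_mono (f.app ⟨k⟩), Category.assoc,
      ← comp_cofanProj hcF (isColimitCofanMkApp (colimit.isColimit G)) (f := colim.map f)
        (fun i => ι_colimMap f ⟨i⟩), reassoc_of% hg, zero_comp, zero_comp]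
  exact hasExactColimitsOfShape_of_preservesMono _ _

section

variable {C : Type v₁} [Category.{v₂} C] {I : Type*}

lemma injective_sigma_of_retract [HasColimitsOfShape (Discrete I) C] {J E : I → C}
    (r : ∀ k, Retract (J k) (E k)) [Injective (∐ E)] : Injective (∐ J) :=
  Retract.injective (Y := ∐ E)
    { i := Limits.Sigma.map fun k => (r k).i
      r := Limits.Sigma.map fun k => (r k).r }

variable [Preadditive C] [HasFiniteBiproducts C] {ι : Type*} [Finite ι]

lemma injective_sigma_biproduct [HasColimitsOfShape (Discrete I) C] {E : ι → I → C}
    (hE : ∀ i, Injective (∐ E i)) : Injective (∐ fun k => ⨁ fun i => E i k) := by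
  refine Retract.injective (Y := ⨁ fun i => ∐ E i)
    { i := Sigma.desc fun k => biproduct.map fun i => Sigma.ι (E i) k
      r := biproduct.desc fun i => Limits.Sigma.map fun k => biproduct.ι (fun i => E i k) i
      retract := Sigma.hom_ext _ _ fun k => biproduct.hom_ext' _ _ fun i => ?_ }
  simp

end

section

variable {C : Type v₁} [Category.{v₂} C]

/-- The morphism `M ⟶ G(J)` adjoint to an embedding of `F(M)` into an injective object `J`. -/
noncomputable def toRightAdjointUnder {D : Type*} [Category D] [EnoughInjectives D] {F : C ⥤ D}
    {G : D ⥤ C} (adj : F ⊣ G) (M : C) : M ⟶ G.obj (Injective.under (F.obj M)) :=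
  adj.homEquiv _ _ (Injective.ι _)

lemma map_eq_map_of_comp_toRightAdjointUnder_eq {D : Type*} [Category D] [EnoughInjectives D]
    {F : C ⥤ D} {G : D ⥤ C} (adj : F ⊣ G) {P M : C} {f g : P ⟶ M}
    (h : f ≫ toRightAdjointUnder adj M = g ≫ toRightAdjointUnder adj M) : F.map f = F.map g := by
  rw [← cancel_mono (Injective.ι (F.obj M))]
  apply (adj.homEquiv _ _).injective
  rwa [adj.homEquiv_naturality_left, adj.homEquiv_naturality_left]

variable [Preadditive C] [HasFiniteBiproducts C] {ι : Type*} [Finite ι] {D : ι → Type*}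
  [∀ i, Category (D i)] [∀ i, EnoughInjectives (D i)] {F : ∀ i, C ⥤ D i} {G : ∀ i, D i ⥤ C}
  (adj : ∀ i, F i ⊣ G i)
  (faithful : ∀ {M N : C} (f g : M ⟶ N), (∀ i, (F i).map f = (F i).map g) → f = g)

include faithful

lemma mono_lift_toRightAdjointUnder (M : C) :
    Mono (biproduct.lift fun i => toRightAdjointUnder (adj i) M) where
  right_cancellation f g h := faithful f g fun i => by
    refine map_eq_map_of_comp_toRightAdjointUnder_eq (adj i) ?_
    simpa only [Category.assoc, biproduct.lift_π] using
      h =≫ biproduct.π (fun i => (G i).obj (Injective.under ((F i).obj M))) i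

variable [∀ i, (F i).PreservesMonomorphisms]

include adj

lemma enoughInjectives_of_adjunctions : EnoughInjectives C where
  presentation M := by
    have mono := mono_lift_toRightAdjointUnder adj faithful M
    have (i : ι) : Injective ((G i).obj (Injective.under ((F i).obj M))) :=
      (adj i).map_injective _ inferInstance
    exact ⟨⟨_, inferInstance, _, mono⟩⟩

lemma isClosedUnderColimitsOfShape_isInjective_of_adjunctions {I : Type*}
    [HasColimitsOfShape (Discrete I) C] [∀ i, HasColimitsOfShape (Discrete I) (D i)]
    [∀ i, (isInjective (D i)).IsClosedUnderColimitsOfShape (Discrete I)]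
    [∀ i, PreservesColimitsOfShape (Discrete I) (G i)] :
    (isInjective C).IsClosedUnderColimitsOfShape (Discrete I) where
  colimitsOfShape_le := by
    rintro M ⟨p⟩
    let J (k : I) : C := p.diag.obj ⟨k⟩
    have hJ (k : I) : Injective (J k) := p.prop_diag_obj ⟨k⟩
    let A (i : ι) (k : I) : D i := Injective.under ((F i).obj (J k))
    have injective_sigma (i : ι) : Injective (∐ fun k => (G i).obj (A i k)) := by
      have : Injective (∐ A i) := (isInjective (D i)).prop_of_isColimit
        (coproductIsCoproduct (A i)) fun k => inferInstanceAs (Injective (Injective.under _))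
      have := (adj i).map_injective _ this
      exact Injective.of_iso (PreservesCoproduct.iso (G i) (A i)) this
    have (k : I) := mono_lift_toRightAdjointUnder adj faithful (J k)
    have r (k : I) : Retract (J k) (⨁ fun i => (G i).obj (A i k)) :=
      { i := biproduct.lift fun i => toRightAdjointUnder (adj i) (J k)
        r := Injective.factorThru (𝟙 _) (biproduct.lift fun i => toRightAdjointUnder (adj i) (J k))
        retract := Injective.comp_factorThru _ _ }
    have := injective_sigma_biproduct injective_sigma
    have := injective_sigma_of_retract r
    exact Injective.of_iso ((coproductIsCoproduct J).coconePointUniqueUpToIso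
      (isColimitCofanMkApp p.isColimit)) this

end

section

variable {R : Type u} [Ring R] {I : Type*} {Y : I → ModuleCat.{v₁} R} {c : Cofan Y}
  (hc : IsColimit c)

lemma cofanTrunc_apply_eq_of_subset {S S' : Finset I} (h : S ⊆ S') {x : c.pt}
    (hx : cofanTrunc hc S x = x) : cofanTrunc hc S' x = x := by
  rw [← hx, ← ModuleCat.comp_apply, cofanTrunc_comp_of_subset hc h]

lemma exists_cofanTrunc_apply_eq (x : c.pt) : ∃ S : Finset I, cofanTrunc hc S x = x := by
  classical
  let P : Submodule R c.pt :=
    { carrier := {x | ∃ S : Finset I, cofanTrunc hc S x = x}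
      zero_mem' := ⟨∅, map_zero _⟩
      add_mem' := by
        rintro x y ⟨S, hS⟩ ⟨S', hS'⟩
        exact ⟨S ∪ S', by
          rw [map_add, cofanTrunc_apply_eq_of_subset hc Finset.subset_union_left hS,
            cofanTrunc_apply_eq_of_subset hc Finset.subset_union_right hS']⟩
      smul_mem' := by
        rintro r x ⟨S, hS⟩
        exact ⟨S, by rw [map_smul, hS]⟩ }
  have mkQ_eq_zero : ModuleCat.ofHom P.mkQ = 0 := by
    refine Cofan.IsColimit.hom_ext hc _ _ fun i => ?_
    ext y
    refine (Submodule.Quotient.mk_eq_zero P).2 ⟨{i}, ?_⟩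
    exact congr($(inj_cofanTrunc_of_mem hc (Finset.mem_singleton_self i)) y)
  exact (Submodule.Quotient.mk_eq_zero P).1 congr($mkQ_eq_zero x)

lemma exists_cofanTrunc_comp_eq {M : Type*} [AddCommGroup M] [Module R M] [Module.Finite R M]
    (f : M →ₗ[R] c.pt) : ∃ S : Finset I, (cofanTrunc hc S).hom ∘ₗ f = f := by
  classical
  obtain ⟨T, hT⟩ := Module.Finite.fg_top (R := R) (M := M)
  choose S hS using fun x : M => exists_cofanTrunc_apply_eq hc (f x)
  exact ⟨T.biUnion S, LinearMap.ext_on hT fun x hx =>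
    cofanTrunc_apply_eq_of_subset hc (Finset.subset_biUnion_of_mem S hx) (hS x)⟩

include hc in
lemma baer_of_isColimit [IsNoetherianRing R] (hY : ∀ i, Module.Baer R (Y i)) :
    Module.Baer R c.pt := by
  intro J g
  obtain ⟨S, hS⟩ := exists_cofanTrunc_comp_eq hc g
  choose e he using fun i => hY i J ((cofanProj hc i).hom ∘ₗ g)
  refine ⟨∑ i ∈ S, (c.inj i).hom ∘ₗ e i, fun x hx => ?_⟩
  rw [LinearMap.sum_apply, ← hS, cofanTrunc]
  simp only [LinearMap.sum_apply, LinearMap.comp_apply, ModuleCat.hom_sum, ModuleCat.hom_comp]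
  exact Finset.sum_congr rfl fun i _ => congrArg _ (he i x hx)

end

instance {R : Type u} [Ring R] [IsNoetherianRing R] [Small.{v₁} R] (I : Type*) :
    (isInjective (ModuleCat.{v₁} R)).IsClosedUnderColimitsOfShape (Discrete I) where
  colimitsOfShape_le := by
    rintro M ⟨p⟩
    have baer : Module.Baer R M :=
      baer_of_isColimit (isColimitCofanMkApp p.isColimit) fun i => Module.Baer.of_injective
        (Module.injective_module_of_injective_object (inj := p.prop_diag_obj ⟨i⟩))
    have := baer.injective
    exact Module.injective_object_of_injective_module R M

/-! ### Coproducts of quasi-coherent sheaves -/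

section

open Scheme

/-- The equivalence between modules over a ring and quasi-coherent sheaves on its spectrum. -/
noncomputable def specEquiv (R : CommRingCat.{u}) : ModuleCat.{u} R ≌ (Spec R).QCoh :=
  tildeEquiv

lemma isQCoh_of_isColimit_Spec {R : CommRingCat.{u}} {J : Type u} [SmallCategory J]
    {F : J ⥤ (Spec R).Modules} {c : Cocone F} (hc : IsColimit c)
    (hF : ∀ j, (Spec R).isQCoh (F.obj j)) : (Spec R).isQCoh c.pt := by
  let G : J ⥤ (Spec R).QCoh := (Spec R).isQCoh.lift F hF
  let A : J ⥤ ModuleCat.{u} R := G ⋙ (specEquiv R).inverse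
  let e : A ⋙ tilde.functor R ≅ F :=
    Functor.isoWhiskerRight (Functor.isoWhiskerLeft G (specEquiv R).counitIso) (Spec R).isQCoh.ι
  have h := isColimitOfPreserves (tilde.functor R) (colimit.isColimit A)
  exact isQCoh.of_iso (h.coconePointsIsoOfNatIso hc e)
    (inferInstanceAs (tilde (colimit A)).IsQuasicoherent)

instance (X : Scheme.{u}) (J : Type u) [SmallCategory J] :
    X.isQCoh.IsClosedUnderColimitsOfShape J where
  colimitsOfShape_le := by
    rintro M ⟨p⟩
    exact isQCoh_of_restrict_fromSpec _ fun U hU => isQCoh_of_isColimit_Spec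
      (isColimitOfPreserves (Modules.restrictFunctor hU.fromSpec) p.isColimit)
      fun j => isQCoh_restrict _ (p.prop_diag_obj j)

instance (X : Scheme.{u}) : HasCoproducts.{u} X.QCoh := fun _ => inferInstance

variable {X Y : Scheme.{u}}

/-- The restriction of quasi-coherent sheaves along an open immersion. -/
noncomputable def qcohRestrict (f : Y ⟶ X) [IsOpenImmersion f] : X.QCoh ⥤ Y.QCoh :=
  Y.isQCoh.lift (X.isQCoh.ι ⋙ Modules.restrictFunctor f) fun M => isQCoh_restrict f M.2

instance (f : Y ⟶ X) [IsOpenImmersion f] (J : Type u) [SmallCategory J] :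
    PreservesColimitsOfShape J (qcohRestrict f) :=
  have : PreservesColimitsOfShape J (qcohRestrict f ⋙ Y.isQCoh.ι) :=
    inferInstanceAs (PreservesColimitsOfShape J (X.isQCoh.ι ⋙ Modules.restrictFunctor f))
  preservesColimitsOfShape_of_reflects_of_preserves (qcohRestrict f) Y.isQCoh.ι

instance (f : Y ⟶ X) [IsOpenImmersion f] : (qcohRestrict f).PreservesMonomorphisms where
  preserves g _ := by
    have := X.isQCoh.preservesMonomorphisms_ι_of_isNormalEpiCategory
    exact Y.isQCoh.ι.mono_of_mono_map
      (inferInstanceAs (Mono ((Modules.restrictFunctor f).map (X.isQCoh.ι.map g))))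

section

variable {U : X.Opens} (hU : IsAffineOpen U)

/-- The module of sections of a quasi-coherent sheaf over an affine open subset. -/
noncomputable def affineSections : X.QCoh ⥤ ModuleCat.{u} Γ(X, U) :=
  qcohRestrict hU.fromSpec ⋙ (specEquiv Γ(X, U)).inverse

instance : (affineSections hU).Additive where
  map_add := rfl

instance (J : Type u) [SmallCategory J] : PreservesColimitsOfShape J (affineSections hU) :=
  inferInstanceAs (PreservesColimitsOfShape J (_ ⋙ _))

instance : (affineSections hU).PreservesMonomorphisms :=
  inferInstanceAs (_ ⋙ _).PreservesMonomorphisms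

end

lemma exists_cofanTrunc_app_eq_of_isAffineOpen {U : X.Opens} (hU : IsAffineOpen U)
    {I : Type u} {Y : I → X.QCoh} {c : Cofan Y} (hc : IsColimit c) (x : Γ(c.pt.obj, U)) :
    ∃ S : Finset I, (cofanTrunc hc S).hom.app U x = x := by
  suffices ∀ (V : X.Opens) (_ : hU.fromSpec ''ᵁ ⊤ = V) (x : Γ(c.pt.obj, V)),
      ∃ S : Finset I, (cofanTrunc hc S).hom.app V x = x from this U (by simp) x
  rintro _ rfl x
  have h := isColimitCofanMkObjOfIsColimit (affineSections hU) _ c.inj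
    (IsColimit.ofIsoColimit hc (Cofan.ext (Iso.refl _) (by simp)))
  obtain ⟨S, hS⟩ := exists_cofanTrunc_apply_eq h x
  rw [← map_cofanTrunc hc (affineSections hU) h] at hS
  exact ⟨S, hS⟩

end

/-! ### Sections of sheaves of modules -/

section

open Scheme

variable {X : Scheme.{u}}

/-- The restriction of functions to a smaller open subset. -/
noncomputable def ringRes {U V : X.Opens} (h : U ≤ V) : Γ(X, V) →+* Γ(X, U) :=
  (X.presheaf.map (homOfLE h).op).hom

/-- The restriction of sections of a sheaf of modules to a smaller open subset. -/
noncomputable def moduleRes (M : X.Modules) {U V : X.Opens} (h : U ≤ V) : Γ(M, V) →+ Γ(M, U) :=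
  (M.presheaf.map (homOfLE h).op).hom

lemma ringRes_self {U : X.Opens} (x : Γ(X, U)) : ringRes le_rfl x = x :=
  congr($(X.presheaf.map_id (op U)) x)

lemma ringRes_ringRes {U V W : X.Opens} (h : U ≤ V) (h' : V ≤ W) (x : Γ(X, W)) :
    ringRes h (ringRes h' x) = ringRes (h.trans h') x :=
  congr($(X.presheaf.map_comp (homOfLE h').op (homOfLE h).op) x).symm

lemma basicOpen_ringRes {U V : X.Opens} (h : U ≤ V) (s : Γ(X, V)) :
    X.basicOpen (ringRes h s) = U ⊓ X.basicOpen s :=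
  X.basicOpen_res _ _

variable {M N : X.Modules}

lemma moduleRes_moduleRes {U V W : X.Opens} (h : U ≤ V) (h' : V ≤ W) (x : Γ(M, W)) :
    moduleRes M h (moduleRes M h' x) = moduleRes M (h.trans h') x :=
  congr($(M.presheaf.map_comp (homOfLE h').op (homOfLE h).op) x).symm

lemma moduleRes_smul {U V : X.Opens} (h : U ≤ V) (r : Γ(X, V)) (x : Γ(M, V)) :
    moduleRes M h (r • x) = ringRes h r • moduleRes M h x :=
  M.map_smul (homOfLE h) r x

lemma app_moduleRes (φ : M ⟶ N) {U V : X.Opens} (h : U ≤ V) (x : Γ(M, V)) :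
    φ.app U (moduleRes M h x) = moduleRes N h (φ.app V x) :=
  congr($(φ.mapPresheaf.naturality (homOfLE h).op) x)

section

variable {ι : Type*} {U : ι → X.Opens} {V : X.Opens} (hU : ∀ i, U i ≤ V) (hV : V ≤ ⨆ i, U i)

include hV in
lemma eq_of_moduleRes_eq {x y : Γ(M, V)}
    (h : ∀ i, moduleRes M (hU i) x = moduleRes M (hU i) y) : x = y :=
  TopCat.Sheaf.eq_of_locally_eq' ⟨M.presheaf, M.isSheaf⟩ U V (fun i => homOfLE (hU i)) hV x y h

include hV in
lemma exists_moduleRes_eq (s : ∀ i, Γ(M, U i))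
    (hs : ∀ i j, moduleRes M inf_le_left (s i) = moduleRes M (V := U j) inf_le_right (s j)) :
    ∃ x : Γ(M, V), ∀ i, moduleRes M (hU i) x = s i :=
  (TopCat.Sheaf.existsUnique_gluing' ⟨M.presheaf, M.isSheaf⟩ U V (fun i => homOfLE (hU i)) hV
    s hs).exists

end

/-- `U` is a cover of the open subset `V` by affine open subsets. -/
structure IsAffineCover {ι : Type*} (U : ι → X.Opens) (V : X.Opens) : Prop where
  isAffineOpen (i : ι) : IsAffineOpen (U i)
  le (i : ι) : U i ≤ V
  le_iSup : V ≤ ⨆ i, U i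

lemma exists_isAffineCover (V : X.Opens) : ∃ (ι : Type u) (U : ι → X.Opens), IsAffineCover U V := by
  obtain ⟨s, hs, rfl⟩ := Opens.isBasis_iff_cover.1 X.isBasis_affineOpens V
  exact ⟨s, Subtype.val, fun i => hs i.2, fun i => le_sSup i.2, (sSup_eq_iSup' s).le⟩

lemma exists_finite_isAffineCover {V : X.Opens} (hV : IsCompact (V : Set X)) :
    ∃ (ι : Type u) (_ : Finite ι) (U : ι → X.Opens), IsAffineCover U V := by
  obtain ⟨s, hs, rfl⟩ := isCompact_iff_finite_and_eq_biUnion_affineOpens.1 hV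
  exact ⟨s, hs, fun i => i.1.1, fun i => i.1.2, fun i => le_iSup₂_of_le i.1 i.2 le_rfl,
    iSup₂_le fun i hi => le_iSup (fun i : s => i.1.1) ⟨i, hi⟩⟩

lemma hom_ext_of_isAffineOpen {φ ψ : M ⟶ N}
    (h : ∀ U : X.Opens, IsAffineOpen U → ∀ x : Γ(M, U), φ.app U x = ψ.app U x) : φ = ψ := by
  refine Modules.hom_ext _ _ fun V => ?_
  ext x
  obtain ⟨ι, U, hU⟩ := exists_isAffineCover V
  refine eq_of_moduleRes_eq hU.le hU.le_iSup fun i => ?_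
  rw [← app_moduleRes, ← app_moduleRes, h _ (hU.isAffineOpen i)]

variable {I : Type u} {Y : I → X.QCoh} {c : Cofan Y} (hc : IsColimit c)

lemma cofanTrunc_app_eq_of_subset {S S' : Finset I} (h : S ⊆ S') {U : X.Opens}
    {x : Γ(c.pt.obj, U)} (hx : (cofanTrunc hc S).hom.app U x = x) :
    (cofanTrunc hc S').hom.app U x = x := by
  have hcomp := congr(($(cofanTrunc_comp_of_subset hc h)).hom.app U x)
  change (cofanTrunc hc S').hom.app U ((cofanTrunc hc S).hom.app U x) = _ at hcomp
  rwa [hx] at hcomp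

lemma exists_cofanTrunc_app_eq {V : X.Opens} (hV : IsCompact (V : Set X)) (x : Γ(c.pt.obj, V)) :
    ∃ S : Finset I, (cofanTrunc hc S).hom.app V x = x := by
  classical
  obtain ⟨ι, _, U, hU⟩ := exists_finite_isAffineCover hV
  have := Fintype.ofFinite ι
  choose S hS using fun i => exists_cofanTrunc_app_eq_of_isAffineOpen (hU.isAffineOpen i) hc
    (moduleRes c.pt.obj (hU.le i) x)
  refine ⟨Finset.univ.biUnion S, eq_of_moduleRes_eq hU.le hU.le_iSup fun i => ?_⟩
  rw [← app_moduleRes]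
  exact cofanTrunc_app_eq_of_subset hc (Finset.subset_biUnion_of_mem S (Finset.mem_univ i)) (hS i)

include hc in
lemma eq_zero_of_comp_cofanProj_eq_zero {P : X.QCoh} {f : P ⟶ c.pt}
    (hf : ∀ k, f ≫ cofanProj hc k = 0) : f = 0 := by
  refine X.isQCoh.hom_ext (hom_ext_of_isAffineOpen fun U hU x => ?_)
  obtain ⟨S, hS⟩ := exists_cofanTrunc_app_eq_of_isAffineOpen hU hc (f.hom.app U x)
  rw [← hS]
  exact congr(($(comp_cofanTrunc_eq_zero hc hf S)).hom.app U x)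

instance (X : Scheme.{u}) (I : Type u) : HasExactColimitsOfShape (Discrete I) X.QCoh :=
  hasExactColimitsOfShape_discrete_of_jointly_mono fun hc _ _ hf =>
    eq_zero_of_comp_cofanProj_eq_zero hc hf

end

/-! ### Direct images of quasi-coherent sheaves -/

section

open Scheme

variable {X : Scheme.{u}} (M : X.Modules) {V : X.Opens}

/-- The restriction of sections of `M` from `V` to the locus where the function `s` is invertible
is a localization map: up to powers of `s`, all sections lift and only zero restricts to zero. -/
def IsLocalizingAt (s : Γ(X, V)) : Prop :=
  (∀ x : Γ(M, X.basicOpen s), ∃ (n : ℕ) (y : Γ(M, V)),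
    ringRes (X.basicOpen_le s) (s ^ n) • x = moduleRes M (X.basicOpen_le s) y) ∧
  ∀ y : Γ(M, V), moduleRes M (X.basicOpen_le s) y = 0 → ∃ n : ℕ, s ^ n • y = 0

variable {M} in
lemma isLocalizingAt_iff {s : Γ(X, V)} {W : X.Opens} (h : W ≤ V) (hW : W = X.basicOpen s) :
    IsLocalizingAt M s ↔
      (∀ x : Γ(M, W), ∃ (n : ℕ) (y : Γ(M, V)), ringRes h (s ^ n) • x = moduleRes M h y) ∧
        ∀ y : Γ(M, V), moduleRes M h y = 0 → ∃ n : ℕ, s ^ n • y = 0 := by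
  subst hW
  rfl

lemma isLocalizingAt_ringRes_iff {V' : X.Opens} (e : V' = V) (s : Γ(X, V)) :
    IsLocalizingAt M (ringRes e.le s) ↔ IsLocalizingAt M s := by
  subst e
  rw [ringRes_self]

lemma smul_restrict_fromSpec {U : X.Opens} (hU : IsAffineOpen U) (U' : (Spec Γ(X, U)).Opens)
    (h : hU.fromSpec ''ᵁ U' ≤ U) (r : Γ(X, U)) (x : Γ(M.restrict hU.fromSpec, U')) :
    (r • x : Γ(M.restrict hU.fromSpec, U')) =
      ringRes h r • (show Γ(M, hU.fromSpec ''ᵁ U') from x) := by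
  have hle : U' ≤ hU.fromSpec ⁻¹ᵁ U := by
    rw [hU.fromSpec_preimage_self]
    exact le_top
  have ringHom_eq : (Scheme.ΓSpecIso Γ(X, U)).inv ≫ (Spec Γ(X, U)).presheaf.map U'.leTop.op ≫
      (hU.fromSpec.appIso U').inv = X.presheaf.map (homOfLE h).op := by
    refine Eq.trans ?_ (hU.fromSpec.appLE_appIso_inv hle)
    rw [Scheme.Hom.appLE, hU.fromSpec_app_self, Category.assoc, Category.assoc,
      ← Functor.map_comp_assoc]
    rfl
  exact congr($ringHom_eq r • (show Γ(M, hU.fromSpec ''ᵁ U') from x))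

lemma isQCoh_restrict_fromSpec_iff {U : X.Opens} (hU : IsAffineOpen U) :
    (Spec Γ(X, U)).isQCoh ((Modules.restrictFunctor hU.fromSpec).obj M) ↔
      ∀ s : Γ(X, U), IsLocalizingAt M s := by
  have hle : hU.fromSpec ''ᵁ ⊤ = U := by simp
  rw [isQCoh_Spec_iff]
  refine forall_congr' fun s => forall_eq.trans ?_
  have hW : hU.fromSpec ''ᵁ PrimeSpectrum.basicOpen s = X.basicOpen (ringRes hle.le s) := by
    rw [hU.fromSpec_image_basicOpen, basicOpen_ringRes, hle, inf_eq_right.2 (X.basicOpen_le s)]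
  have pow_smul (U' : (Spec Γ(X, U)).Opens) (h : hU.fromSpec ''ᵁ U' ≤ hU.fromSpec ''ᵁ ⊤) (n : ℕ)
      (x : Γ(M.restrict hU.fromSpec, U')) : (s ^ n • x : Γ(M.restrict hU.fromSpec, U')) =
        ringRes h (ringRes hle.le s ^ n) • (show Γ(M, hU.fromSpec ''ᵁ U') from x) := by
    rw [← map_pow, ringRes_ringRes]
    exact smul_restrict_fromSpec M hU U' (h.trans hle.le) (s ^ n) x
  rw [← isLocalizingAt_ringRes_iff M hle s, isLocalizingAt_iff (Scheme.Hom.image_mono _ le_top) hW]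
  refine and_congr
    (forall_congr' fun x => exists₂_congr fun n y => Eq.congr_left (pow_smul _ _ n x))
    (forall_congr' fun y => imp_congr_right fun _ => exists_congr fun n => Eq.congr_left ?_)
  rw [pow_smul ⊤ le_rfl, ringRes_self]

lemma isQCoh_iff_isLocalizingAt :
    X.isQCoh M ↔ ∀ U : X.Opens, IsAffineOpen U → ∀ s : Γ(X, U), IsLocalizingAt M s :=
  ⟨fun h _ hU => (isQCoh_restrict_fromSpec_iff M hU).1 (isQCoh_restrict _ h),
    fun h => isQCoh_of_restrict_fromSpec M fun U hU =>
      (isQCoh_restrict_fromSpec_iff M hU).2 (h U hU)⟩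

variable {M}

lemma IsLocalizingAt.eventually_pow_smul_eq_zero {s : Γ(X, V)} (hs : IsLocalizingAt M s)
    {W : X.Opens} (h : W ≤ V) (hW : W = X.basicOpen s) {y : Γ(M, V)} (hy : moduleRes M h y = 0) :
    ∀ᶠ n : ℕ in Filter.atTop, s ^ n • y = 0 := by
  obtain ⟨n, hn⟩ := ((isLocalizingAt_iff h hW).1 hs).2 y hy
  filter_upwards [Filter.eventually_ge_atTop n] with m hm
  rw [← Nat.sub_add_cancel hm, pow_add, mul_smul, hn, smul_zero]

lemma IsLocalizingAt.eventually_exists_moduleRes_eq {s : Γ(X, V)} (hs : IsLocalizingAt M s)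
    {W : X.Opens} (h : W ≤ V) (hW : W = X.basicOpen s) (x : Γ(M, W)) :
    ∀ᶠ n : ℕ in Filter.atTop, ∃ y : Γ(M, V), moduleRes M h y = ringRes h (s ^ n) • x := by
  obtain ⟨n, y, hy⟩ := ((isLocalizingAt_iff h hW).1 hs).1 x
  filter_upwards [Filter.eventually_ge_atTop n] with m hm
  exact ⟨s ^ (m - n) • y, by
    rw [moduleRes_smul, ← hy, smul_smul, ← map_mul, ← pow_add, Nat.sub_add_cancel hm]⟩

variable (hM : X.isQCoh M)
include hM

lemma eventually_pow_smul_eq_zero (hV : IsCompact (V : Set X)) {s : Γ(X, V)} {W : X.Opens}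
    (h : W ≤ V) (hW : W = X.basicOpen s) {y : Γ(M, V)} (hy : moduleRes M h y = 0) :
    ∀ᶠ n : ℕ in Filter.atTop, s ^ n • y = 0 := by
  obtain ⟨ι, _, U, hU⟩ := exists_finite_isAffineCover hV
  have local_eq_zero (i : ι) : ∀ᶠ n : ℕ in Filter.atTop,
      ringRes (hU.le i) s ^ n • moduleRes M (hU.le i) y = 0 := by
    have hs := (isQCoh_iff_isLocalizingAt M).1 hM _ (hU.isAffineOpen i) (ringRes (hU.le i) s)
    refine hs.eventually_pow_smul_eq_zero (W := U i ⊓ W) inf_le_left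
      (by rw [basicOpen_ringRes, hW]) ?_
    rw [moduleRes_moduleRes, ← moduleRes_moduleRes inf_le_right h, hy, map_zero]
  filter_upwards [Filter.eventually_all.2 local_eq_zero] with n hn
  refine eq_of_moduleRes_eq hU.le hU.le_iSup fun i => ?_
  rw [map_zero, moduleRes_smul, map_pow, hn]

section

variable {ι : Type*} [Finite ι] {U : ι → X.Opens} (hU : IsAffineCover U V) {s : Γ(X, V)}
  {W : X.Opens} (h : W ≤ V) (hW : W = X.basicOpen s)
include hU hW

lemma exists_forall_moduleRes_eq_pow_smul (x : Γ(M, W)) :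
    ∃ (n : ℕ) (y : ∀ i, Γ(M, U i)), ∀ i, moduleRes M (inf_le_left : U i ⊓ W ≤ U i) (y i) =
      moduleRes M inf_le_right (ringRes h (s ^ n) • x) := by
  have local_lift (i : ι) : ∀ᶠ n : ℕ in Filter.atTop, ∃ y : Γ(M, U i),
      moduleRes M (inf_le_left : U i ⊓ W ≤ U i) y =
        moduleRes M inf_le_right (ringRes h (s ^ n) • x) := by
    have hs := (isQCoh_iff_isLocalizingAt M).1 hM _ (hU.isAffineOpen i) (ringRes (hU.le i) s)
    filter_upwards [hs.eventually_exists_moduleRes_eq inf_le_left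
      (by rw [basicOpen_ringRes, hW]) (moduleRes M (inf_le_right : U i ⊓ W ≤ W) x)] with n hn
    obtain ⟨y, hy⟩ := hn
    refine ⟨y, hy.trans ?_⟩
    rw [moduleRes_smul, ← map_pow, ringRes_ringRes, ringRes_ringRes]
  obtain ⟨n, hn⟩ := (Filter.eventually_all.2 local_lift).exists
  choose y hy using hn
  exact ⟨n, y, hy⟩

lemma exists_forall_moduleRes_eq_pow_smul_of_isQuasiSeparated
    (hV : IsQuasiSeparated (V : Set X)) {x : Γ(M, W)} {y : ∀ i, Γ(M, U i)}
    (hy : ∀ i, moduleRes M (inf_le_left : U i ⊓ W ≤ U i) (y i) = moduleRes M inf_le_right x) :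
    ∃ (n : ℕ) (z : Γ(M, V)), ∀ i, moduleRes M (hU.le i) z = ringRes (hU.le i) (s ^ n) • y i := by
  have local_agree (i j : ι) : ∀ᶠ n : ℕ in Filter.atTop,
      ringRes (inf_le_left.trans (hU.le i) : U i ⊓ U j ≤ V) s ^ n •
        (moduleRes M (inf_le_left : U i ⊓ U j ≤ U i) (y i) -
          moduleRes M (inf_le_right : U i ⊓ U j ≤ U j) (y j)) = 0 := by
    have hcompact : IsCompact ((U i ⊓ U j : X.Opens) : Set X) :=
      hV _ _ (hU.le i) (U i).2 (hU.isAffineOpen i).isCompact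
        (hU.le j) (U j).2 (hU.isAffineOpen j).isCompact
    refine eventually_pow_smul_eq_zero hM hcompact (W := U i ⊓ U j ⊓ W) inf_le_left
      (by rw [basicOpen_ringRes, hW]) ?_
    rw [map_sub, moduleRes_moduleRes, moduleRes_moduleRes, sub_eq_zero,
      ← moduleRes_moduleRes (le_inf (inf_le_left.trans inf_le_left) inf_le_right) inf_le_left, hy,
      ← moduleRes_moduleRes (le_inf (inf_le_left.trans inf_le_right) inf_le_right) inf_le_left, hy,
      moduleRes_moduleRes, moduleRes_moduleRes]
  obtain ⟨n, hn⟩ :=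
    (Filter.eventually_all.2 fun i => Filter.eventually_all.2 (local_agree i)).exists
  refine ⟨n, exists_moduleRes_eq hU.le hU.le_iSup _ fun i j => ?_⟩
  rw [moduleRes_smul, moduleRes_smul, ringRes_ringRes, ringRes_ringRes, ← sub_eq_zero, ← smul_sub,
    map_pow]
  exact hn i j

end

lemma isLocalizingAt_of_isQCoh (hV : IsCompact (V : Set X)) (hV' : IsQuasiSeparated (V : Set X))
    (s : Γ(X, V)) : IsLocalizingAt M s := by
  refine ⟨fun x => ?_, fun y hy =>
    (eventually_pow_smul_eq_zero hM hV (X.basicOpen_le s) rfl hy).exists⟩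
  obtain ⟨ι, _, U, hU⟩ := exists_finite_isAffineCover hV
  obtain ⟨n, y, hy⟩ := exists_forall_moduleRes_eq_pow_smul hM hU (X.basicOpen_le s) rfl x
  obtain ⟨k, z, hz⟩ := exists_forall_moduleRes_eq_pow_smul_of_isQuasiSeparated hM hU rfl hV' hy
  refine ⟨k + n, z, eq_of_moduleRes_eq (U := fun i => U i ⊓ X.basicOpen s) (fun _ => inf_le_right)
    (by rw [← iSup_inf_eq]; exact le_inf ((X.basicOpen_le s).trans hU.le_iSup) le_rfl) fun i => ?_⟩
  rw [moduleRes_moduleRes, ← moduleRes_moduleRes inf_le_left (hU.le i), hz, moduleRes_smul,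
    moduleRes_smul, hy, moduleRes_smul, ringRes_ringRes, ringRes_ringRes, ringRes_ringRes,
    smul_smul, ← map_mul, ← pow_add]

lemma isQCoh_pushforward {Z : Scheme.{u}} (f : X ⟶ Z) [QuasiCompact f] [QuasiSeparated f] :
    Z.isQCoh ((Modules.pushforward f).obj M) := by
  refine (isQCoh_iff_isLocalizingAt _).2 fun U hU s => ?_
  have map_pow_app (n : ℕ) : ringRes (Scheme.Hom.preimage_mono f (Z.basicOpen_le s))
      (f.app U s ^ n) = f.app (Z.basicOpen s) (ringRes (Z.basicOpen_le s) (s ^ n)) := by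
    rw [← map_pow]
    exact congr($(f.naturality (homOfLE (Z.basicOpen_le s)).op) (s ^ n)).symm
  obtain ⟨exists_lift, exists_pow_smul_eq_zero⟩ :=
    (isLocalizingAt_iff (Scheme.Hom.preimage_mono f (Z.basicOpen_le s))
      (Scheme.preimage_basicOpen f s)).1 (isLocalizingAt_of_isQCoh hM
        (f.isCompact_preimage hU.isCompact) (f.isQuasiSeparated_preimage hU.isQuasiSeparated)
        (f.app U s))
  refine ⟨fun x => ?_, fun y hy => ?_⟩
  · obtain ⟨n, y, hy⟩ := exists_lift x
    exact ⟨n, y, .trans (by rw [map_pow_app]; rfl) hy⟩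
  · obtain ⟨n, hn⟩ := exists_pow_smul_eq_zero y hy
    exact ⟨n, .trans (by rw [← map_pow]; rfl) hn⟩

end

/-! ### Injective quasi-coherent sheaves -/

section

open Scheme

variable {X Y : Scheme.{u}}

section

variable (f : Y ⟶ X) [QuasiCompact f] [QuasiSeparated f]

/-- The direct image of quasi-coherent sheaves along a quasi-compact quasi-separated morphism. -/
noncomputable def qcohPushforward : Y.QCoh ⥤ X.QCoh :=
  X.isQCoh.lift (Y.isQCoh.ι ⋙ Modules.pushforward f) fun M => isQCoh_pushforward M.2 f

instance : (qcohPushforward f).Additive where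
  map_add := rfl

instance (I : Type u) : PreservesColimitsOfShape (Discrete I) (qcohPushforward f) := by
  refine @preservesColimitsOfShape_of_discrete _ _ _ _ _ _ fun Z => ?_
  have hc := coproductIsCoproduct Z
  have hd := coproductIsCoproduct fun i => (qcohPushforward f).obj (Z i)
  let φ := sigmaComparison (qcohPushforward f) Z
  have : Mono φ := mono_of_forall_inj_comp_eq_map (qcohPushforward f) hc hd
    (fun i => ι_comp_sigmaComparison _ _ i) fun _ => eq_zero_of_comp_cofanProj_eq_zero hd
  have : Epi φ := by
    refine (Preadditive.epi_iff_cancel_zero _).2 fun Q g hg => ?_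
    refine X.isQCoh.hom_ext (hom_ext_of_isAffineOpen fun U hU x => ?_)
    obtain ⟨S, hS⟩ := exists_cofanTrunc_app_eq hc (f.isCompact_preimage hU.isCompact) x
    have hzero := map_cofanTrunc_comp_eq_zero (qcohPushforward f) hc (g := g) (fun k => by
      have hk := Sigma.ι (fun i => (qcohPushforward f).obj (Z i)) k ≫= hg
      rwa [ι_comp_sigmaComparison_assoc, comp_zero] at hk) S
    exact (congr(g.hom.app U $hS)).symm.trans congr(($hzero).hom.app U x)
  have := isIso_of_mono_of_epi φ
  exact PreservesCoproduct.of_iso_comparison _ _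

end

/-- Restriction along a quasi-compact open immersion is left adjoint to the direct image. -/
noncomputable def qcohRestrictAdjunction (f : Y ⟶ X) [IsOpenImmersion f] [QuasiCompact f] :
    qcohRestrict f ⊣ qcohPushforward f :=
  (Modules.restrictAdjunction f).restrictFullyFaithful X.isQCoh.fullyFaithfulι
    Y.isQCoh.fullyFaithfulι (Iso.refl _) (Iso.refl _)

section

variable [QuasiSeparatedSpace X] {U : X.Opens} (hU : IsAffineOpen U)

/-- The direct image on `X` of the quasi-coherent sheaf on the affine open subset `U` associated
with a module. -/
noncomputable def affinePushforward : ModuleCat.{u} Γ(X, U) ⥤ X.QCoh :=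
  (specEquiv Γ(X, U)).functor ⋙ qcohPushforward hU.fromSpec

instance (I : Type u) : PreservesColimitsOfShape (Discrete I) (affinePushforward hU) :=
  inferInstanceAs (PreservesColimitsOfShape (Discrete I) (_ ⋙ _))

/-- The sections over an affine open subset are left adjoint to the direct image. -/
noncomputable def affineSectionsAdjunction : affineSections hU ⊣ affinePushforward hU :=
  (qcohRestrictAdjunction hU.fromSpec).comp (specEquiv Γ(X, U)).symm.toAdjunction

end

lemma eq_of_affineSections_map_eq {ι : Type*} {U : ι → X.Opens} (hU : IsAffineCover U ⊤)
    {M N : X.QCoh} (φ ψ : M ⟶ N)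
    (h : ∀ i, (affineSections (hU.isAffineOpen i)).map φ =
      (affineSections (hU.isAffineOpen i)).map ψ) : φ = ψ := by
  have restrict_eq (i : ι) : (qcohRestrict (hU.isAffineOpen i).fromSpec).map φ =
      (qcohRestrict (hU.isAffineOpen i).fromSpec).map ψ :=
    (specEquiv Γ(X, U i)).inverse.map_injective (h i)
  have app_eq (i : ι) (W : X.Opens) (hW : W ≤ U i) (x : Γ(M.obj, W)) :
      φ.hom.app W x = ψ.hom.app W x := by
    obtain ⟨W', rfl⟩ : ∃ W', (hU.isAffineOpen i).fromSpec ''ᵁ W' = W :=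
      ⟨(hU.isAffineOpen i).fromSpec ⁻¹ᵁ W, by
        rw [Scheme.Hom.image_preimage_eq_opensRange_inf, (hU.isAffineOpen i).opensRange_fromSpec,
          inf_eq_right.2 hW]⟩
    exact congr(($(restrict_eq i)).hom.app W' x)
  refine X.isQCoh.hom_ext (Modules.hom_ext _ _ fun V => ?_)
  ext x
  refine eq_of_moduleRes_eq (U := fun i => V ⊓ U i) (fun i => inf_le_left)
    (by rw [← inf_iSup_eq]; exact le_inf le_rfl (le_top.trans hU.le_iSup)) fun i => ?_
  rw [← app_moduleRes, ← app_moduleRes, app_eq i _ inf_le_right]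

attribute [local instance] Abelian.hasFiniteBiproducts

instance [CompactSpace X] [QuasiSeparatedSpace X] : EnoughInjectives X.QCoh := by
  obtain ⟨ι, _, U, hU⟩ := exists_finite_isAffineCover (X := X) (V := ⊤) CompactSpace.isCompact_univ
  exact enoughInjectives_of_adjunctions
    (fun i => affineSectionsAdjunction (hU.isAffineOpen i)) (eq_of_affineSections_map_eq hU)

instance [AlgebraicGeometry.IsNoetherian X] (I : Type u) :
    (isInjective X.QCoh).IsClosedUnderColimitsOfShape (Discrete I) := by
  obtain ⟨ι, _, U, hU⟩ := exists_finite_isAffineCover (X := X) (V := ⊤) CompactSpace.isCompact_univ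
  have (i : ι) : IsNoetherianRing Γ(X, U i) :=
    IsLocallyNoetherian.component_noetherian ⟨U i, hU.isAffineOpen i⟩
  exact isClosedUnderColimitsOfShape_isInjective_of_adjunctions
    (fun i => affineSectionsAdjunction (hU.isAffineOpen i)) (eq_of_affineSections_map_eq hU)

end

/-! ### Coherent sheaves -/

section

open Scheme

variable {X : Scheme.{u}}

/-- The section over `U` given by a global section of the restriction of `M` to `U`. -/
def sectionOver (M : X.Modules) {U : X.Opens} (s : (SheafOfModules.over M U).sections) : Γ(M, U) :=
  s.1 (op (Over.mk (𝟙 U)))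

lemma app_eq_of_generatingSections {M N : X.Modules} {U : X.Opens}
    (σ : SheafOfModules.GeneratingSections (SheafOfModules.over M U)) {φ ψ : M ⟶ N}
    (h : ∀ j, φ.app U (sectionOver M (σ.s j)) = ψ.app U (sectionOver M (σ.s j)))
    {V : X.Opens} (hV : V ≤ U) (x : Γ(M, V)) : φ.app V x = ψ.app V x := by
  have over_eq : SheafOfModules.Hom.over φ U = SheafOfModules.Hom.over ψ U := by
    rw [← cancel_epi σ.π, SheafOfModules.freeHomEquiv_symm_comp,
      SheafOfModules.freeHomEquiv_symm_comp]
    congr 1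
    funext j
    refine PresheafOfModules.sections_ext _ _ fun W => ?_
    have section_eq : (σ.s j).1 W = moduleRes M (leOfHom W.unop.hom) (sectionOver M (σ.s j)) :=
      (PresheafOfModules.sections_property (σ.s j)
        (Over.homMk W.unop.hom : W.unop ⟶ Over.mk (𝟙 U)).op).symm
    change φ.app W.unop.left ((σ.s j).1 W) = ψ.app W.unop.left ((σ.s j).1 W)
    rw [section_eq, app_moduleRes, app_moduleRes, h]
  exact congr(($over_eq).val.app (op (Over.mk (homOfLE hV))) x)

lemma exists_cofanTrunc_app_app_eq {M : X.QCoh} {I : Type u} {Y : I → X.QCoh} {c : Cofan Y}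
    (hc : IsColimit c) (f : M ⟶ c.pt) {U : X.Opens} (hU : IsCompact (U : Set X))
    (σ : SheafOfModules.GeneratingSections (SheafOfModules.over M.obj U)) [Finite σ.I] :
    ∃ S : Finset I, ∀ (V : X.Opens) (_ : V ≤ U) (x : Γ(M.obj, V)),
      (cofanTrunc hc S).hom.app V (f.hom.app V x) = f.hom.app V x := by
  classical
  have := Fintype.ofFinite σ.I
  choose S hS using fun j => exists_cofanTrunc_app_eq hc hU
    (f.hom.app U (sectionOver M.obj (σ.s j)))
  refine ⟨Finset.univ.biUnion S, fun V hV => ?_⟩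
  exact app_eq_of_generatingSections σ (φ := f.hom ≫ (cofanTrunc hc _).hom) (fun j =>
    cofanTrunc_app_eq_of_subset hc (Finset.subset_biUnion_of_mem S (Finset.mem_univ j)) (hS j)) hV

lemma isFinitelySupported_of_isFiniteType [NoetherianSpace X] (M : X.QCoh)
    (hM : M.obj.IsFiniteType) : IsFinitelySupported.{u} M := by
  classical
  intro I Y c hc f
  obtain ⟨σ, hσ⟩ := hM.exists_localGeneratorsData
  obtain ⟨T, hT⟩ := (CompactSpace.isCompact_univ (X := X)).elim_finite_subcover
    (fun i => (σ.X i : Set X)) (fun i => (σ.X i).2) (by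
      rw [← Opens.coe_iSup, (Opens.coversTop_iff _ _).1 σ.coversTop]
      exact subset_rfl)
  have (i : σ.I) : Finite (σ.generators i).I := (hσ.isFiniteType i).finite
  choose S hS using fun i : σ.I =>
    exists_cofanTrunc_app_app_eq hc f (NoetherianSpace.isCompact (σ.X i : Set X)) (σ.generators i)
  refine ⟨T.biUnion S, X.isQCoh.hom_ext (Modules.hom_ext _ _ fun V => ?_)⟩
  ext x
  refine eq_of_moduleRes_eq (U := fun i : T => V ⊓ σ.X i) (fun i => inf_le_left)
    (fun y hy => ?_) fun i => ?_
  · obtain ⟨i, hi, hyi⟩ := Set.mem_iUnion₂.1 (hT (Set.mem_univ y))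
    exact Opens.mem_iSup.2 ⟨⟨i, hi⟩, hy, hyi⟩
  · have local_eq := cofanTrunc_app_eq_of_subset hc (Finset.subset_biUnion_of_mem S i.2)
      (hS i _ inf_le_right (moduleRes M.obj (inf_le_left : V ⊓ σ.X i ≤ V) x))
    rw [← app_moduleRes, ← app_moduleRes]
    exact local_eq

end

end CoApprox

open CoApprox in
theorem mainTheorem7_general {C : Type v₁} [Category.{v₂} C] [Abelian C] [EnoughInjectives C]
    [HasDerivedCategory.{u} C] [HasCoproducts.{w} C]
    [∀ I : Type w, HasExactColimitsOfShape (Discrete I) C]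
    [∀ I : Type w, (isInjective C).IsClosedUnderColimitsOfShape (Discrete I)]
    (G : DerivedCategory C) {a b : ℤ} (ha : G.IsGE a) (hb : G.IsLE b)
    (hG : ∀ n : ℤ, IsFinitelySupported.{w} ((DerivedCategory.homologyFunctor C n).obj G))
    (N : ℕ) (hgen : bigGen.{w} G Set.univ N = ⊤) :
    IsCoapproximable.{w} (HomotopyCategory (InjectiveObject C) (ComplexShape.up ℤ)) ∧
      IsCoapproximableVia.{w} (homotopyGE (InjectiveObject C) 0)
        (homotopyLE (InjectiveObject C) 0) := by
  obtain ⟨H, hH, ⟨e⟩⟩ := exists_kInjToD_iso G a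
  have via := isCoapproximableVia_of_bigGen_eq_top hH e hb hG hgen
  exact ⟨⟨_, _, via⟩, via⟩

theorem mainTheorem7 (X : Scheme.{u}) [AlgebraicGeometry.IsNoetherian X]
    [HasDerivedCategory.{w} X.QCoh]
    (G : DerivedCategory X.QCoh) (hG : Scheme.IsBoundedCoherent G)
    (N : ℕ) (hN : 0 < N) (hgen : CoApprox.bigGen.{u} G Set.univ N = ⊤) :
    CoApprox.IsCoapproximable.{u} X.KInj ∧
      CoApprox.IsCoapproximableVia.{u} X.kInjGE X.kInjLE := by
  obtain ⟨⟨a, b, ha, hb⟩, hcoh⟩ := hG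
  exact mainTheorem7_general G ha hb
    (fun n => CoApprox.isFinitelySupported_of_isFiniteType _ (hcoh n)) N hgen
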